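/- Let $d\ge 1$. Let $\Omega\subset\mathbb{R}^d$ be a root system, i.e. a finite set of non-zero vectors stable under the orthogonal reflections $\sigma_\alpha$ in the hyperplanes $\alpha^\perp$, $\alpha\in\Omega$, and let $\kappa\colon\Omega\to[0,\infty)$ be a multiplicity function, i.e. $\kappa$ is invariant under the group generated by the $\sigma_\alpha$. Put $\langle\kappa\rangle=\frac12\sum_{\alpha\in\Omega}\kappa(\alpha)$ and $\lambda_\kappa=\langle\kappa\rangle+\frac{d-2}{2}$, and let $a>0$ be such that $2\lambda_\kappa+a>0$. Put $\lambda_{\kappa,a}=2\lambda_\kappa/a$ and $$d\mu_{\kappa,a}(x)=c_{\kappa,a}\,|x|^{a-2}\prod_{\alpha\in\Omega}|\langle\alpha,x\rangle|^{\kappa(\alpha)}\,dx,\qquad c_{\kappa,a}^{-1}=\int_{\mathbb{R}^d}e^{-|x|^a/a}\,|x|^{a-2}\prod_{\alpha\in\Omega}|\langle\alpha,x\rangle|^{\kappa(\alpha)}\,dx .$$ Let $$\Delta_\kappa f(x)=\Delta f(x)+\frac12\sum_{\alpha\in\Omega}\kappa(\alpha)\Bigl(\frac{2\langle\nabla f(x),\alpha\rangle}{\langle\alpha,x\rangle}-|\alpha|^2\,\frac{f(x)-f(\sigma_\alpha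 x)}{\langle\alpha,x\rangle^2}\Bigr)$$ be the Dunkl Laplacian and $\Delta_{\kappa,a}=|x|^{2-a}\Delta_\kappa-|x|^a$. The operator $\Delta_{\kappa,a}$ is considered as a self-adjoint operator on $L^2(\mathbb{R}^d,d\mu_{\kappa,a})$, namely as the closure of its restriction to the linear span of the functions $p(x)\,|x|^{aj}e^{-|x|^a/a}$, where $j\in\{0,1,2,\dots\}$ and $p$ is a homogeneous polynomial with $\Delta_\kappa p=0$. The $(\kappa,a)$-generalized Fourier transform is the unitary operator $$\mathcal{F}_{\kappa,a}=\exp\Bigl(\frac{i\pi}{2}(\lambda_{\kappa,a}+1)\Bigr)\exp\Bigl(\frac{i\pi}{2a}\,\Delta_{\kappa,a}\Bigr)\quad\text{on } L^2(\mathbb{R}^d,d\mu_{\kappa,a}).$$ Elements of $L^2(\mathbb{R}^d,d\mu_{\kappa,a})$ are identified with functions up to equality almost everywhere, and $\mathbb{N}=\{1,2,\dots\}$. Then: (i) If $\mathcal{F}_{\kappa,a}(\mathcal{S}(\mathbb{R}^d))\subset C^\infty(\mathbb{R}^d)$, then $\frac a2\in\mathbb{N}$. (ii) If every function $g\in\mathcal{F}_{\kappa,a}(\mathcal{S}(\mathbb{R}^d))$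 is rapidly decreasing at infinity, i.e. $g(y)=O(|y|^{-N})$ as $|y|\to\infty$ for every $N\in\mathbb{N}$, then $\frac 2a\in\mathbb{N}$. (iii) If $\mathcal{F}_{\kappa,a}(\mathcal{S}(\mathbb{R}^d))=\mathcal{S}(\mathbb{R}^d)$, then $a=2$. Moreover, if $a\neq 2$, then $\mathcal{S}(\mathbb{R}^d)$ is not invariant under $\mathcal{F}_{\kappa,a}$, i.e. $\mathcal{F}_{\kappa,a}(\mathcal{S}(\mathbb{R}^d))\not\subset\mathcal{S}(\mathbb{R}^d)$. -/

import Mathlib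

open MeasureTheory
open scoped ContDiff SchwartzMap InnerProductSpace

noncomputable section

namespace DunklA

/-- `ℝ^d` with its Euclidean structure. -/
abbrev E (d : ℕ) := EuclideanSpace ℝ (Fin d)

variable {d : ℕ}

/-- The orthogonal reflection `σ_α` in the hyperplane orthogonal to `α`. -/
def sigma (α x : E d) : E d := (ℝ ∙ α)ᗮ.reflection x

/-- A root system in the sense of Dunkl theory: a finite set of non-zero vectors that is stable
under the reflections in its members (it need be neither spanning nor crystallographic,
and reduced systems are a special case). -/
structure IsRootSystem (R : Finset (E d)) : Prop where
  ne_zero : ∀ α ∈ R, α ≠ 0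
  sigma_mem : ∀ α ∈ R, ∀ β ∈ R, sigma α β ∈ R

/-- A non-negative multiplicity function on `R`, invariant under the group generated by the
reflections. Only the values on `R` matter. -/
structure IsMultiplicity (R : Finset (E d)) (κ : E d → ℝ) : Prop where
  nonneg : ∀ α ∈ R, 0 ≤ κ α
  invariant : ∀ α ∈ R, ∀ β ∈ R, κ (sigma α β) = κ β

/-- `⟨κ⟩ = (1/2) ∑_{α ∈ R} κ(α)`. -/
def index (R : Finset (E d)) (κ : E d → ℝ) : ℝ := (1 / 2) * ∑ α ∈ R, κ α

/-- `λ_κ = ⟨κ⟩ + (d - 2) / 2`. -/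
def lam (R : Finset (E d)) (κ : E d → ℝ) : ℝ := index R κ + ((d : ℝ) - 2) / 2

/-- `λ_{κ,a} = 2 λ_κ / a`. -/
def lamA (R : Finset (E d)) (κ : E d → ℝ) (a : ℝ) : ℝ := 2 * lam R κ / a

/-- The weight `v_{κ,a}(x) = |x|^{a-2} ∏_{α ∈ R} |⟨α,x⟩|^{κ(α)}`. -/
def weight (R : Finset (E d)) (κ : E d → ℝ) (a : ℝ) (x : E d) : ℝ :=
  ‖x‖ ^ (a - 2) * ∏ α ∈ R, |⟪α, x⟫_ℝ| ^ κ α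

/-- The constant `c_{κ,a}`, the inverse of `∫ exp(-|x|^a / a) v_{κ,a}(x) dx`. -/
def normConst (R : Finset (E d)) (κ : E d → ℝ) (a : ℝ) : ℝ :=
  (∫ x : E d, Real.exp (-(‖x‖ ^ a / a)) * weight R κ a x)⁻¹

/-- The measure `dμ_{κ,a}(x) = c_{κ,a} v_{κ,a}(x) dx`. -/
def mu (R : Finset (E d)) (κ : E d → ℝ) (a : ℝ) : Measure (E d) :=
  volume.withDensity fun x => ENNReal.ofReal (normConst R κ a * weight R κ a x)

/-- The Hilbert space `L²(ℝ^d, dμ_{κ,a})` of complex-valued functions. -/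
abbrev L2 (R : Finset (E d)) (κ : E d → ℝ) (a : ℝ) := Lp ℂ 2 (mu R κ a)

/-- The Dunkl Laplacian
`Δ_κ f(x) = Δ f(x) + ∑_{α ∈ R⁺} κ(α) (2 ∂_α f(x) / ⟨α,x⟩ - |α|² (f(x) - f(σ_α x)) / ⟨α,x⟩²)`,
written as one half of the sum over all roots, whose terms for `α` and `-α` agree. It has its
meaning at points off all the hyperplanes `⟨α,x⟩ = 0`, hence almost everywhere. -/
def dunklLaplacian (R : Finset (E d)) (κ : E d → ℝ) (f : E d → ℂ) (x : E d) : ℂ :=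
  Laplacian.laplacian f x + (1 / 2) * ∑ α ∈ R, (κ α : ℂ) *
    (2 * fderiv ℝ f x α / (⟪α, x⟫_ℝ : ℂ) -
      ((‖α‖ ^ 2 : ℝ) : ℂ) * (f x - f (sigma α x)) / ((⟪α, x⟫_ℝ : ℂ) ^ 2))

/-- The `a`-deformed Dunkl harmonic oscillator `Δ_{κ,a} = |x|^{2-a} Δ_κ - |x|^a`, as a
differential-difference expression. -/
def oscillator (R : Finset (E d)) (κ : E d → ℝ) (a : ℝ) (f : E d → ℂ) (x : E d) : ℂ :=
  ((‖x‖ ^ (2 - a) : ℝ) : ℂ) * dunklLaplacian R κ f x - ((‖x‖ ^ a : ℝ) : ℂ) * f x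

/-- The function on `ℝ^d` given by a complex polynomial in `d` variables. -/
def polyFun (p : MvPolynomial (Fin d) ℂ) (x : E d) : ℂ :=
  MvPolynomial.eval (fun i => (x i : ℂ)) p

/-- `p` is a `κ`-harmonic homogeneous polynomial of degree `m`. The equation `Δ_κ p = 0` is an
identity between polynomials, so it may be tested off the hyperplanes. -/
def IsHarmonic (R : Finset (E d)) (κ : E d → ℝ) (m : ℕ) (p : MvPolynomial (Fin d) ℂ) : Prop :=
  p.IsHomogeneous m ∧
    ∀ x : E d, (∀ α ∈ R, ⟪α, x⟫_ℝ ≠ 0) → dunklLaplacian R κ (polyFun p) x = 0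

/-- The standard domain of essential self-adjointness of `Δ_{κ,a}`: the span of the functions
`p(x) |x|^{a j} exp(-|x|^a / a)` with `p` a `κ`-harmonic homogeneous polynomial and `j ∈ ℕ`
(equivalently of the functions `p(x) L(2|x|^a / a) exp(-|x|^a / a)` with `L` a Laguerre
polynomial). -/
def core (R : Finset (E d)) (κ : E d → ℝ) (a : ℝ) : Submodule ℂ (E d → ℂ) :=
  Submodule.span ℂ {f | ∃ (m j : ℕ) (p : MvPolynomial (Fin d) ℂ), IsHarmonic R κ m p ∧
    f = fun x => polyFun p x * ((‖x‖ ^ (a * j) * Real.exp (-(‖x‖ ^ a / a)) : ℝ) : ℂ)}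

/-- The graph in `L² × L²` of the self-adjoint operator `Δ_{κ,a}`: the closure of the graph of the
differential-difference expression on `core`. -/
def oscillatorGraph (R : Finset (E d)) (κ : E d → ℝ) (a : ℝ) :
    Submodule ℂ (L2 R κ a × L2 R κ a) :=
  (Submodule.span ℂ {w | ∃ f ∈ core R κ a, (w.1 =ᵐ[mu R κ a] f) ∧
    (w.2 =ᵐ[mu R κ a] oscillator R κ a f)}).topologicalClosure

section Exponential

variable {H : Type*} [NormedAddCommGroup H] [InnerProductSpace ℂ H] [CompleteSpace H]

/-- The eigenspace for `t` of the operator with graph `G`: all `u` with `(u, t u) ∈ G`. -/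
def eigenspace (G : Submodule ℂ (H × H)) (t : ℝ) : Submodule ℂ H :=
  G.comap (LinearMap.prod LinearMap.id ((t : ℂ) • LinearMap.id))

/-- The exponential `exp(z A)`, through the spectral decomposition `A = ∑ t P_t`, of a self-adjoint
operator `A` with graph `G` whose eigenvectors span a dense subspace: `exp(z A) = ∑ e^{z t} P_t`,
where `P_t` is the orthogonal projection to the eigenspace for `t` (which is closed when `G` is).
Here it is used for imaginary `z`, where it is unitary. -/
def expOp (G : Submodule ℂ (H × H)) (z : ℂ) (f : H) : H :=
  ∑' t : ℝ, Complex.exp (z * t) • (eigenspace G t).topologicalClosure.starProjection f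

end Exponential

/-- The generalized Fourier transform
`F_{κ,a} = exp((iπ/2)(λ_{κ,a} + 1)) exp((iπ/(2a)) Δ_{κ,a})` on `L²(ℝ^d, dμ_{κ,a})`. -/
def genFourier (R : Finset (E d)) (κ : E d → ℝ) (a : ℝ) (f : L2 R κ a) : L2 R κ a :=
  Complex.exp (Complex.I * Real.pi / 2 * (lamA R κ a + 1)) •
    expOp (oscillatorGraph R κ a) (Complex.I * Real.pi / (2 * a)) f

/-- The Schwartz space, as a set of classes in `L²(ℝ^d, dμ_{κ,a})`. -/
def schwartzSet (R : Finset (E d)) (κ : E d → ℝ) (a : ℝ) : Set (L2 R κ a) :=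
  {u | ∃ f : 𝓢(E d, ℂ), u =ᵐ[mu R κ a] f}

/-- The classes in `L²(ℝ^d, dμ_{κ,a})` of functions in `C^∞(ℝ^d)`. -/
def smoothSet (R : Finset (E d)) (κ : E d → ℝ) (a : ℝ) : Set (L2 R κ a) :=
  {u | ∃ g : E d → ℂ, ContDiff ℝ ∞ g ∧ u =ᵐ[mu R κ a] g}

/-- The classes in `L²(ℝ^d, dμ_{κ,a})` of functions that decrease at infinity faster than every
negative power of `|x|` (nothing is asked of derivatives). -/
def rapidSet (R : Finset (E d)) (κ : E d → ℝ) (a : ℝ) : Set (L2 R κ a) :=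
  {u | ∃ g : E d → ℂ, (∀ N : ℕ, g =O[Filter.cocompact (E d)] fun x => (‖x‖ ^ N)⁻¹) ∧
    u =ᵐ[mu R κ a] g}

end DunklA

end

noncomputable section

namespace DunklA

variable {d : ℕ}

/-! One radial test function decides both questions. Put `τ = |x|^a / a` and `ν = λ_{κ,a}`. In the
variable `τ` the oscillator acts on radial functions as a Laguerre operator: the functions `φ_l =
laguerreFun ν l τ` are eigenvectors with eigenvalue `-a(2l + ν + 1)`, so the phases in `genFourier`
combine to the factor `(-1)^l` on `φ_l`. The Laplace transform `∫ φ_l e^{-cτ} dμ` equals `K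
(c+1)^{-(ν+1)} ((c-1)/(c+1))^l`, and `c ↦ 1/c` changes the sign of `(c-1)/(c+1)`. Hence, for `f` in
the closed span of the `φ_l`, `∫ e^{-cτ} F f dμ = c^{-(ν+1)} ∫ e^{-τ/c} f dμ`
(`inner_expL2_genFourier`, `integral_exp_mul_genFourier`).

This is used for `f = |x|² χ(|x|²)` with a smooth cutoff `χ`. As `c = 1/ε → ∞` the right side is
`ε^{ν+1} (m₀ - m₁ ε + O(ε²))` with `m₁ > 0`. If `F f` is smooth, its Taylor terms of degree `m`
contribute multiples of `ε^{ν+1+m/a}`, and odd degrees vanish because `μ` is even. The power `ε¹`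
must occur among the `ε^{m/a}`, so `a` is a positive even integer (`exists_half_eq_nat`). As `c → 0`
the right side is `A c^{2/a} + O(c^{4/a})` with `A > 0`. If `F f` decreases rapidly, all its moments
are finite and the left side expands in integral powers of `c`, so `2/a` is a positive integer
(`exists_two_div_eq_nat`). Together these force `a = 2`.

The operator theory needs little: neither self-adjointness nor completeness of all eigenvectors
enters. It suffices that each `φ_l` is an eigenvector and that `⟨φ_l, w.2⟩ = t_l ⟨φ_l, w.1⟩` on the
whole graph (`inner_laguerreL2_graph`). On the generators of the core this is a recursion between
moments when the harmonic polynomial is constant. For positive degree both sides vanish, because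
`κ`-harmonic polynomials have weighted mean zero on the sphere (`integral_sphere_harmonic`), a
consequence of `∫ w Δ_κ f = 0` for `f` smooth with compact support. That compactly supported radial
functions lie in the closed span of the `φ_l` follows from Weierstrass approximation in `e^{-τ}`. -/

theorem laplacian_eq_sum_fderiv (f : E d → ℂ) (x : E d) :
    Laplacian.laplacian f x = ∑ i, fderiv ℝ (fderiv ℝ f) x (EuclideanSpace.basisFun (Fin d) ℝ i)
      (EuclideanSpace.basisFun (Fin d) ℝ i) := by
  rw [InnerProductSpace.laplacian_eq_iteratedFDeriv_orthonormalBasis f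
    (EuclideanSpace.basisFun (Fin d) ℝ)]
  simp [iteratedFDeriv_two_apply]

/-! ### The Dunkl Laplacian of a function times a radial factor -/

section Radial

variable {P : E d → ℂ} {ψ ψ₁ : ℝ → ℝ} {ψ₂ : ℝ} {x : E d}

/-- The inner product with `x` as a complex-valued real-linear form. -/
def innerC (x : E d) : E d →L[ℝ] ℂ := Complex.ofRealCLM.comp (innerSL ℝ x)

@[simp] theorem innerC_apply (x y : E d) : innerC x y = ((⟪x, y⟫_ℝ : ℝ) : ℂ) := rfl

/-- Radial factors are written through `‖x‖²`, which is smooth at the origin too, so that smooth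
cutoffs need no exception there. -/
theorem hasFDerivAt_radial {c : ℝ} (h : HasDerivAt ψ c (‖x‖ ^ 2)) :
    HasFDerivAt (fun y : E d => (ψ (‖y‖ ^ 2) : ℂ)) ((2 * c : ℂ) • innerC x) x := by
  have h1 : HasFDerivAt (fun y : E d => ‖y‖ ^ 2) (2 • innerSL ℝ x) x :=
    (hasStrictFDerivAt_norm_sq x).hasFDerivAt
  have h2 := Complex.ofRealCLM.hasFDerivAt.comp x (h.comp_hasFDerivAt x h1)
  refine h2.congr_fderiv ?_
  ext v
  simp
  ring

theorem hasFDerivAt_mul_radial {c : ℝ} {P' : E d →L[ℝ] ℂ} (hP : HasFDerivAt P P' x)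
    (h : HasDerivAt ψ c (‖x‖ ^ 2)) :
    HasFDerivAt (fun y : E d => P y * (ψ (‖y‖ ^ 2) : ℂ))
      ((ψ (‖x‖ ^ 2) : ℂ) • P' + (P x * (2 * c)) • innerC x) x := by
  refine (hP.mul (hasFDerivAt_radial h)).congr_fderiv ?_
  ext v
  simp
  ring

theorem hasFDerivAt_innerC (x : E d) :
    HasFDerivAt (innerC : E d → E d →L[ℝ] ℂ)
      ((ContinuousLinearMap.compL ℝ (E d) ℝ ℂ Complex.ofRealCLM).comp (innerSL ℝ)) x :=
  ((ContinuousLinearMap.compL ℝ (E d) ℝ ℂ Complex.ofRealCLM).comp (innerSL ℝ)).hasFDerivAt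

/-- Only the diagonal values of the second derivative are recorded, since the Laplacian is their sum
over an orthonormal basis. -/
theorem hasFDerivAt_fderiv_mul_radial (hP : ContDiff ℝ 2 P)
    (h : ∀ᶠ s in nhds (‖x‖ ^ 2), HasDerivAt ψ (ψ₁ s) s) (h' : HasDerivAt ψ₁ ψ₂ (‖x‖ ^ 2)) :
    ∃ L : E d →L[ℝ] E d →L[ℝ] ℂ,
      HasFDerivAt (fderiv ℝ fun y : E d => P y * (ψ (‖y‖ ^ 2) : ℂ)) L x ∧
      ∀ v, L v v = ψ (‖x‖ ^ 2) * fderiv ℝ (fderiv ℝ P) x v v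
        + 4 * ψ₁ (‖x‖ ^ 2) * (⟪x, v⟫_ℝ * fderiv ℝ P x v)
        + P x * (4 * ψ₂ * (⟪x, v⟫_ℝ ^ 2 : ℝ) + 2 * ψ₁ (‖x‖ ^ 2) * (‖v‖ ^ 2 : ℝ)) := by
  have hP1 : ∀ y, HasFDerivAt P (fderiv ℝ P y) y := fun y =>
    (hP.differentiable (by norm_num) y).hasFDerivAt
  have hP2 : HasFDerivAt (fderiv ℝ P) (fderiv ℝ (fderiv ℝ P) x) x :=
    ((hP.fderiv_right (m := 1) (by norm_num)).differentiable (by norm_num) x).hasFDerivAt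
  have hcont : Filter.Tendsto (fun y : E d => ‖y‖ ^ 2) (nhds x) (nhds (‖x‖ ^ 2)) := by
    have : Continuous fun y : E d => ‖y‖ ^ 2 := by fun_prop
    exact this.tendsto x
  have hev : (fderiv ℝ fun y : E d => P y * (ψ (‖y‖ ^ 2) : ℂ)) =ᶠ[nhds x] fun y =>
      (ψ (‖y‖ ^ 2) : ℂ) • fderiv ℝ P y + (P y * (2 * (ψ₁ (‖y‖ ^ 2) : ℂ))) • innerC y := by
    filter_upwards [hcont.eventually h] with y hy
    exact (hasFDerivAt_mul_radial (hP1 y) hy).fderiv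
  have hA := (hasFDerivAt_radial h.self_of_nhds).smul hP2
  have hB := ((hP1 x).mul ((hasFDerivAt_radial h').const_mul 2)).smul (hasFDerivAt_innerC x)
  refine ⟨_, (hA.add hB).congr_of_eventuallyEq hev, fun v => ?_⟩
  simp
  ring

theorem laplacian_mul_radial (hP : ContDiff ℝ 2 P)
    (h : ∀ᶠ s in nhds (‖x‖ ^ 2), HasDerivAt ψ (ψ₁ s) s) (h' : HasDerivAt ψ₁ ψ₂ (‖x‖ ^ 2)) :
    Laplacian.laplacian (fun y : E d => P y * (ψ (‖y‖ ^ 2) : ℂ)) x =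
      ψ (‖x‖ ^ 2) * Laplacian.laplacian P x + 4 * ψ₁ (‖x‖ ^ 2) * fderiv ℝ P x x
        + P x * (4 * ψ₂ * (‖x‖ ^ 2 : ℝ) + 2 * d * ψ₁ (‖x‖ ^ 2)) := by
  obtain ⟨L, hL, hLv⟩ := hasFDerivAt_fderiv_mul_radial hP h h'
  set b := EuclideanSpace.basisFun (Fin d) ℝ
  have e1 : ∑ i, ((⟪x, b i⟫_ℝ : ℝ) : ℂ) * fderiv ℝ P x (b i) = fderiv ℝ P x x := by
    have := congrArg (fderiv ℝ P x) (b.sum_repr' x)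
    rw [← this, map_sum]
    simp [real_inner_comm]
  have e2 : ∑ i, (⟪x, b i⟫_ℝ ^ 2) = ‖x‖ ^ 2 := by
    have := b.sum_sq_norm_inner_left x
    simpa using this
  rw [laplacian_eq_sum_fderiv, laplacian_eq_sum_fderiv, hL.fderiv]
  simp_rw [hLv]
  rw [Finset.sum_add_distrib, Finset.sum_add_distrib, ← Finset.mul_sum, ← Finset.mul_sum, e1,
    ← Finset.mul_sum, Finset.sum_add_distrib, ← Finset.mul_sum, ← Complex.ofReal_sum, e2]
  simp
  left
  ring

theorem norm_sigma (α x : E d) : ‖sigma α x‖ = ‖x‖ :=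
  LinearIsometryEquiv.norm_map _ _

/-- Reflections preserve the norm, so the difference terms treat the radial factor as a constant. In
the gradient terms `⟨α,x⟩` cancels, and the roots act like `2⟨κ⟩` additional dimensions: `2d`
becomes `2d + 4⟨κ⟩`. -/
theorem dunklLaplacian_mul_radial (R : Finset (E d)) (κ : E d → ℝ) (hP : ContDiff ℝ 2 P)
    (h : ∀ᶠ s in nhds (‖x‖ ^ 2), HasDerivAt ψ (ψ₁ s) s) (h' : HasDerivAt ψ₁ ψ₂ (‖x‖ ^ 2))
    (hx : ∀ α ∈ R, ⟪α, x⟫_ℝ ≠ 0) :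
    dunklLaplacian R κ (fun y : E d => P y * (ψ (‖y‖ ^ 2) : ℂ)) x =
      ψ (‖x‖ ^ 2) * dunklLaplacian R κ P x + 4 * ψ₁ (‖x‖ ^ 2) * fderiv ℝ P x x
        + P x * ((4 * ‖x‖ ^ 2 * ψ₂ + (2 * d + 4 * index R κ) * ψ₁ (‖x‖ ^ 2) : ℝ) : ℂ) := by
  have hP1 : HasFDerivAt P (fderiv ℝ P x) x := (hP.differentiable (by norm_num) x).hasFDerivAt
  have key : ∀ α ∈ R, (κ α : ℂ) *
      (2 * fderiv ℝ (fun y : E d => P y * (ψ (‖y‖ ^ 2) : ℂ)) x α / (⟪α, x⟫_ℝ : ℂ) -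
      ((‖α‖ ^ 2 : ℝ) : ℂ) * (P x * (ψ (‖x‖ ^ 2) : ℂ) - P (sigma α x) * (ψ (‖sigma α x‖ ^ 2) : ℂ)) /
        ((⟪α, x⟫_ℝ : ℂ) ^ 2)) = ψ (‖x‖ ^ 2) * ((κ α : ℂ) *
    (2 * fderiv ℝ P x α / (⟪α, x⟫_ℝ : ℂ) -
      ((‖α‖ ^ 2 : ℝ) : ℂ) * (P x - P (sigma α x)) / ((⟪α, x⟫_ℝ : ℂ) ^ 2)))
      + (4 * P x * ψ₁ (‖x‖ ^ 2)) * κ α := by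
    intro α hα
    have hne : ((⟪α, x⟫_ℝ : ℝ) : ℂ) ≠ 0 := by exact_mod_cast hx α hα
    rw [(hasFDerivAt_mul_radial hP1 h.self_of_nhds).fderiv, norm_sigma]
    simp only [add_apply, smul_apply, innerC_apply,
      smul_eq_mul, real_inner_comm]
    rw [real_inner_comm] at hne
    field_simp
    ring
  rw [dunklLaplacian, dunklLaplacian, laplacian_mul_radial hP h h', Finset.sum_congr rfl key,
    Finset.sum_add_distrib, ← Finset.mul_sum, ← Finset.mul_sum, index]
  push_cast
  ring

end Radial

/-! ### Homogeneous and `κ`-harmonic polynomials -/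

section Polynomials

theorem contDiff_polyFun (p : MvPolynomial (Fin d) ℂ) {n : WithTop ℕ∞} :
    ContDiff ℝ n (polyFun p) := by
  induction p using MvPolynomial.induction_on with
  | C c =>
    have : polyFun (d := d) (MvPolynomial.C c) = fun _ => c := by ext; simp [polyFun]
    exact this ▸ contDiff_const
  | add p q hp hq =>
    have : polyFun (p + q) = fun x => polyFun p x + polyFun q x := by ext; simp [polyFun]
    exact this ▸ hp.add hq
  | mul_X p i hp =>
    have : ContDiff ℝ n fun x : E d => ((x i : ℝ) : ℂ) :=
      (Complex.ofRealCLM.comp (EuclideanSpace.proj i : E d →L[ℝ] ℝ)).contDiff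
    have h : polyFun (p * MvPolynomial.X i) = fun x => polyFun p x * ((x i : ℝ) : ℂ) := by
      ext; simp [polyFun]
    exact h ▸ hp.mul this

variable {p : MvPolynomial (Fin d) ℂ} {m : ℕ}

theorem polyFun_smul (hp : p.IsHomogeneous m) (r : ℝ) (x : E d) :
    polyFun p (r • x) = (r : ℂ) ^ m * polyFun p x := by
  rw [polyFun, polyFun, MvPolynomial.eval_eq', MvPolynomial.eval_eq', Finset.mul_sum]
  refine Finset.sum_congr rfl fun s hs => ?_
  have hs' : ∑ i, s i = m := by
    rw [← hp (MvPolynomial.mem_support_iff.1 hs)]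
    simp [Finsupp.weight_apply, Finsupp.sum_fintype]
  simp only [PiLp.smul_apply, smul_eq_mul, Complex.ofReal_mul, mul_pow, Finset.prod_mul_distrib]
  rw [Finset.prod_pow_eq_pow_sum, hs']
  ring

theorem fderiv_polyFun_self (hp : p.IsHomogeneous m) (x : E d) :
    fderiv ℝ (polyFun p) x x = m * polyFun p x := by
  have h1 : HasDerivAt (fun r : ℝ => polyFun p (r • x)) (fderiv ℝ (polyFun p) x x) 1 := by
    have hd : HasFDerivAt (polyFun p) (fderiv ℝ (polyFun p) x) ((1 : ℝ) • x) := by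
      rw [one_smul]
      exact ((contDiff_polyFun p (n := 1)).differentiable (by norm_num) x).hasFDerivAt
    have hl : HasDerivAt (fun r : ℝ => r • x) x 1 := by
      simpa using (hasDerivAt_id (1 : ℝ)).smul_const x
    exact hd.comp_hasDerivAt 1 hl
  have h2 : HasDerivAt (fun r : ℝ => polyFun p (r • x)) (m * polyFun p x) 1 := by
    simp_rw [polyFun_smul hp]
    have := (((hasDerivAt_id (1 : ℝ)).ofReal_comp).pow m).mul_const (polyFun p x)
    simpa using this
  exact h1.unique h2

theorem dunklLaplacian_harmonic_mul_radial {R : Finset (E d)} {κ : E d → ℝ}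
    (hp : IsHarmonic R κ m p) {ψ ψ₁ : ℝ → ℝ} {ψ₂ : ℝ} {x : E d}
    (h : ∀ᶠ s in nhds (‖x‖ ^ 2), HasDerivAt ψ (ψ₁ s) s) (h' : HasDerivAt ψ₁ ψ₂ (‖x‖ ^ 2))
    (hx : ∀ α ∈ R, ⟪α, x⟫_ℝ ≠ 0) :
    dunklLaplacian R κ (fun y : E d => polyFun p y * (ψ (‖y‖ ^ 2) : ℂ)) x = polyFun p x *
      ((4 * ‖x‖ ^ 2 * ψ₂ + (4 * m + 2 * d + 4 * index R κ) * ψ₁ (‖x‖ ^ 2) : ℝ) : ℂ) := by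
  rw [dunklLaplacian_mul_radial R κ (contDiff_polyFun p) h h' hx, hp.2 x hx,
    fderiv_polyFun_self hp.1]
  push_cast
  ring

end Polynomials

/-! ### The oscillator on the generators of the core -/

section Oscillator

/-- With `s = |x|²`, the span of these functions over all `b` is stable under differentiation, so
the same formula also gives the second derivative. -/
theorem hasDerivAt_rpow_mul_exp {a : ℝ} (ha : 0 < a) (b : ℝ) {s : ℝ} (hs : 0 < s) :
    HasDerivAt (fun s : ℝ => s ^ b * Real.exp (-(s ^ (a / 2) / a)))
      (b * (s ^ (b - 1) * Real.exp (-(s ^ (a / 2) / a))) -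
        1 / 2 * (s ^ (b + a / 2 - 1) * Real.exp (-(s ^ (a / 2) / a)))) s := by
  have h1 := Real.hasDerivAt_rpow_const (p := b) (Or.inl hs.ne')
  have h2 := ((Real.hasDerivAt_rpow_const (p := a / 2) (Or.inl hs.ne')).div_const a).neg.exp
  refine (h1.mul h2).congr_deriv ?_
  rw [add_sub_assoc, Real.rpow_add hs]
  simp only [Pi.neg_apply]
  field_simp
  ring

theorem norm_rpow_mul_natCast (a : ℝ) (j : ℕ) (x : E d) : ‖x‖ ^ (a * j) = (‖x‖ ^ a) ^ j := by
  rw [Real.rpow_mul (norm_nonneg x), Real.rpow_natCast]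

/-- The basic functions `p(x) |x|^{a j} exp(-|x|^a / a)`. -/
def basicFun (a : ℝ) (p : MvPolynomial (Fin d) ℂ) (j : ℕ) (x : E d) : ℂ :=
  polyFun p x * (((‖x‖ ^ a) ^ j * Real.exp (-(‖x‖ ^ a / a)) : ℝ) : ℂ)

theorem basicFun_eq_radial {a : ℝ} (p : MvPolynomial (Fin d) ℂ) (j : ℕ) :
    basicFun a p j = fun x : E d => polyFun p x *
      ((fun s : ℝ => s ^ (a * j / 2) * Real.exp (-(s ^ (a / 2) / a))) (‖x‖ ^ 2) : ℝ) := by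
  ext x
  have h : ∀ b : ℝ, (‖x‖ ^ 2) ^ (b / 2) = ‖x‖ ^ b := fun b => by
    rw [← Real.rpow_natCast_mul (norm_nonneg x)]
    congr 1
    push_cast
    ring
  simp only [h, basicFun, norm_rpow_mul_natCast]

/-- Differentiating the exponential twice produces a term raising `j` by one, which the potential
`-|x|^a` cancels; what remains keeps `j` or lowers it by one. For `j = 0` the truncated `j - 1` is
harmless because its coefficient contains `j`. -/
theorem oscillator_basicFun {R : Finset (E d)} {κ : E d → ℝ} {a : ℝ} (ha : 0 < a) {m : ℕ}
    {p : MvPolynomial (Fin d) ℂ} (hp : IsHarmonic R κ m p) (j : ℕ) {x : E d} (hx0 : x ≠ 0)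
    (hx : ∀ α ∈ R, ⟪α, x⟫_ℝ ≠ 0) :
    oscillator R κ a (basicFun a p j) x =
      (a * j * (a * j + 2 * m + 2 * lam R κ) : ℝ) * basicFun a p (j - 1) x -
      (2 * a * j + a + 2 * m + 2 * lam R κ : ℝ) * basicFun a p j x := by
  have hs : 0 < ‖x‖ ^ 2 := by positivity
  have hev : ∀ᶠ s in nhds (‖x‖ ^ 2), HasDerivAt
      (fun s : ℝ => s ^ (a * j / 2) * Real.exp (-(s ^ (a / 2) / a))) _ s :=
    (lt_mem_nhds hs).mono fun s hs => hasDerivAt_rpow_mul_exp ha (a * j / 2) hs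
  have h2 := ((hasDerivAt_rpow_mul_exp ha (a * j / 2 - 1) hs).const_mul (a * j / 2)).sub
    ((hasDerivAt_rpow_mul_exp ha (a * j / 2 + a / 2 - 1) hs).const_mul (1 / 2))
  rw [oscillator, basicFun_eq_radial, dunklLaplacian_harmonic_mul_radial hp hev h2 hx,
    ← basicFun_eq_radial]
  have hu : (‖x‖ ^ 2) ^ (a / 2) = ‖x‖ ^ a := by
    rw [← Real.rpow_natCast_mul (norm_nonneg x)]
    congr 1
    push_cast
    ring
  have hb : (‖x‖ ^ 2) ^ (a * j / 2) = (‖x‖ ^ a) ^ j := by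
    rw [← hu, ← Real.rpow_mul_natCast hs.le]
    congr 1
    ring
  have h2a : ‖x‖ ^ (2 - a) = ‖x‖ ^ 2 / ‖x‖ ^ a := by
    rw [Real.rpow_sub (by positivity), Real.rpow_two]
  have hu0 : 0 < ‖x‖ ^ a := by positivity
  simp only [Real.rpow_add hs, Real.rpow_sub hs, Real.rpow_one, hu, hb, h2a, basicFun, lam]
  set u := ‖x‖ ^ a
  set s := ‖x‖ ^ 2
  have key : s / u * (4 * s * (a * j / 2 * ((a * j / 2 - 1) * (u ^ j / s / s * Real.exp (-(u / a))) -
      1 / 2 * (u ^ j / s * u / s * Real.exp (-(u / a)))) -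
      1 / 2 * ((a * j / 2 + a / 2 - 1) * (u ^ j * u / s / s * Real.exp (-(u / a))) -
      1 / 2 * (u ^ j * u / s * u / s * Real.exp (-(u / a))))) +
      (4 * m + 2 * d + 4 * index R κ) * (a * j / 2 * (u ^ j / s * Real.exp (-(u / a))) -
      1 / 2 * (u ^ j * u / s * Real.exp (-(u / a))))) - u * (u ^ j * Real.exp (-(u / a))) =
      a * j * (a * j + 2 * m + 2 * (index R κ + (d - 2) / 2)) *
        (u ^ (j - 1) * Real.exp (-(u / a))) -
      (2 * a * j + a + 2 * m + 2 * (index R κ + (d - 2) / 2)) *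
        (u ^ j * Real.exp (-(u / a))) := by
    cases j with
    | zero =>
      simp
      field_simp
      ring
    | succ k =>
      rw [Nat.add_sub_cancel, pow_succ]
      field_simp
      ring
  have key' := congrArg (fun t : ℝ => (t : ℂ) * polyFun p x) key
  push_cast at key' ⊢
  linear_combination key'

end Oscillator

/-! ### Reflections and their hyperplanes -/

section Reflections

theorem sigma_eq (α x : E d) : sigma α x = x - (2 * ⟪α, x⟫_ℝ / ‖α‖ ^ 2) • α := by
  rw [sigma, Submodule.reflection_orthogonal_apply, Submodule.reflection_singleton_apply]
  simp
  module

theorem sigma_sigma (α x : E d) : sigma α (sigma α x) = x :=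
  Submodule.reflection_reflection _ x

theorem inner_sigma_right (α β x : E d) : ⟪β, sigma α x⟫_ℝ = ⟪sigma α β, x⟫_ℝ := by
  conv_lhs => rw [← sigma_sigma α β]
  exact LinearIsometryEquiv.inner_map_map ((ℝ ∙ α)ᗮ.reflection) (sigma α β) x

theorem sigma_self (α : E d) : sigma α α = -α :=
  Submodule.reflection_orthogonalComplement_singleton_eq_neg α

theorem sigma_of_inner_eq_zero {α x : E d} (h : ⟪α, x⟫_ℝ = 0) : sigma α x = x := by
  simp [sigma_eq, h]

theorem measurePreserving_sigma (α : E d) :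
    MeasurePreserving (sigma α) (volume : Measure (E d)) volume :=
  LinearIsometryEquiv.measurePreserving ((ℝ ∙ α)ᗮ.reflection)

theorem measurableEmbedding_sigma (α : E d) : MeasurableEmbedding (sigma α) :=
  ((ℝ ∙ α)ᗮ.reflection).toHomeomorph.measurableEmbedding

/-- `sigma α` permutes the roots and preserves `κ`. The general `F` allows the application to the
regularized weight. -/
theorem prod_comp_sigma {R : Finset (E d)} {κ : E d → ℝ} (hR : IsRootSystem R)
    (hκ : IsMultiplicity R κ) {α : E d} (hα : α ∈ R) (F : ℝ → ℝ → ℝ) (x : E d) :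
    ∏ β ∈ R, F ⟪β, sigma α x⟫_ℝ (κ β) = ∏ β ∈ R, F ⟪β, x⟫_ℝ (κ β) := by
  refine Finset.prod_nbij' (sigma α) (sigma α) (hR.sigma_mem α hα) (hR.sigma_mem α hα)
    (fun β _ => sigma_sigma α β) (fun β _ => sigma_sigma α β) fun β hβ => ?_
  rw [inner_sigma_right, hκ.invariant α hα β hβ]

theorem volume_inner_eq_zero {α : E d} (hα : α ≠ 0) :
    volume {x : E d | ⟪α, x⟫_ℝ = 0} = 0 := by
  have : {x : E d | ⟪α, x⟫_ℝ = 0} = ((ℝ ∙ α)ᗮ : Submodule ℝ (E d)) := by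
    ext x
    simp [Submodule.mem_orthogonal_singleton_iff_inner_right]
  rw [this]
  refine Measure.addHaar_submodule _ _ fun h => hα ?_
  have : α ∈ (ℝ ∙ α)ᗮ := h ▸ Submodule.mem_top
  simpa [Submodule.mem_orthogonal_singleton_iff_inner_right] using this

theorem ae_inner_ne_zero {R : Finset (E d)} (hR : IsRootSystem R) :
    ∀ᵐ x : E d, ∀ α ∈ R, ⟪α, x⟫_ℝ ≠ 0 := by
  rw [Filter.eventually_all_finset]
  intro α hα
  rw [ae_iff]
  simpa using volume_inner_eq_zero (hR.ne_zero α hα)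

end Reflections

/-! ### Integrals of Dunkl Laplacians against the weight -/

section Green

variable {R : Finset (E d)} {κ : E d → ℝ}

/-- The homogeneous weight `∏ |⟨α, x⟩|^κ(α)`. -/
def dunklWeight (R : Finset (E d)) (κ : E d → ℝ) (x : E d) : ℝ := ∏ α ∈ R, |⟪α, x⟫_ℝ| ^ κ α

/-- The smooth approximation `∏ (⟨α, x⟩² + ε)^(κ(α) / 2)` of the weight. -/
def smoothWeight (R : Finset (E d)) (κ : E d → ℝ) (ε : ℝ) (x : E d) : ℝ :=
  ∏ α ∈ R, (⟪α, x⟫_ℝ ^ 2 + ε) ^ (κ α / 2)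

theorem smoothWeight_eq_exp {ε : ℝ} (hε : 0 < ε) (x : E d) :
    smoothWeight R κ ε x = Real.exp (∑ α ∈ R, κ α / 2 * Real.log (⟪α, x⟫_ℝ ^ 2 + ε)) := by
  rw [Real.exp_sum]
  refine Finset.prod_congr rfl fun α _ => ?_
  rw [Real.rpow_def_of_pos (by positivity), mul_comm]

theorem smoothWeight_pos {ε : ℝ} (hε : 0 < ε) (x : E d) : 0 < smoothWeight R κ ε x := by
  rw [smoothWeight_eq_exp hε]
  positivity

theorem contDiff_smoothWeight {ε : ℝ} (hε : 0 < ε) : ContDiff ℝ ∞ (smoothWeight R κ ε) := by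
  have : smoothWeight R κ ε =
      fun x : E d => Real.exp (∑ α ∈ R, κ α / 2 * Real.log (⟪α, x⟫_ℝ ^ 2 + ε)) := by
    ext x
    exact smoothWeight_eq_exp hε x
  rw [this]
  refine (ContDiff.sum fun α _ => contDiff_const.mul (ContDiff.log ?_ fun x => ?_)).exp
  · exact ((contDiff_const.inner ℝ contDiff_id).pow 2).add contDiff_const
  · positivity

theorem hasFDerivAt_smoothWeight {ε : ℝ} (hε : 0 < ε) (x : E d) :
    HasFDerivAt (fun x => (smoothWeight R κ ε x : ℂ))
      (∑ α ∈ R, (smoothWeight R κ ε x * (κ α * (⟪α, x⟫_ℝ / (⟪α, x⟫_ℝ ^ 2 + ε))) : ℂ) • innerC α)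
      x := by
  have h1 : ∀ α ∈ R, HasFDerivAt (fun x : E d => κ α / 2 * Real.log (⟪α, x⟫_ℝ ^ 2 + ε))
      ((κ α * (⟪α, x⟫_ℝ / (⟪α, x⟫_ℝ ^ 2 + ε))) • innerSL ℝ α) x := by
    intro α _
    have h0 : HasFDerivAt (fun x : E d => ⟪α, x⟫_ℝ) (innerSL ℝ α) x := (innerSL ℝ α).hasFDerivAt
    have hne : ⟪α, x⟫_ℝ ^ 2 + ε ≠ 0 := by positivity
    refine ((((h0.pow 2).add_const ε).log hne).const_mul (κ α / 2)).congr_fderiv ?_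
    ext v
    simp
    field_simp
  have h2 := Complex.ofRealCLM.hasFDerivAt.comp x (HasFDerivAt.fun_sum h1).exp
  have h3 : (fun x : E d => (smoothWeight R κ ε x : ℂ)) = Complex.ofRealCLM ∘
      fun x => Real.exp (∑ α ∈ R, κ α / 2 * Real.log (⟪α, x⟫_ℝ ^ 2 + ε)) := by
    ext x
    simp [smoothWeight_eq_exp hε]
  rw [h3]
  refine h2.congr_fderiv ?_
  ext v
  simp [← smoothWeight_eq_exp hε, Finset.mul_sum, mul_assoc]

variable {f : E d → ℂ}

theorem contDiff_fderiv (hf : ContDiff ℝ ∞ f) : ContDiff ℝ ∞ (fderiv ℝ f) :=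
  hf.fderiv_right (m := ∞) (by simp)

theorem continuous_laplacian (hf : ContDiff ℝ ∞ f) : Continuous (Laplacian.laplacian f) := by
  have : Laplacian.laplacian f = fun x => ∑ i, fderiv ℝ (fderiv ℝ f) x
      (EuclideanSpace.basisFun (Fin d) ℝ i) (EuclideanSpace.basisFun (Fin d) ℝ i) := by
    ext x
    exact laplacian_eq_sum_fderiv f x
  rw [this]
  have h2 := (contDiff_fderiv hf).continuous_fderiv (by simp)
  fun_prop

theorem laplacian_eq_zero_of_eventuallyEq {x : E d} (h : f =ᶠ[nhds x] fun _ => 0) :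
    Laplacian.laplacian f x = 0 := by
  rw [(InnerProductSpace.laplacian_congr_nhds h).self_of_nhds]
  simp [laplacian_eq_sum_fderiv]

theorem hasCompactSupport_laplacian (hfc : HasCompactSupport f) :
    HasCompactSupport (Laplacian.laplacian f) :=
  hfc.mono' fun x hx => by
    by_contra hxs
    exact hx (laplacian_eq_zero_of_eventuallyEq (notMem_tsupport_iff_eventuallyEq.1 hxs))

/-- The integrand is the divergence of `W ∇f`, because the logarithmic gradient of the regularized
weight is `∑ κ(α) ⟨α,x⟩ / (⟨α,x⟩² + ε) α`. -/
theorem integral_smoothWeight_mul_divergence {ε : ℝ} (hε : 0 < ε) (hf : ContDiff ℝ ∞ f)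
    (hfc : HasCompactSupport f) :
    ∫ x, (smoothWeight R κ ε x : ℂ) * (Laplacian.laplacian f x +
      ∑ α ∈ R, (κ α * (⟪α, x⟫_ℝ / (⟪α, x⟫_ℝ ^ 2 + ε)) : ℂ) * fderiv ℝ f x α) = 0 := by
  set b := EuclideanSpace.basisFun (Fin d) ℝ
  set W : E d → ℂ := fun x => (smoothWeight R κ ε x : ℂ)
  have hW : ContDiff ℝ ∞ W := Complex.ofRealCLM.contDiff.comp (contDiff_smoothWeight hε)
  have hg : ∀ v, ContDiff ℝ ∞ fun x => fderiv ℝ f x v := fun v =>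
    (hf.fderiv_right (m := ∞) (by simp)).clm_apply contDiff_const
  have hgc : ∀ v, HasCompactSupport fun x => fderiv ℝ f x v := fun v => hfc.fderiv_apply ℝ v
  have i1 : ∀ v, Integrable fun x => W x * fderiv ℝ (fun x => fderiv ℝ f x v) x v := fun v =>
    (hW.continuous.mul (((hg v).continuous_fderiv (by simp)).clm_apply
      continuous_const)).integrable_of_hasCompactSupport ((hgc v).fderiv_apply ℝ v).mul_left
  have i2 : ∀ v, Integrable fun x => fderiv ℝ W x v * fderiv ℝ f x v := fun v =>
    (((hW.continuous_fderiv (by simp)).clm_apply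
      continuous_const).mul (hg v).continuous).integrable_of_hasCompactSupport (hgc v).mul_left
  have i3 : ∀ v, Integrable fun x => W x * fderiv ℝ f x v := fun v =>
    (hW.continuous.mul (hg v).continuous).integrable_of_hasCompactSupport (hgc v).mul_left
  have key : ∀ v, ∫ x, (W x * fderiv ℝ (fun x => fderiv ℝ f x v) x v +
      fderiv ℝ W x v * fderiv ℝ f x v) = 0 := by
    intro v
    rw [integral_add (i1 v) (i2 v), integral_mul_fderiv_eq_neg_fderiv_mul_of_integrable (i2 v)
      (i1 v) (i3 v) (fun x _ => hW.differentiable (by simp) x)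
      (fun x _ => (hg v).differentiable (by simp) x)]
    simp
  calc _ = ∫ x, ∑ i, (W x * fderiv ℝ (fun x => fderiv ℝ f x (b i)) x (b i) +
      fderiv ℝ W x (b i) * fderiv ℝ f x (b i)) := by
        congr 1
        ext x
        have e1 : ∀ v, fderiv ℝ (fun x => fderiv ℝ f x v) x v = fderiv ℝ (fderiv ℝ f) x v v := by
          intro v
          have := ((contDiff_fderiv hf).differentiable
            (by simp) x).hasFDerivAt.clm_apply (hasFDerivAt_const v x)
          rw [this.fderiv]
          simp
        have e2 : ∀ α : E d, ∑ i, ((⟪α, b i⟫_ℝ : ℝ) : ℂ) * fderiv ℝ f x (b i) =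
            fderiv ℝ f x α := by
          intro α
          have := congrArg (fderiv ℝ f x) (b.sum_repr' α)
          rw [← this, map_sum]
          simp [real_inner_comm]
        rw [Finset.sum_add_distrib, laplacian_eq_sum_fderiv, mul_add, Finset.mul_sum]
        simp_rw [e1]
        congr 1
        simp only [W, (hasFDerivAt_smoothWeight hε x).fderiv]
        simp only [sum_apply, smul_apply, innerC_apply, smul_eq_mul, Finset.sum_mul]
        rw [Finset.sum_comm, Finset.mul_sum]
        refine Finset.sum_congr rfl fun α _ => ?_
        rw [← e2 α, Finset.mul_sum, Finset.mul_sum]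
        refine Finset.sum_congr rfl fun i _ => ?_
        ring
    _ = 0 := by
        refine (integral_finsetSum _ fun i _ => (i1 (b i)).add (i2 (b i))).trans ?_
        exact Finset.sum_eq_zero fun i _ => key (b i)

/-- The quotient of the weight by `⟨α,x⟩² + ε` is invariant under the measure-preserving map `sigma
α`, so the two halves of the difference have equal integrals. -/
theorem integral_smoothWeight_mul_difference (hR : IsRootSystem R) (hκ : IsMultiplicity R κ)
    {α : E d} (hα : α ∈ R) {ε : ℝ} (hε : 0 < ε) (hf : Continuous f)
    (hfc : HasCompactSupport f) :
    Integrable (fun x => (smoothWeight R κ ε x : ℂ) *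
      ((f x - f (sigma α x)) / ((⟪α, x⟫_ℝ ^ 2 + ε : ℝ) : ℂ))) ∧
    ∫ x, (smoothWeight R κ ε x : ℂ) *
      ((f x - f (sigma α x)) / ((⟪α, x⟫_ℝ ^ 2 + ε : ℝ) : ℂ)) = 0 := by
  set G : E d → ℂ := fun x => ((smoothWeight R κ ε x / (⟪α, x⟫_ℝ ^ 2 + ε) : ℝ) : ℂ)
  have hG : Continuous G := by
    refine Complex.continuous_ofReal.comp ((contDiff_smoothWeight hε).continuous.div
      (by fun_prop) fun x => by positivity)
  have hGs : ∀ x, G (sigma α x) = G x := by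
    intro x
    have h1 : smoothWeight R κ ε (sigma α x) = smoothWeight R κ ε x :=
      prod_comp_sigma hR hκ hα (fun c k => (c ^ 2 + ε) ^ (k / 2)) x
    have h2 : ⟪α, sigma α x⟫_ℝ ^ 2 = ⟪α, x⟫_ℝ ^ 2 := by
      rw [inner_sigma_right, sigma_self, inner_neg_left, neg_sq]
    simp only [G, h1, h2]
  have i1 : Integrable fun x => G x * f x :=
    (hG.mul hf).integrable_of_hasCompactSupport hfc.mul_left
  have e : (fun x => G x * f (sigma α x)) = (fun x => G x * f x) ∘ sigma α := by
    ext x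
    simp [hGs]
  have i2 : Integrable fun x => G x * f (sigma α x) := by
    rw [e]
    exact (measurePreserving_sigma α).integrable_comp_of_integrable i1
  have e3 : (fun x => (smoothWeight R κ ε x : ℂ) *
      ((f x - f (sigma α x)) / ((⟪α, x⟫_ℝ ^ 2 + ε : ℝ) : ℂ))) =
      fun x => G x * f x - G x * f (sigma α x) := by
    ext x
    simp only [G]
    push_cast
    ring
  rw [e3]
  refine ⟨i1.sub i2, ?_⟩
  rw [integral_sub i1 (e ▸ i2), e]
  erw [(measurePreserving_sigma α).integral_comp (measurableEmbedding_sigma α)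
    (fun x => G x * f x), sub_self]

/-- The contribution of the root `α` to the Dunkl Laplacian, up to the factor `κ(α)`. -/
def rootTerm (α : E d) (f : E d → ℂ) (x : E d) : ℂ :=
  fderiv ℝ f x α / (⟪α, x⟫_ℝ : ℂ) -
    ((‖α‖ ^ 2 / 2 : ℝ) : ℂ) * (f x - f (sigma α x)) / ((⟪α, x⟫_ℝ : ℂ) ^ 2)

theorem dunklLaplacian_eq_rootTerm (x : E d) :
    dunklLaplacian R κ f x = Laplacian.laplacian f x + ∑ α ∈ R, (κ α : ℂ) * rootTerm α f x := by
  rw [dunklLaplacian, Finset.mul_sum]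
  congr 1
  refine Finset.sum_congr rfl fun α _ => ?_
  rw [rootTerm]
  push_cast
  ring

theorem rootTerm_eq_zero {α : E d} {r : ℝ} (h : ∀ x, r < ‖x‖ → f x = 0) {x : E d} (hx : r < ‖x‖) :
    rootTerm α f x = 0 := by
  have h1 : f =ᶠ[nhds x] fun _ => 0 :=
    (continuous_norm.tendsto x).eventually (lt_mem_nhds hx) |>.mono fun y hy => h y hy
  have h2 : fderiv ℝ f x = 0 := by rw [h1.fderiv_eq]; simp
  simp [rootTerm, h2, h x hx, h (sigma α x) (by rwa [norm_sigma])]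

/-- The apparent singularity is absent. Since `σ_α x - x` is `-2⟨α,x⟩/|α|²` times `α`, the term is
`|α|² / (2⟨α,x⟩²)` times the first-order Taylor remainder of `f` from `x` to `σ_α x`, and that
remainder is at most `C |σ_α x - x|² = 4C ⟨α,x⟩² / |α|²`. On the hyperplane itself, division by zero
gives the value `0`. -/
theorem exists_norm_rootTerm_le (hf : ContDiff ℝ ∞ f) (hfc : HasCompactSupport f) {α : E d}
    (hα : α ≠ 0) : ∃ C, ∀ x, ‖rootTerm α f x‖ ≤ C := by
  obtain ⟨C, hC⟩ := ContDiff.lipschitzWith_of_hasCompactSupport (hfc.fderiv ℝ)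
    (contDiff_fderiv hf) (by simp)
  refine ⟨2 * C, fun x => ?_⟩
  set c := ⟪α, x⟫_ℝ with hc
  by_cases hc0 : c = 0
  · simp [rootTerm, ← hc, hc0]
  have hn : 0 < ‖α‖ := norm_pos_iff.2 hα
  set y := sigma α x
  have hy : y - x = -((2 * c / ‖α‖ ^ 2) • α) := by
    simp only [y, sigma_eq]
    module
  have hyn : ‖y - x‖ = 2 * |c| / ‖α‖ := by
    rw [hy, norm_neg, norm_smul, norm_div, norm_mul]
    simp
    field_simp
  have h1 : ‖f y - f x - fderiv ℝ f x (y - x)‖ ≤ C * ‖y - x‖ * ‖y - x‖ := by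
    refine (convex_closedBall x ‖y - x‖).norm_image_sub_le_of_norm_fderiv_le'
      (fun z _ => hf.differentiable (by simp) z) (fun z hz => ?_) (by simp) (by simp [dist_eq_norm])
    rw [← dist_eq_norm]
    exact (hC.dist_le_mul z x).trans (mul_le_mul_of_nonneg_left (by simpa using hz) C.2)
  have h2 : rootTerm α f x = ((‖α‖ ^ 2 / 2 / c ^ 2 : ℝ) : ℂ) *
      (f y - f x - fderiv ℝ f x (y - x)) := by
    rw [hy, map_neg, map_smul, rootTerm, ← hc]
    have h3 : (c : ℂ) ≠ 0 := by exact_mod_cast hc0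
    have h4 : (‖α‖ : ℂ) ≠ 0 := by exact_mod_cast hn.ne'
    simp only [Complex.real_smul, y]
    push_cast
    field_simp
    ring
  rw [h2, norm_mul, Complex.norm_real, Real.norm_of_nonneg (by positivity)]
  refine (mul_le_mul_of_nonneg_left h1 (by positivity)).trans (le_of_eq ?_)
  have : |c| ≠ 0 := by simpa using hc0
  rw [hyn, ← sq_abs c]
  field_simp

theorem tendsto_smoothWeight (hκ : IsMultiplicity R κ) (x : E d) :
    Filter.Tendsto (fun ε => smoothWeight R κ ε x) (nhdsWithin 0 (Set.Ioi 0))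
      (nhds (dunklWeight R κ x)) := by
  refine tendsto_finsetProd _ fun α hα => ?_
  have h1 : Filter.Tendsto (fun ε : ℝ => ⟪α, x⟫_ℝ ^ 2 + ε) (nhdsWithin 0 (Set.Ioi 0))
      (nhds (⟪α, x⟫_ℝ ^ 2)) := by
    have : Continuous fun ε : ℝ => ⟪α, x⟫_ℝ ^ 2 + ε := by fun_prop
    simpa using (this.tendsto 0).mono_left nhdsWithin_le_nhds
  have h2 := ((Real.continuous_rpow_const (q := κ α / 2)
    (div_nonneg (hκ.nonneg α hα) zero_le_two)).tendsto _).comp h1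
  have h3 : |⟪α, x⟫_ℝ| ^ κ α = (⟪α, x⟫_ℝ ^ 2) ^ (κ α / 2) := by
    rw [← sq_abs ⟪α, x⟫_ℝ, ← Real.rpow_natCast_mul (abs_nonneg _)]
    congr 1
    push_cast
    ring
  rw [h3]
  exact h2

theorem smoothWeight_mono (hκ : IsMultiplicity R κ) {ε δ : ℝ} (hε : 0 ≤ ε) (h : ε ≤ δ) (x : E d) :
    smoothWeight R κ ε x ≤ smoothWeight R κ δ x := by
  refine Finset.prod_le_prod (fun α _ => by positivity) fun α hα => ?_
  exact Real.rpow_le_rpow (by positivity) (by gcongr) (div_nonneg (hκ.nonneg α hα) zero_le_two)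

/-- The factor `⟨α,x⟩² / (⟨α,x⟩² + ε)` turns the singular denominators of `rootTerm` into those of
the two preceding identities. It tends to `1` off the hyperplanes, which makes the limit `ε → 0`
possible. -/
theorem integral_smoothWeight_mul_rootTerm (hR : IsRootSystem R) (hκ : IsMultiplicity R κ)
    {ε : ℝ} (hε : 0 < ε) (hf : ContDiff ℝ ∞ f) (hfc : HasCompactSupport f) :
    ∫ x, (smoothWeight R κ ε x : ℂ) * (Laplacian.laplacian f x + ∑ α ∈ R, (κ α : ℂ) *
      (((⟪α, x⟫_ℝ ^ 2 / (⟪α, x⟫_ℝ ^ 2 + ε) : ℝ) : ℂ) * rootTerm α f x)) = 0 := by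
  have hd := integral_smoothWeight_mul_divergence (R := R) (κ := κ) hε hf hfc
  have hα := fun α (h : α ∈ R) =>
    integral_smoothWeight_mul_difference hR hκ h hε hf.continuous hfc
  have e : ∀ x, (smoothWeight R κ ε x : ℂ) * (Laplacian.laplacian f x + ∑ α ∈ R, (κ α : ℂ) *
      (((⟪α, x⟫_ℝ ^ 2 / (⟪α, x⟫_ℝ ^ 2 + ε) : ℝ) : ℂ) * rootTerm α f x)) =
      (smoothWeight R κ ε x : ℂ) * (Laplacian.laplacian f x +
      ∑ α ∈ R, (κ α * (⟪α, x⟫_ℝ / (⟪α, x⟫_ℝ ^ 2 + ε)) : ℂ) * fderiv ℝ f x α) -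
      ∑ α ∈ R, ((κ α * (‖α‖ ^ 2 / 2) : ℝ) : ℂ) * ((smoothWeight R κ ε x : ℂ) *
      ((f x - f (sigma α x)) / ((⟪α, x⟫_ℝ ^ 2 + ε : ℝ) : ℂ))) := by
    intro x
    rw [mul_add, mul_add, add_sub_assoc, Finset.mul_sum, Finset.mul_sum,
      ← Finset.sum_sub_distrib]
    congr 1
    refine Finset.sum_congr rfl fun α _ => ?_
    have hq : ((⟪α, x⟫_ℝ ^ 2 + ε : ℝ) : ℂ) ≠ 0 := by
      have : ⟪α, x⟫_ℝ ^ 2 + ε ≠ 0 := by positivity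
      exact_mod_cast this
    by_cases hc : ⟪α, x⟫_ℝ = 0
    · simp [hc, sigma_of_inner_eq_zero hc]
    · have hc' : ((⟪α, x⟫_ℝ : ℝ) : ℂ) ≠ 0 := by exact_mod_cast hc
      rw [rootTerm]
      push_cast at hq ⊢
      field_simp
  simp_rw [e]
  rw [integral_sub, hd, integral_finsetSum]
  · simp only [integral_const_mul]
    rw [Finset.sum_eq_zero fun α h => by rw [(hα α h).2, mul_zero], sub_zero]
  · exact fun α h => ((hα α h).1).const_mul _
  · refine Continuous.integrable_of_hasCompactSupport ?_ ?_
    · refine (Complex.continuous_ofReal.comp (contDiff_smoothWeight hε).continuous).mul ?_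
      refine Continuous.add ?_ (continuous_finsetSum _ fun α _ => ?_)
      · exact continuous_laplacian hf
      · have h1 := hf.continuous_fderiv (by simp)
        refine Continuous.mul ?_ (by fun_prop)
        refine continuous_const.mul (Continuous.div (by fun_prop) (by fun_prop) fun x => ?_)
        have : ⟪α, x⟫_ℝ ^ 2 + ε ≠ 0 := by positivity
        exact_mod_cast this
    · refine HasCompactSupport.mul_left (hfc.mono' ?_)
      intro x hx
      by_contra hxs
      have h1 : f =ᶠ[nhds x] fun _ => 0 := notMem_tsupport_iff_eventuallyEq.1 hxs
      refine hx ?_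
      have h2 : fderiv ℝ f x = 0 := by rw [h1.fderiv_eq]; simp
      simp [laplacian_eq_zero_of_eventuallyEq h1, h2]
  · exact integrable_finsetSum _ fun α h => ((hα α h).1).const_mul _

/-- The integral of a Dunkl Laplacian against the weight vanishes. -/
theorem integral_dunklWeight_mul_dunklLaplacian (hR : IsRootSystem R) (hκ : IsMultiplicity R κ)
    (hf : ContDiff ℝ ∞ f) (hfc : HasCompactSupport f) :
    ∫ x, (dunklWeight R κ x : ℂ) * dunklLaplacian R κ f x = 0 := by
  obtain ⟨C₀, hC₀⟩ := (hasCompactSupport_laplacian hfc).exists_bound_of_continuous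
    (continuous_laplacian hf)
  have hroot : ∀ α : E d, ∃ C, 0 ≤ C ∧ (α ∈ R → ∀ x, ‖rootTerm α f x‖ ≤ C) := by
    intro α
    by_cases h : α ∈ R
    · obtain ⟨C, hC⟩ := exists_norm_rootTerm_le hf hfc (hR.ne_zero α h)
      exact ⟨C, (norm_nonneg _).trans (hC 0), fun _ => hC⟩
    · exact ⟨0, le_rfl, fun h' => absurd h' h⟩
  choose C hCnn hC using hroot
  obtain ⟨r, hr⟩ := hfc.isCompact.isBounded.subset_closedBall (0 : E d)
  have hfr : ∀ x, r < ‖x‖ → f x = 0 := fun x hx => by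
    refine image_eq_zero_of_notMem_tsupport fun h => ?_
    exact absurd (hr h) (by simpa using hx)
  obtain ⟨M, hM⟩ := (isCompact_closedBall (0 : E d) r).exists_bound_of_continuousOn
    (contDiff_smoothWeight (R := R) (κ := κ) one_pos).continuous.continuousOn
  set F : ℝ → E d → ℂ := fun ε x => (smoothWeight R κ ε x : ℂ) * (Laplacian.laplacian f x +
    ∑ α ∈ R, (κ α : ℂ) * (((⟪α, x⟫_ℝ ^ 2 / (⟪α, x⟫_ℝ ^ 2 + ε) : ℝ) : ℂ) * rootTerm α f x))
  have hmeas_root : ∀ α : E d, Measurable (rootTerm α f) := by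
    intro α
    have h1 := (hf.continuous_fderiv (by simp)).measurable
    have h2 : Measurable fun x => f (sigma α x) :=
      hf.continuous.measurable.comp (measurableEmbedding_sigma α).measurable
    have h3 : Measurable fun x : E d => ((⟪α, x⟫_ℝ : ℝ) : ℂ) :=
      (Continuous.measurable (by fun_prop))
    have h4 : Measurable fun x => fderiv ℝ f x α :=
      ((hf.continuous_fderiv (by simp)).clm_apply continuous_const).measurable
    exact (h4.div h3).sub (((measurable_const.mul (hf.continuous.measurable.sub h2))).div
      (h3.pow_const 2))
  -- Dominated convergence. For `ε ≤ 1` the regularized weight is at most its value at `ε = 1`,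
  -- which is bounded by `M` on the ball; the fractions are at most `1`, and the root terms are
  -- bounded.
  have hlim : Filter.Tendsto (fun ε => ∫ x, F ε x) (nhdsWithin 0 (Set.Ioi 0))
      (nhds (∫ x, (dunklWeight R κ x : ℂ) * dunklLaplacian R κ f x)) := by
    refine tendsto_integral_filter_of_dominated_convergence
      ((Metric.closedBall (0 : E d) r).indicator fun _ => M * (C₀ + ∑ α ∈ R, κ α * C α)) ?_ ?_ ?_ ?_
    · filter_upwards [self_mem_nhdsWithin] with ε (hε : 0 < ε)
      refine (Measurable.mul ?_ (Measurable.add ?_ ?_)).aestronglyMeasurable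
      · exact (Complex.continuous_ofReal.comp (contDiff_smoothWeight hε).continuous).measurable
      · exact (continuous_laplacian hf).measurable
      · refine Finset.measurable_sum _ fun α _ => measurable_const.mul
          (Measurable.mul (Continuous.measurable ?_) (hmeas_root α))
        refine Complex.continuous_ofReal.comp
          (Continuous.div (by fun_prop) (by fun_prop) fun x => by positivity)
    · filter_upwards [Ioc_mem_nhdsGT one_pos] with ε hε
      refine Filter.Eventually.of_forall fun x => ?_
      by_cases hx : ‖x‖ ≤ r
      · rw [Set.indicator_of_mem (by simpa using hx), norm_mul]
        have hw : ‖(smoothWeight R κ ε x : ℂ)‖ ≤ M := by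
          rw [Complex.norm_real, Real.norm_of_nonneg (smoothWeight_pos hε.1 x).le]
          exact (smoothWeight_mono hκ hε.1.le hε.2 x).trans
            ((le_abs_self _).trans (hM x (by simpa using hx)))
        refine mul_le_mul hw ((norm_add_le _ _).trans (add_le_add (hC₀ x) ?_)) (norm_nonneg _)
          ((norm_nonneg _).trans hw)
        refine norm_sum_le_of_le _ fun α hα => ?_
        rw [norm_mul, Complex.norm_real, Real.norm_of_nonneg (hκ.nonneg α hα), norm_mul,
          Complex.norm_real]
        refine mul_le_mul_of_nonneg_left ?_ (hκ.nonneg α hα)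
        have hq : ‖⟪α, x⟫_ℝ ^ 2 / (⟪α, x⟫_ℝ ^ 2 + ε)‖ ≤ 1 := by
          have h0 : 0 < ⟪α, x⟫_ℝ ^ 2 + ε := by have := hε.1; positivity
          rw [Real.norm_of_nonneg (by positivity), div_le_one h0]
          linarith [hε.1]
        calc _ ≤ 1 * C α := mul_le_mul hq (hC α hα x) (norm_nonneg _) zero_le_one
          _ = C α := one_mul _
      · push Not at hx
        have h1 : f =ᶠ[nhds x] fun _ => 0 :=
          (continuous_norm.tendsto x).eventually (lt_mem_nhds hx) |>.mono fun y hy => hfr y hy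
        rw [Set.indicator_of_notMem (by simpa using hx)]
        simp [F, laplacian_eq_zero_of_eventuallyEq h1, rootTerm_eq_zero hfr hx]
    · exact (integrable_indicator_iff measurableSet_closedBall).2
        (integrableOn_const (isCompact_closedBall _ _).measure_lt_top.ne)
    · filter_upwards [ae_inner_ne_zero hR] with x hx
      rw [dunklLaplacian_eq_rootTerm]
      refine ((Complex.continuous_ofReal.tendsto _).comp (tendsto_smoothWeight hκ x)).mul
        (tendsto_const_nhds.add (tendsto_finsetSum _ fun α hα => tendsto_const_nhds.mul ?_))
      have hc : ⟪α, x⟫_ℝ ^ 2 ≠ 0 := pow_ne_zero 2 (hx α hα)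
      have h1 : Filter.Tendsto (fun ε : ℝ => ⟪α, x⟫_ℝ ^ 2 / (⟪α, x⟫_ℝ ^ 2 + ε))
          (nhdsWithin 0 (Set.Ioi 0)) (nhds 1) := by
        have : ContinuousAt (fun ε : ℝ => ⟪α, x⟫_ℝ ^ 2 / (⟪α, x⟫_ℝ ^ 2 + ε)) 0 :=
          ContinuousAt.div (by fun_prop) (by fun_prop) (by simpa using hc)
        have h := this.tendsto.mono_left (nhdsWithin_le_nhds (s := Set.Ioi 0))
        simpa [div_self hc] using h
      simpa using ((Complex.continuous_ofReal.tendsto _).comp h1).mul_const (rootTerm α f x)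
  refine tendsto_nhds_unique hlim ?_
  refine tendsto_const_nhds.congr' ?_
  filter_upwards [self_mem_nhdsWithin] with ε (hε : 0 < ε)
  exact (integral_smoothWeight_mul_rootTerm hR hκ hε hf hfc).symm

end Green

/-! ### Polar coordinates -/

section Polar

variable {𝕜 : Type*} [RCLike 𝕜]

theorem integral_volumeIoiPow (n : ℕ) (f : ℝ → 𝕜) :
    ∫ r : Set.Ioi (0 : ℝ), f r ∂Measure.volumeIoiPow n = ∫ r in Set.Ioi (0 : ℝ), r ^ n • f r := by
  simp only [Measure.volumeIoiPow, ENNReal.ofReal]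
  rw [integral_withDensity_eq_integral_smul,
    integral_subtype_comap measurableSet_Ioi fun a => Real.toNNReal (a ^ n) • f a,
    setIntegral_congr_fun measurableSet_Ioi fun x hx => ?_]
  · rw [NNReal.smul_def, Real.coe_toNNReal _ (pow_nonneg (le_of_lt hx) _)]
  · exact (measurable_subtype_coe.pow_const _).real_toNNReal

theorem integrable_volumeIoiPow (n : ℕ) (f : ℝ → 𝕜) :
    Integrable (fun r : Set.Ioi (0 : ℝ) => f r) (Measure.volumeIoiPow n) ↔
      IntegrableOn (fun r => r ^ n • f r) (Set.Ioi (0 : ℝ)) := by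
  rw [integrableOn_iff_comap_subtypeVal measurableSet_Ioi, Function.comp_def,
    Measure.volumeIoiPow, integrable_withDensity_iff_integrable_smul', integrable_congr]
  · refine .of_forall ?_
    rintro ⟨x, hx : 0 < x⟩
    simp (disch := positivity) [ENNReal.toReal_ofReal]
  · fun_prop
  · simp

variable {Q : E d → 𝕜} {M : ℝ}

theorem polar_smul_rpow (hd : 1 ≤ d) {r : ℝ} (hr : 0 < r) (c : 𝕜) :
    r ^ (Module.finrank ℝ (E d) - 1) • (r ^ M • c) = r ^ (d - 1 + M) • c := by
  rw [smul_smul, finrank_euclideanSpace_fin, ← Real.rpow_natCast, ← Real.rpow_add hr]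
  push_cast [hd]
  rfl

/-- Polar coordinates for the product of a homogeneous and a radial function. -/
theorem integral_homogeneous_mul_radial (hd : 1 ≤ d)
    (hQ : ∀ r : ℝ, 0 < r → ∀ x, Q (r • x) = r ^ M • Q x) (ρ : ℝ → 𝕜) :
    ∫ x, Q x * ρ ‖x‖ = (∫ θ : Metric.sphere (0 : E d) 1, Q θ ∂(volume : Measure (E d)).toSphere) *
      ∫ r in Set.Ioi (0 : ℝ), r ^ (d - 1 + M) • ρ r := by
  have hne : Nontrivial (E d) := by
    have : Nonempty (Fin d) := ⟨⟨0, hd⟩⟩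
    infer_instance
  calc ∫ x, Q x * ρ ‖x‖ = ∫ x : ({(0)}ᶜ : Set (E d)), Q x * ρ ‖x.1‖ ∂(volume.comap Subtype.val) := by
        rw [integral_subtype_comap (measurableSet_singleton _).compl fun x => Q x * ρ ‖x‖,
          restrict_compl_singleton]
    _ = ∫ z : Metric.sphere (0 : E d) 1 × Set.Ioi (0 : ℝ), Q z.1 * (z.2.1 ^ M • ρ z.2)
          ∂(volume : Measure (E d)).toSphere.prod (.volumeIoiPow (Module.finrank ℝ (E d) - 1)) := by
        rw [← (volume : Measure (E d)).measurePreserving_homeomorphUnitSphereProd.integral_comp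
          (Homeomorph.measurableEmbedding _)]
        congr 1
        ext x
        have hx : 0 < ‖x.1‖ := norm_pos_iff.2 x.2
        simp only [homeomorphUnitSphereProd_apply_fst_coe, homeomorphUnitSphereProd_apply_snd_coe]
        rw [mul_smul_comm, ← smul_mul_assoc, ← hQ _ hx, smul_smul, mul_inv_cancel₀ hx.ne', one_smul]
    _ = _ := by
        rw [integral_prod_mul (fun θ : Metric.sphere (0 : E d) 1 => Q θ)
          (fun r : Set.Ioi (0 : ℝ) => r.1 ^ M • ρ r),
          integral_volumeIoiPow _ (fun r => r ^ M • ρ r)]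
        congr 1
        exact setIntegral_congr_fun measurableSet_Ioi fun r hr => polar_smul_rpow hd hr _

theorem integrable_homogeneous_mul_radial (hd : 1 ≤ d)
    (hQ : ∀ r : ℝ, 0 < r → ∀ x, Q (r • x) = r ^ M • Q x)
    (hQc : Integrable (fun θ : Metric.sphere (0 : E d) 1 => Q θ) (volume : Measure (E d)).toSphere)
    {ρ : ℝ → 𝕜} (hρ : IntegrableOn (fun r : ℝ => r ^ (d - 1 + M) • ρ r) (Set.Ioi (0 : ℝ))) :
    Integrable fun x => Q x * ρ ‖x‖ := by
  have hne : Nontrivial (E d) := by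
    have : Nonempty (Fin d) := ⟨⟨0, hd⟩⟩
    infer_instance
  have h1 : Integrable (fun r : Set.Ioi (0 : ℝ) => r.1 ^ M • ρ r)
      (Measure.volumeIoiPow (Module.finrank ℝ (E d) - 1)) := by
    rw [integrable_volumeIoiPow _ (fun r => r ^ M • ρ r)]
    exact hρ.congr_fun (fun r hr => (polar_smul_rpow hd hr _).symm) measurableSet_Ioi
  have h2 := ((volume : Measure (E d)).measurePreserving_homeomorphUnitSphereProd.integrable_comp_emb
    (Homeomorph.measurableEmbedding _)).2 (hQc.mul_prod h1)
  rw [← restrict_compl_singleton (μ := volume) (0 : E d), ← IntegrableOn,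
    integrableOn_iff_comap_subtypeVal (measurableSet_singleton _).compl]
  refine h2.congr (.of_forall fun x => ?_)
  have hx : 0 < ‖x.1‖ := norm_pos_iff.2 x.2
  simp only [Function.comp_apply, homeomorphUnitSphereProd_apply_fst_coe,
    homeomorphUnitSphereProd_apply_snd_coe]
  rw [mul_smul_comm, ← smul_mul_assoc, ← hQ _ hx, smul_smul, mul_inv_cancel₀ hx.ne', one_smul]

theorem integrable_sphere_of_continuous (hQ : Continuous Q) :
    Integrable (fun θ : Metric.sphere (0 : E d) 1 => Q θ) (volume : Measure (E d)).toSphere := by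
  have hc : Continuous fun θ : Metric.sphere (0 : E d) 1 => Q θ := hQ.comp continuous_subtype_val
  obtain ⟨C, hC⟩ := isCompact_univ.exists_bound_of_continuousOn hc.continuousOn
  exact Integrable.of_bound hc.aestronglyMeasurable C (.of_forall fun θ => hC θ (Set.mem_univ _))

end Polar

/-! ### The homogeneous weight and spherical means of harmonic polynomials -/

section Weight

variable {R : Finset (E d)} {κ : E d → ℝ}

theorem continuous_dunklWeight (hκ : IsMultiplicity R κ) : Continuous (dunklWeight R κ) := by
  refine continuous_finsetProd _ fun α hα => ?_
  exact (Real.continuous_rpow_const (hκ.nonneg α hα)).comp (by fun_prop)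

theorem dunklWeight_nonneg (x : E d) : 0 ≤ dunklWeight R κ x :=
  Finset.prod_nonneg fun _ _ => by positivity

theorem dunklWeight_smul {r : ℝ} (hr : 0 < r) (x : E d) :
    dunklWeight R κ (r • x) = r ^ (2 * index R κ) * dunklWeight R κ x := by
  have h : 2 * index R κ = ∑ α ∈ R, κ α := by rw [index]; ring
  rw [h, Real.rpow_sum_of_pos hr, dunklWeight, dunklWeight, ← Finset.prod_mul_distrib]
  refine Finset.prod_congr rfl fun α _ => ?_
  rw [inner_smul_right, abs_mul, abs_of_pos hr, Real.mul_rpow hr.le (abs_nonneg _)]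

theorem index_nonneg (hκ : IsMultiplicity R κ) : 0 ≤ index R κ :=
  mul_nonneg (by norm_num) (Finset.sum_nonneg hκ.nonneg)

variable {p : MvPolynomial (Fin d) ℂ} {m : ℕ}

theorem polyFun_mul_dunklWeight_smul (hp : p.IsHomogeneous m) (r : ℝ) (hr : 0 < r) (x : E d) :
    polyFun p (r • x) * (dunklWeight R κ (r • x) : ℂ) =
      r ^ (m + 2 * index R κ) • (polyFun p x * (dunklWeight R κ x : ℂ)) := by
  rw [polyFun_smul hp, dunklWeight_smul hr, Real.rpow_add hr, Real.rpow_natCast, Complex.real_smul]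
  push_cast
  ring

/-- A smooth cutoff equal to `1` for `s ≤ 1` and to `0` for `s ≥ 2`. -/
def cutoff (s : ℝ) : ℝ := Real.smoothTransition (2 - s)

theorem contDiff_cutoff {n : ℕ∞} : ContDiff ℝ n cutoff :=
  Real.smoothTransition.contDiff.comp (contDiff_const.sub contDiff_id)

theorem cutoff_of_le {s : ℝ} (h : s ≤ 1) : cutoff s = 1 :=
  Real.smoothTransition.one_of_one_le (by linarith)

theorem cutoff_of_ge {s : ℝ} (h : 2 ≤ s) : cutoff s = 0 :=
  Real.smoothTransition.zero_of_nonpos (by linarith)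

theorem antitone_cutoff : Antitone cutoff := fun _ _ h =>
  Real.smoothTransition.monotone (by linarith)

theorem cutoff_nonneg (s : ℝ) : 0 ≤ cutoff s := Real.smoothTransition.nonneg _

theorem cutoff_le_one (s : ℝ) : cutoff s ≤ 1 := Real.smoothTransition.le_one _

theorem cutoff_eventuallyEq_const {s : ℝ} (h : s < 1 ∨ 2 < s) :
    ∃ c, cutoff =ᶠ[nhds s] fun _ => c := by
  rcases h with h | h
  · exact ⟨1, (gt_mem_nhds h).mono fun t ht => cutoff_of_le (le_of_lt ht)⟩
  · exact ⟨0, (lt_mem_nhds h).mono fun t ht => cutoff_of_ge (le_of_lt ht)⟩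

theorem deriv_cutoff_eventuallyEq_zero {s : ℝ} (h : s < 1 ∨ 2 < s) :
    deriv cutoff =ᶠ[nhds s] fun _ => 0 := by
  obtain ⟨c, hc⟩ := cutoff_eventuallyEq_const h
  simpa using hc.deriv

theorem hasDerivAt_cutoff (s : ℝ) : HasDerivAt cutoff (deriv cutoff s) s :=
  ((contDiff_cutoff (n := 1)).differentiable (by norm_num) s).hasDerivAt

theorem contDiff_deriv_cutoff : ContDiff ℝ 1 (deriv cutoff) :=
  ContDiff.deriv' (contDiff_cutoff (n := 2))

theorem hasDerivAt_deriv_cutoff (s : ℝ) :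
    HasDerivAt (deriv cutoff) (deriv (deriv cutoff) s) s :=
  (contDiff_deriv_cutoff.differentiable (by norm_num) s).hasDerivAt

/-- The part without `l` is the derivative of `2 r^N χ'(r²)` and integrates to zero. There remains
`2l ∫ r^{N-1} χ'(r²) dr`, which is negative: `χ' ≤ 0`, and on its support `r ≥ 1`, so `r^{N-1} ≥ r`
by `N ≥ 2`, whereas `∫ 2r χ'(r²) dr = -1`. -/
theorem integral_cutoff_ne_zero {N l : ℝ} (hN : 2 ≤ N) (hl : 0 < l) :
    ∫ r in Set.Ioi (0 : ℝ), r ^ (N - 1) * (4 * r ^ 2 * deriv (deriv cutoff) (r ^ 2) +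
      (2 * N + 2 * l) * deriv cutoff (r ^ 2)) ≠ 0 := by
  have hz1 : ∀ r : ℝ, r ^ 2 < 1 ∨ 2 < r ^ 2 → deriv cutoff (r ^ 2) = 0 := fun r h =>
    (deriv_cutoff_eventuallyEq_zero h).self_of_nhds
  have hz2 : ∀ r : ℝ, r ^ 2 < 1 ∨ 2 < r ^ 2 → deriv (deriv cutoff) (r ^ 2) = 0 := fun r h => by
    simpa using (deriv_cutoff_eventuallyEq_zero h).deriv_eq
  have hc1 : Continuous (deriv cutoff) := contDiff_deriv_cutoff.continuous
  have hc2 : Continuous (deriv (deriv cutoff)) := contDiff_deriv_cutoff.continuous_deriv (by norm_num)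
  have hrp : ∀ b : ℝ, 0 ≤ b → Continuous fun r : ℝ => r ^ b := fun b hb =>
    Real.continuous_rpow_const hb
  have hcN1 := hrp (N - 1) (by linarith)
  have hderiv : ∀ r ∈ Set.uIcc (1 / 2 : ℝ) 2, HasDerivAt (fun r : ℝ => r ^ N * deriv cutoff (r ^ 2))
      (r ^ (N - 1) * (2 * r ^ 2 * deriv (deriv cutoff) (r ^ 2) + N * deriv cutoff (r ^ 2))) r := by
    intro r hr
    rw [Set.uIcc_of_le (by norm_num)] at hr
    have hr0 : 0 < r := lt_of_lt_of_le (by norm_num) hr.1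
    have h1 := Real.hasDerivAt_rpow_const (p := N) (Or.inl hr0.ne')
    have h2 := (hasDerivAt_deriv_cutoff (r ^ 2)).comp r (hasDerivAt_pow 2 r)
    refine (h1.mul h2).congr_deriv ?_
    have : r ^ N = r ^ (N - 1) * r := by
      rw [← Real.rpow_add_one hr0.ne']
      congr 1
      ring
    rw [this]
    simp
    ring
  have hI1 : ∫ r in (1 / 2 : ℝ)..2, r ^ (N - 1) * (2 * r ^ 2 * deriv (deriv cutoff) (r ^ 2) +
      N * deriv cutoff (r ^ 2)) = 0 := by
    rw [intervalIntegral.integral_eq_sub_of_hasDerivAt hderiv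
      (Continuous.intervalIntegrable (by fun_prop) _ _), hz1 2 (by norm_num),
      hz1 (1 / 2) (by norm_num)]
    simp
  have hI2 : ∫ r in (1 / 2 : ℝ)..2, 2 * r * deriv cutoff (r ^ 2) = -1 := by
    have : ∀ r ∈ Set.uIcc (1 / 2 : ℝ) 2, HasDerivAt (fun r : ℝ => cutoff (r ^ 2))
        (2 * r * deriv cutoff (r ^ 2)) r := by
      intro r _
      refine ((hasDerivAt_cutoff (r ^ 2)).comp r (hasDerivAt_pow 2 r)).congr_deriv ?_
      simp
      ring
    rw [intervalIntegral.integral_eq_sub_of_hasDerivAt this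
      (Continuous.intervalIntegrable (by fun_prop) _ _), cutoff_of_ge (by norm_num),
      cutoff_of_le (by norm_num)]
    norm_num
  have hI3 : ∫ r in (1 / 2 : ℝ)..2, r ^ (N - 1) * deriv cutoff (r ^ 2) ≤ -1 / 2 := by
    have hle : ∫ r in (1 / 2 : ℝ)..2, r ^ (N - 1) * deriv cutoff (r ^ 2) ≤
        ∫ r in (1 / 2 : ℝ)..2, 1 / 2 * (2 * r * deriv cutoff (r ^ 2)) := by
      refine intervalIntegral.integral_mono_on (by norm_num)
        (Continuous.intervalIntegrable (by fun_prop) _ _)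
        (Continuous.intervalIntegrable (by fun_prop) _ _) fun r hr => ?_
      have hr0 : 0 < r := lt_of_lt_of_le (by norm_num) hr.1
      by_cases h : r ^ 2 < 1
      · simp [hz1 r (Or.inl h)]
      · have h1 : 1 ≤ r := by nlinarith
        have h2 : r ≤ r ^ (N - 1) := by
          conv_lhs => rw [← Real.rpow_one r]
          exact Real.rpow_le_rpow_of_exponent_le h1 (by linarith)
        have h3 : deriv cutoff (r ^ 2) ≤ 0 := antitone_cutoff.deriv_nonpos
        nlinarith [mul_le_mul_of_nonpos_right h2 h3]
    rw [intervalIntegral.integral_const_mul, hI2] at hle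
    linarith
  have hsplit : ∫ r in Set.Ioi (0 : ℝ), r ^ (N - 1) * (4 * r ^ 2 * deriv (deriv cutoff) (r ^ 2) +
      (2 * N + 2 * l) * deriv cutoff (r ^ 2)) =
      2 * l * ∫ r in (1 / 2 : ℝ)..2, r ^ (N - 1) * deriv cutoff (r ^ 2) := by
    have h1 : ∫ r in Set.Ioi (0 : ℝ), r ^ (N - 1) * (4 * r ^ 2 * deriv (deriv cutoff) (r ^ 2) +
      (2 * N + 2 * l) * deriv cutoff (r ^ 2)) = ∫ r in Set.Ioc (1 / 2 : ℝ) 2, r ^ (N - 1) *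
      (4 * r ^ 2 * deriv (deriv cutoff) (r ^ 2) + (2 * N + 2 * l) * deriv cutoff (r ^ 2)) := by
      refine setIntegral_eq_of_subset_of_forall_sdiff_eq_zero measurableSet_Ioi
        (fun r hr => lt_trans (by norm_num) hr.1) fun r hr => ?_
      have hr0 : 0 < r := hr.1
      have : r ^ 2 < 1 ∨ 2 < r ^ 2 := by
        by_cases h : 1 / 2 < r
        · have : 2 < r := by
            by_contra hc
            exact hr.2 ⟨h, not_lt.1 hc⟩
          right; nlinarith
        · left; nlinarith
      rw [hz1 r this, hz2 r this]
      simp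
    rw [h1, ← intervalIntegral.integral_of_le (by norm_num),
      ← intervalIntegral.integral_const_mul]
    have h2 : ∫ r in (1 / 2 : ℝ)..2, ((r ^ (N - 1) * (4 * r ^ 2 * deriv (deriv cutoff) (r ^ 2) +
        (2 * N + 2 * l) * deriv cutoff (r ^ 2))) - 2 * (r ^ (N - 1) * (2 * r ^ 2 *
        deriv (deriv cutoff) (r ^ 2) + N * deriv cutoff (r ^ 2)))) =
        ∫ r in (1 / 2 : ℝ)..2, 2 * l * (r ^ (N - 1) * deriv cutoff (r ^ 2)) := by
      congr 1
      ext r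
      ring
    rw [← h2, intervalIntegral.integral_sub (Continuous.intervalIntegrable (by fun_prop) _ _)
      (Continuous.intervalIntegrable (by fun_prop) _ _), intervalIntegral.integral_const_mul, hI1]
    simp
  rw [hsplit]
  nlinarith [hI3, hl]

/-- Harmonic polynomials of positive degree have weighted mean zero on the sphere. -/
theorem integral_sphere_harmonic (hd : 1 ≤ d) (hR : IsRootSystem R) (hκ : IsMultiplicity R κ)
    (hp : IsHarmonic R κ m p) (hm : 1 ≤ m) :
    ∫ θ : Metric.sphere (0 : E d) 1, polyFun p θ * (dunklWeight R κ θ : ℂ)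
      ∂(volume : Measure (E d)).toSphere = 0 := by
  set f : E d → ℂ := fun x => polyFun p x * (cutoff (‖x‖ ^ 2) : ℂ)
  have hf : ContDiff ℝ ∞ f := (contDiff_polyFun p).mul
    (Complex.ofRealCLM.contDiff.comp (contDiff_cutoff.comp (contDiff_norm_sq ℝ)))
  have hfc : HasCompactSupport f := by
    refine HasCompactSupport.intro (isCompact_closedBall (0 : E d) 2) fun x hx => ?_
    have : 2 ≤ ‖x‖ ^ 2 := by
      have : 2 < ‖x‖ := by simpa using hx
      nlinarith
    simp [f, cutoff_of_ge this]
  -- In polar coordinates this vanishing integral is the spherical mean times a radial integral, so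
  -- it is enough that the radial integral is nonzero.
  have hG := integral_dunklWeight_mul_dunklLaplacian hR hκ hf hfc
  set ρ : ℝ → ℂ := fun r => ((4 * r ^ 2 * deriv (deriv cutoff) (r ^ 2) +
    (4 * m + 2 * d + 4 * index R κ) * deriv cutoff (r ^ 2) : ℝ) : ℂ) with hρ
  have e : (fun x => (dunklWeight R κ x : ℂ) * dunklLaplacian R κ f x) =ᵐ[volume]
      fun x => (polyFun p x * (dunklWeight R κ x : ℂ)) * ρ ‖x‖ := by
    filter_upwards [ae_inner_ne_zero hR] with x hx
    rw [dunklLaplacian_harmonic_mul_radial hp (.of_forall hasDerivAt_cutoff)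
      (hasDerivAt_deriv_cutoff _) hx]
    simp only [hρ]
    ring
  rw [integral_congr_ae e, integral_homogeneous_mul_radial hd
    (polyFun_mul_dunklWeight_smul hp.1) ρ] at hG
  refine (mul_eq_zero.1 hG).resolve_right ?_
  have hm' : (1 : ℝ) ≤ m := by exact_mod_cast hm
  have hd' : (1 : ℝ) ≤ d := by exact_mod_cast hd
  have hi := index_nonneg hκ
  -- The coefficient `4m + 2d + 4⟨κ⟩` equals `2N + 2l`; the excess `l = m` over the exact-derivative
  -- case is positive because `m ≥ 1`.
  have := integral_cutoff_ne_zero (N := d + m + 2 * index R κ) (l := m) (by linarith) (by linarith)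
  have e2 : ∀ r : ℝ, r ^ ((d : ℝ) - 1 + (m + 2 * index R κ)) • ρ r =
      ((r ^ ((d : ℝ) + m + 2 * index R κ - 1) * (4 * r ^ 2 * deriv (deriv cutoff) (r ^ 2) +
      (2 * (d + m + 2 * index R κ) + 2 * m) * deriv cutoff (r ^ 2)) : ℝ) : ℂ) := by
    intro r
    rw [Complex.real_smul, hρ, ← Complex.ofReal_mul]
    congr 2
    · congr 1; ring
    · ring
  simp_rw [e2]
  rw [integral_complex_ofReal]
  exact_mod_cast this

end Weight

/-! ### Exponentials of operators on spans of eigenvectors -/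

section Spectral

variable {H : Type*} [NormedAddCommGroup H] [InnerProductSpace ℂ H] [CompleteSpace H]
  {e : ℕ → H}

theorem summable_smul_orthonormal (he : Orthonormal ℂ e) {c : ℕ → ℂ}
    (hc : Summable fun l => ‖c l‖ ^ 2) : Summable fun l => c l • e l := by
  simpa using (he.orthogonalFamily.summable_iff_norm_sq_summable c).2 hc

/-- The orthonormal expansion of an element of the closed span of an orthonormal sequence. -/
theorem hasSum_inner_smul_orthonormal (he : Orthonormal ℂ e) {f : H}
    (hf : f ∈ (Submodule.span ℂ (Set.range e)).topologicalClosure) :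
    HasSum (fun l => inner ℂ (e l) f • e l) f := by
  set K := (Submodule.span ℂ (Set.range e)).topologicalClosure with hK
  have hsum : Summable fun l => inner ℂ (e l) f • e l :=
    summable_smul_orthonormal he (Orthonormal.inner_products_summable f he)
  obtain ⟨S, hS⟩ := hsum
  have heK : ∀ l, e l ∈ K := fun l =>
    Submodule.le_topologicalClosure _ (Submodule.subset_span ⟨l, rfl⟩)
  have hSK : S ∈ K := by
    have hcl : IsClosed (K : Set H) := Submodule.isClosed_topologicalClosure _
    exact hcl.mem_of_tendsto hS (.of_forall fun s =>
      Submodule.sum_mem _ fun l _ => Submodule.smul_mem _ _ (heK l))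
  have hinner : ∀ l, inner ℂ (e l) (f - S) = 0 := by
    intro l
    have h1 := hS.mapL (innerSL ℂ (e l))
    have h2 : HasSum (fun m => innerSL ℂ (e l) (inner ℂ (e m) f • e m)) (inner ℂ (e l) f) := by
      have h3 : ∀ m, innerSL ℂ (e l) (inner ℂ (e m) f • e m) =
          if m = l then inner ℂ (e l) f else 0 := by
        intro m
        rw [map_smul, innerSL_apply_apply, orthonormal_iff_ite.1 he l m]
        by_cases h : m = l
        · simp [h]
        · simp [h, Ne.symm h]
      simp_rw [h3]
      exact hasSum_ite_eq l _
    rw [inner_sub_right, h2.unique h1]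
    simp
  have hperp : f - S ∈ Kᗮ := by
    rw [hK, Submodule.orthogonal_closure, Submodule.mem_orthogonal]
    intro u hu
    induction hu using Submodule.span_induction with
    | mem u hu => obtain ⟨l, rfl⟩ := hu; exact hinner l
    | zero => simp
    | add u v _ _ hu hv => rw [inner_add_left, hu, hv, add_zero]
    | smul c u _ hu => rw [inner_smul_left, hu, mul_zero]
  have h0 : f - S = 0 := by
    have := Submodule.inner_right_of_mem_orthogonal (K.sub_mem hf hSK) hperp
    exact inner_self_eq_zero.1 this
  rw [sub_eq_zero.1 h0]
  rwa [sub_eq_zero.1 h0] at hS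

/-- The exponential acts diagonally on the closed span of a sequence of eigenvectors. -/
theorem hasSum_expOp {G : Submodule ℂ (H × H)} (he : Orthonormal ℂ e) {t : ℕ → ℝ}
    (ht : Function.Injective t) (hmem : ∀ l, e l ∈ eigenspace G (t l))
    (hsymm : ∀ w ∈ G, ∀ l, inner ℂ (e l) w.2 = t l * inner ℂ (e l) w.1) {z : ℂ}
    (hz : ∀ l, ‖Complex.exp (z * t l)‖ ≤ 1) {f : H}
    (hf : f ∈ (Submodule.span ℂ (Set.range e)).topologicalClosure) :
    HasSum (fun l => Complex.exp (z * t l) • inner ℂ (e l) f • e l) (expOp G z f) := by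
  have hexp := hasSum_inner_smul_orthonormal he hf
  -- An eigenspace may be larger than the line of `e l`. It suffices that `e l` lies in its own
  -- eigenspace and, by `hsymm`, is orthogonal to all the others.
  have hproj : ∀ (s : ℝ) (l : ℕ), (eigenspace G s).topologicalClosure.starProjection (e l) =
      if t l = s then e l else 0 := by
    intro s l
    split_ifs with h
    · subst h
      exact Submodule.starProjection_eq_self_iff.2 (Submodule.le_topologicalClosure _ (hmem l))
    · rw [Submodule.starProjection_apply_eq_zero_iff, Submodule.orthogonal_closure,
        Submodule.mem_orthogonal']
      intro u hu
      have h1 := hsymm (u, (s : ℂ) • u) hu l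
      simp only [inner_smul_right] at h1
      have h2 : ((s : ℂ) - t l) * inner ℂ (e l) u = 0 := by rw [sub_mul, h1, sub_self]
      refine (mul_eq_zero.1 h2).resolve_left ?_
      rw [← ne_eq, sub_ne_zero]
      exact_mod_cast Ne.symm h
  have hP : ∀ s : ℝ, HasSum (fun l => inner ℂ (e l) f • if t l = s then e l else 0)
      ((eigenspace G s).topologicalClosure.starProjection f) := by
    intro s
    have := hexp.mapL (eigenspace G s).topologicalClosure.starProjection
    simpa only [map_smul, hproj] using this
  have hPt : ∀ l, (eigenspace G (t l)).topologicalClosure.starProjection f =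
      inner ℂ (e l) f • e l := by
    intro l
    refine (hP (t l)).unique ?_
    have : (fun m => inner ℂ (e m) f • if t m = t l then e m else 0) =
        fun m => if m = l then inner ℂ (e l) f • e l else 0 := by
      ext m
      by_cases h : m = l
      · simp [h]
      · simp [h, ht.ne h]
    rw [this]
    exact hasSum_ite_eq l _
  have hP0 : ∀ s ∉ Set.range t, (eigenspace G s).topologicalClosure.starProjection f = 0 := by
    intro s hs
    refine (hP s).unique ?_
    have : (fun m => inner ℂ (e m) f • if t m = s then e m else 0) = fun _ => 0 := by
      ext m
      rw [if_neg fun h : t m = s => hs ⟨m, h⟩, smul_zero]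
    rw [this]
    exact hasSum_zero
  have hs1 : Summable fun l => Complex.exp (z * t l) • inner ℂ (e l) f • e l := by
    simp_rw [smul_smul]
    refine summable_smul_orthonormal he (Summable.of_nonneg_of_le (fun _ => by positivity)
      (fun l => ?_) (Orthonormal.inner_products_summable f he))
    rw [norm_mul]
    gcongr
    exact mul_le_of_le_one_left (norm_nonneg _) (hz l)
  have hs2 : Summable ((fun s : ℝ => Complex.exp (z * s) •
      (eigenspace G s).topologicalClosure.starProjection f) ∘ t) := by
    simpa only [Function.comp_def, hPt] using hs1
  have hs3 := (ht.hasSum_iff (f := fun s : ℝ => Complex.exp (z * s) •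
      (eigenspace G s).topologicalClosure.starProjection f)
      (fun s hs => by rw [hP0 s hs, smul_zero])).1 hs2.hasSum
  rw [expOp, hs3.tsum_eq]
  simpa only [Function.comp_def, hPt] using hs2.hasSum

/-- The exponential moves onto the test vector: if its phases change the coefficients of `v` into
those of `v'` up to a factor `b` that does not depend on `l`, then the termwise identity sums.
Orthogonality of the `Φ l` comes from `hsymm` and the distinct eigenvalues. -/
theorem inner_expOp_eq {G : Submodule ℂ (H × H)} {Φ : ℕ → H} (hΦ : ∀ l, Φ l ≠ 0) {t : ℕ → ℝ}
    (ht : Function.Injective t) (hmem : ∀ l, Φ l ∈ eigenspace G (t l))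
    (hsymm : ∀ w ∈ G, ∀ l, inner ℂ (Φ l) w.2 = t l * inner ℂ (Φ l) w.1) {z : ℂ}
    (hz : ∀ l, ‖Complex.exp (z * t l)‖ ≤ 1) {f : H}
    (hf : f ∈ (Submodule.span ℂ (Set.range Φ)).topologicalClosure) {v v' : H} {b : ℂ}
    (hv : ∀ l, Complex.exp (z * t l) * inner ℂ v (Φ l) = b * inner ℂ v' (Φ l)) :
    inner ℂ v (expOp G z f) = b * inner ℂ v' f := by
  set e : ℕ → H := fun l => ((‖Φ l‖⁻¹ : ℝ) : ℂ) • Φ l with he_def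
  have hn : ∀ l, ‖Φ l‖ ≠ 0 := fun l => norm_ne_zero_iff.2 (hΦ l)
  have he : Orthonormal ℂ e := by
    refine ⟨fun l => ?_, fun l m hlm => ?_⟩
    · rw [he_def, norm_smul, Complex.norm_real, norm_inv, norm_norm, inv_mul_cancel₀ (hn l)]
    · have h1 := hsymm (Φ m, (t m : ℂ) • Φ m) (hmem m) l
      simp only [inner_smul_right] at h1
      have h2 : ((t m : ℂ) - t l) * inner ℂ (Φ l) (Φ m) = 0 := by rw [sub_mul, h1, sub_self]
      have h3 : (t m : ℂ) - t l ≠ 0 := by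
        rw [sub_ne_zero]
        exact_mod_cast ht.ne hlm.symm
      simp only [he_def, inner_smul_left, inner_smul_right, (mul_eq_zero.1 h2).resolve_left h3,
        mul_zero]
  have hspan : Submodule.span ℂ (Set.range Φ) ≤ Submodule.span ℂ (Set.range e) := by
    rw [Submodule.span_le]
    rintro _ ⟨l, rfl⟩
    have : Φ l = ((‖Φ l‖ : ℝ) : ℂ) • e l := by
      rw [he_def, smul_smul, ← Complex.ofReal_mul, mul_inv_cancel₀ (hn l), Complex.ofReal_one,
        one_smul]
    rw [this]
    exact Submodule.smul_mem _ _ (Submodule.subset_span ⟨l, rfl⟩)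
  have hf' : f ∈ (Submodule.span ℂ (Set.range e)).topologicalClosure :=
    Submodule.topologicalClosure_mono hspan hf
  have hsum := hasSum_expOp he ht (fun l => Submodule.smul_mem _ _ (hmem l))
    (fun w hw l => by
      simp only [he_def, inner_smul_left, hsymm w hw l]
      ring) hz hf'
  have h1 := hsum.mapL (innerSL ℂ v)
  have h2 := ((hasSum_inner_smul_orthonormal he hf').mapL (innerSL ℂ v')).mul_left b
  have heq : (fun l => innerSL ℂ v (Complex.exp (z * t l) • inner ℂ (e l) f • e l)) =
      fun l => b * innerSL ℂ v' (inner ℂ (e l) f • e l) := by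
    funext l
    simp only [map_smul, innerSL_apply_apply, smul_eq_mul]
    have : Complex.exp (z * t l) * inner ℂ v (e l) = b * inner ℂ v' (e l) := by
      simp only [he_def, inner_smul_right]
      linear_combination ((‖Φ l‖⁻¹ : ℝ) : ℂ) * hv l
    linear_combination inner ℂ (e l) f * this
  rw [heq] at h1
  exact h1.unique h2

end Spectral

/-- The hypotheses under which the generalized Fourier transform is considered. -/
structure Admissible (R : Finset (E d)) (κ : E d → ℝ) (a : ℝ) : Prop where
  one_le : 1 ≤ d
  root : IsRootSystem R
  mult : IsMultiplicity R κ
  a_pos : 0 < a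
  lam_pos : 0 < 2 * lam R κ + a

/-- The radial variable `|x|^a / a`. -/
def tau (a : ℝ) (x : E d) : ℝ := ‖x‖ ^ a / a

/-! ### Integration against `mu` and Gamma integrals -/

section Measure

variable {R : Finset (E d)} {κ : E d → ℝ} {a : ℝ} {𝕜 : Type*} [RCLike 𝕜]

theorem Admissible.lamA_pos (h : Admissible R κ a) : 0 < lamA R κ a + 1 := by
  have : lamA R κ a + 1 = (2 * lam R κ + a) / a := by
    rw [lamA]
    field_simp [h.a_pos.ne']
  rw [this]
  exact div_pos h.lam_pos h.a_pos

theorem tau_nonneg (ha : 0 < a) (x : E d) : 0 ≤ tau a x := by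
  unfold tau
  positivity

theorem continuous_tau (ha : 0 < a) : Continuous (tau a : E d → ℝ) :=
  ((Real.continuous_rpow_const ha.le).comp continuous_norm).div_const a

theorem weight_eq (x : E d) : weight R κ a x = ‖x‖ ^ (a - 2) * dunklWeight R κ x := rfl

theorem weight_nonneg (x : E d) : 0 ≤ weight R κ a x :=
  mul_nonneg (by positivity) (dunklWeight_nonneg x)

theorem measurable_weight (h : Admissible R κ a) : Measurable (weight R κ a) :=
  (measurable_norm.pow_const (a - 2)).mul (continuous_dunklWeight h.mult).measurable

variable {Q : E d → 𝕜} {M : ℝ}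

theorem mul_dunklWeight_smul (hQ : ∀ r : ℝ, 0 < r → ∀ x, Q (r • x) = r ^ M • Q x) (r : ℝ)
    (hr : 0 < r) (x : E d) : dunklWeight R κ (r • x) • Q (r • x) =
      r ^ (M + 2 * index R κ) • (dunklWeight R κ x • Q x) := by
  rw [hQ r hr, dunklWeight_smul hr, Real.rpow_add hr, smul_smul, smul_smul]
  congr 1
  ring

/-- The exponents `d - 1` of polar coordinates, `2⟨κ⟩` and `a - 2` of the weight add up to `2λ_κ + a
- 1`, which exceeds `-1` precisely when `2λ_κ + a > 0`. -/
theorem rpow_exponent {r : ℝ} (hr : 0 < r) (c : 𝕜) :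
    r ^ ((d : ℝ) - 1 + (M + 2 * index R κ)) • (r ^ (a - 2) • c) =
      r ^ (M + 2 * lam R κ + a - 1) • c := by
  rw [smul_smul, ← Real.rpow_add hr, lam]
  congr 2
  ring

theorem integral_weight_smul (h : Admissible R κ a)
    (hQ : ∀ r : ℝ, 0 < r → ∀ x, Q (r • x) = r ^ M • Q x) (ρ : ℝ → 𝕜) :
    ∫ x, weight R κ a x • (Q x * ρ ‖x‖) =
      (∫ θ : Metric.sphere (0 : E d) 1, dunklWeight R κ θ • Q θ
        ∂(volume : Measure (E d)).toSphere) *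
      ∫ r in Set.Ioi (0 : ℝ), r ^ (M + 2 * lam R κ + a - 1) • ρ r := by
  have e : (fun x => weight R κ a x • (Q x * ρ ‖x‖)) =
      fun x => (dunklWeight R κ x • Q x) * (fun r => r ^ (a - 2) • ρ r) ‖x‖ := by
    ext x
    rw [weight_eq, smul_mul_smul_comm, mul_comm]
  rw [e, integral_homogeneous_mul_radial h.one_le (mul_dunklWeight_smul hQ)
    (fun r => r ^ (a - 2) • ρ r)]
  congr 1
  exact setIntegral_congr_fun measurableSet_Ioi fun r hr => rpow_exponent hr _

theorem integrable_weight_smul (h : Admissible R κ a)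
    (hQ : ∀ r : ℝ, 0 < r → ∀ x, Q (r • x) = r ^ M • Q x) (hQc : Continuous Q) {ρ : ℝ → 𝕜}
    (hρ : IntegrableOn (fun r => r ^ (M + 2 * lam R κ + a - 1) • ρ r) (Set.Ioi (0 : ℝ))) :
    Integrable fun x => weight R κ a x • (Q x * ρ ‖x‖) := by
  have e : (fun x => weight R κ a x • (Q x * ρ ‖x‖)) =
      fun x => (dunklWeight R κ x • Q x) * (fun r => r ^ (a - 2) • ρ r) ‖x‖ := by
    ext x
    rw [weight_eq, smul_mul_smul_comm, mul_comm]
  rw [e]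
  refine integrable_homogeneous_mul_radial h.one_le (mul_dunklWeight_smul hQ)
    (integrable_sphere_of_continuous ((continuous_dunklWeight h.mult).smul hQc))
    (hρ.congr_fun (fun r hr => (rpow_exponent hr _).symm) measurableSet_Ioi)

theorem integrableOn_radial (h : Admissible R κ a) {q c : ℝ} (hq : 0 ≤ q) (hc : 0 < c) :
    IntegrableOn (fun r : ℝ => r ^ (q + 2 * lam R κ + a - 1) * Real.exp (-(c * (r ^ a / a))))
      (Set.Ioi 0) := by
  have := integrableOn_rpow_mul_exp_neg_mul_rpow (p := a) (s := q + 2 * lam R κ + a - 1)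
    (b := c / a) (by linarith [h.lam_pos]) h.a_pos (div_pos hc h.a_pos)
  refine this.congr_fun (fun r _ => ?_) measurableSet_Ioi
  ring_nf

theorem integral_radial (h : Admissible R κ a) {q c : ℝ} (hq : 0 ≤ q) (hc : 0 < c) :
    ∫ r in Set.Ioi (0 : ℝ), r ^ (q + 2 * lam R κ + a - 1) * Real.exp (-(c * (r ^ a / a))) =
      (c / a) ^ (-(lamA R κ a + 1 + q / a)) * (1 / a) * Real.Gamma (lamA R κ a + 1 + q / a) := by
  have h0 := integral_rpow_mul_exp_neg_mul_rpow (p := a) (q := q + 2 * lam R κ + a - 1)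
    (b := c / a) h.a_pos (by linarith [h.lam_pos]) (div_pos hc h.a_pos)
  have e : (q + 2 * lam R κ + a - 1 + 1) / a = lamA R κ a + 1 + q / a := by
    rw [lamA]
    field_simp [h.a_pos.ne']
    ring
  rw [neg_div, e] at h0
  rw [← h0]
  refine setIntegral_congr_fun measurableSet_Ioi fun r _ => ?_
  congr 2
  ring

theorem one_homogeneous (r : ℝ) (_ : 0 < r) (_ : E d) : (1 : 𝕜) = r ^ (0 : ℝ) • 1 := by simp

theorem integrable_exp_mul_weight (h : Admissible R κ a) :
    Integrable fun x : E d => Real.exp (-(‖x‖ ^ a / a)) * weight R κ a x := by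
  have := integrable_weight_smul h (Q := fun _ => (1 : ℝ)) one_homogeneous continuous_const
    (ρ := fun r => Real.exp (-(1 * (r ^ a / a)))) (integrableOn_radial h le_rfl one_pos)
  refine this.congr (.of_forall fun x => ?_)
  simp [mul_comm]

theorem ae_ne_zero (h : Admissible R κ a) : ∀ᵐ x : E d, x ≠ 0 := by
  have hne : Nontrivial (E d) := by
    have : Nonempty (Fin d) := ⟨⟨0, h.one_le⟩⟩
    infer_instance
  rw [ae_iff]
  simp

theorem normConst_pos (h : Admissible R κ a) : 0 < normConst R κ a := by
  refine inv_pos.2 ((integral_pos_iff_support_of_nonneg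
    (fun x => mul_nonneg (Real.exp_pos _).le (weight_nonneg x)) (integrable_exp_mul_weight h)).2 ?_)
  have : (Function.support fun x : E d => Real.exp (-(‖x‖ ^ a / a)) * weight R κ a x) =ᵐ[volume]
      Set.univ := by
    refine Filter.eventuallyEq_univ.2 ?_
    filter_upwards [ae_inner_ne_zero h.root, ae_ne_zero h] with x hx hx0
    refine mul_ne_zero (Real.exp_pos _).ne' (mul_ne_zero ?_ ?_)
    · have := norm_pos_iff.2 hx0
      positivity
    · refine Finset.prod_ne_zero_iff.2 fun α hα => ?_
      have := abs_pos.2 (hx α hα)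
      positivity
  rw [measure_congr this]
  exact Measure.measure_univ_pos.2 (NeZero.ne _)

theorem mu_absolutelyContinuous : mu R κ a ≪ volume := withDensity_absolutelyContinuous _ _

theorem measurable_density (h : Admissible R κ a) :
    Measurable fun x => ENNReal.ofReal (normConst R κ a * weight R κ a x) :=
  ((measurable_weight h).const_mul _).ennreal_ofReal

theorem integral_mu (h : Admissible R κ a) (F : E d → 𝕜) :
    ∫ x, F x ∂mu R κ a = normConst R κ a • ∫ x, weight R κ a x • F x := by
  rw [mu, integral_withDensity_eq_integral_toReal_smul (measurable_density h) (by simp),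
    ← integral_smul]
  congr 1
  ext x
  rw [ENNReal.toReal_ofReal (mul_nonneg (normConst_pos h).le (weight_nonneg x)), mul_smul]

theorem integrable_mu (h : Admissible R κ a) {F : E d → 𝕜}
    (hF : Integrable fun x => weight R κ a x • F x) : Integrable F (mu R κ a) := by
  rw [mu, integrable_withDensity_iff_integrable_smul' (measurable_density h) (by simp)]
  refine (hF.smul (normConst R κ a)).congr (.of_forall fun x => ?_)
  simp only [Pi.smul_apply]
  rw [ENNReal.toReal_ofReal (mul_nonneg (normConst_pos h).le (weight_nonneg x)), mul_smul]

theorem tau_rpow_eq (ha : 0 < a) (s : ℝ) (x : E d) : tau a x ^ s = (a ^ s)⁻¹ * ‖x‖ ^ (a * s) := by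
  rw [tau, Real.div_rpow (by positivity) ha.le, ← Real.rpow_mul (norm_nonneg x)]
  ring

theorem tau_rpow_mul_exp_eq (ha : 0 < a) (s c : ℝ) (x : E d) :
    tau a x ^ s * Real.exp (-(c * tau a x)) = (a ^ s)⁻¹ *
      (fun r : ℝ => r ^ (a * s) * Real.exp (-(c * (r ^ a / a)))) ‖x‖ := by
  rw [tau_rpow_eq ha, tau, mul_assoc]

theorem integrable_homogeneous_mul_tau (h : Admissible R κ a)
    (hQ : ∀ r : ℝ, 0 < r → ∀ x, Q (r • x) = r ^ M • Q x) (hQc : Continuous Q) (hM : 0 ≤ M)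
    {s c : ℝ} (hs : 0 ≤ s) (hc : 0 < c) :
    Integrable (fun x => (tau a x ^ s * Real.exp (-(c * tau a x))) • Q x) (mu R κ a) := by
  have hq : 0 ≤ M + a * s := add_nonneg hM (mul_nonneg h.a_pos.le hs)
  have h1 := (integrableOn_radial h hq hc).ofReal (𝕜 := 𝕜)
  have h2 := integrable_mu h (integrable_weight_smul h hQ hQc
    (ρ := fun r => ((r ^ (a * s) * Real.exp (-(c * (r ^ a / a))) : ℝ) : 𝕜))
    (IntegrableOn.congr_fun h1 (fun r hr => ?_) measurableSet_Ioi))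
  · refine (h2.smul (a ^ s)⁻¹).congr (.of_forall fun x => ?_)
    simp only [Pi.smul_apply]
    rw [tau_rpow_mul_exp_eq h.a_pos, mul_smul, mul_comm, ← RCLike.real_smul_eq_coe_mul]
  · have hr' : (0 : ℝ) < r := hr
    rw [RCLike.real_smul_eq_coe_mul, ← RCLike.ofReal_mul, ← mul_assoc, ← Real.rpow_add hr']
    congr 3
    ring

theorem integral_homogeneous_mul_radial_mu (h : Admissible R κ a)
    (hQ : ∀ r : ℝ, 0 < r → ∀ x, Q (r • x) = r ^ M • Q x) (ρ : ℝ → 𝕜) :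
    ∫ x, Q x * ρ ‖x‖ ∂mu R κ a = normConst R κ a • ((∫ θ : Metric.sphere (0 : E d) 1,
        dunklWeight R κ θ • Q θ ∂(volume : Measure (E d)).toSphere) *
      ∫ r in Set.Ioi (0 : ℝ), r ^ (M + 2 * lam R κ + a - 1) • ρ r) := by
  rw [integral_mu h, integral_weight_smul h hQ]

/-- The integral of a homogeneous function of degree `M` against `exp(-c |x|^a / a)`. -/
theorem integral_homogeneous_mul_exp (h : Admissible R κ a)
    (hQ : ∀ r : ℝ, 0 < r → ∀ x, Q (r • x) = r ^ M • Q x) (hM : 0 ≤ M) :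
    ∃ A : 𝕜, ∀ c : ℝ, 0 < c → ∫ x, Real.exp (-(c * tau a x)) • Q x ∂mu R κ a =
      c ^ (-(lamA R κ a + 1 + M / a)) • A := by
  have e : ∀ (c : ℝ) (x : E d), Real.exp (-(c * tau a x)) • Q x =
      Q x * (fun r : ℝ => ((Real.exp (-(c * (r ^ a / a))) : ℝ) : 𝕜)) ‖x‖ := by
    intro c x
    rw [RCLike.real_smul_eq_coe_mul, mul_comm, tau]
  have e2 : ∀ c : ℝ, 0 < c → ∫ r in Set.Ioi (0 : ℝ), r ^ (M + 2 * lam R κ + a - 1) •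
      ((Real.exp (-(c * (r ^ a / a))) : ℝ) : 𝕜) = (((c / a) ^ (-(lamA R κ a + 1 + M / a)) * (1 / a) *
      Real.Gamma (lamA R κ a + 1 + M / a) : ℝ) : 𝕜) := by
    intro c hc
    rw [← integral_radial h hM hc, ← integral_ofReal]
    congr 1
    ext r
    rw [RCLike.real_smul_eq_coe_mul, ← RCLike.ofReal_mul]
  refine ⟨normConst R κ a • ((∫ θ : Metric.sphere (0 : E d) 1,
        dunklWeight R κ θ • Q θ ∂(volume : Measure (E d)).toSphere) *
      ((a⁻¹ ^ (-(lamA R κ a + 1 + M / a)) * (1 / a) *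
      Real.Gamma (lamA R κ a + 1 + M / a) : ℝ) : 𝕜)), fun c hc => ?_⟩
  simp_rw [e]
  rw [integral_homogeneous_mul_radial_mu h hQ
    (fun r : ℝ => ((Real.exp (-(c * (r ^ a / a))) : ℝ) : 𝕜)), e2 c hc, div_eq_mul_inv c,
    Real.mul_rpow hc.le (inv_nonneg.2 h.a_pos.le)]
  simp only [RCLike.real_smul_eq_coe_mul]
  push_cast
  ring

theorem integrable_tau (h : Admissible R κ a) {s c : ℝ} (hs : 0 ≤ s) (hc : 0 < c) :
    Integrable (fun x => tau a x ^ s * Real.exp (-(c * tau a x))) (mu R κ a) := by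
  simpa using integrable_homogeneous_mul_tau h (Q := fun _ => (1 : ℝ)) one_homogeneous
    continuous_const le_rfl hs hc

/-- The moments of `exp(-c |x|^a / a)`. -/
theorem exists_integral_tau (h : Admissible R κ a) : ∃ K : ℝ, 0 < K ∧ ∀ s c : ℝ, 0 ≤ s → 0 < c →
    ∫ x, tau a x ^ s * Real.exp (-(c * tau a x)) ∂mu R κ a =
      K * (Real.Gamma (lamA R κ a + 1 + s) * c ^ (-(lamA R κ a + 1 + s))) := by
  set W := ∫ θ : Metric.sphere (0 : E d) 1, dunklWeight R κ θ • (1 : ℝ)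
    ∂(volume : Measure (E d)).toSphere with hW
  have key : ∀ s c : ℝ, 0 ≤ s → 0 < c →
    ∫ x, tau a x ^ s * Real.exp (-(c * tau a x)) ∂mu R κ a =
      normConst R κ a * W * (a ^ (lamA R κ a + 1) * (1 / a)) *
        (Real.Gamma (lamA R κ a + 1 + s) * c ^ (-(lamA R κ a + 1 + s))) := by
    intro s c hs hc
    have ha := h.a_pos
    have e : ∀ x : E d, tau a x ^ s * Real.exp (-(c * tau a x)) =
        1 * (fun r : ℝ => (a ^ s)⁻¹ * (r ^ (a * s) * Real.exp (-(c * (r ^ a / a))))) ‖x‖ := by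
      intro x
      rw [tau_rpow_mul_exp_eq ha, one_mul]
    simp_rw [e]
    rw [integral_homogeneous_mul_radial_mu h (Q := fun _ => (1 : ℝ)) (M := 0) one_homogeneous
      (fun r : ℝ => (a ^ s)⁻¹ * (r ^ (a * s) * Real.exp (-(c * (r ^ a / a))))), ← hW]
    have e2 : ∫ r in Set.Ioi (0 : ℝ), r ^ (0 + 2 * lam R κ + a - 1) •
        ((a ^ s)⁻¹ * (r ^ (a * s) * Real.exp (-(c * (r ^ a / a))))) = (a ^ s)⁻¹ *
        ∫ r in Set.Ioi (0 : ℝ), r ^ (a * s + 2 * lam R κ + a - 1) *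
          Real.exp (-(c * (r ^ a / a))) := by
      rw [← integral_const_mul]
      refine setIntegral_congr_fun measurableSet_Ioi fun r (hr : 0 < r) => ?_
      have : r ^ (a * s + 2 * lam R κ + a - 1) = r ^ (0 + 2 * lam R κ + a - 1) * r ^ (a * s) := by
        rw [← Real.rpow_add hr]
        congr 1
        ring
      rw [this, smul_eq_mul]
      ring
    have e3 : a * s / a = s := by field_simp
    rw [e2, integral_radial h (by positivity) hc, e3, div_eq_mul_inv c,
      Real.mul_rpow hc.le (inv_nonneg.2 ha.le), Real.inv_rpow ha.le (-(lamA R κ a + 1 + s)),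
      Real.rpow_neg ha.le, inv_inv, Real.rpow_add ha]
    have : a ^ s ≠ 0 := (Real.rpow_pos_of_pos ha s).ne'
    simp only [smul_eq_mul]
    field_simp
  refine ⟨_, ?_, key⟩
  have hWnn : 0 ≤ W := integral_nonneg fun θ => by
    simpa using dunklWeight_nonneg (θ : E d)
  have ha := h.a_pos
  -- If the weighted mass `W` of the sphere were zero, the integral defining `normConst` would
  -- vanish as well.
  refine mul_pos (mul_pos (normConst_pos h) (lt_of_le_of_ne hWnn fun hW0 => ?_)) (by positivity)
  have h1 := inv_pos.1 (normConst_pos h)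
  have h2 := integral_weight_smul h (Q := fun _ => (1 : ℝ)) (M := 0) one_homogeneous
    (fun r => Real.exp (-(r ^ a / a)))
  rw [← hW, ← hW0, zero_mul] at h2
  refine h1.ne' ?_
  rw [← h2]
  congr 1
  ext x
  simp [mul_comm]

end Measure

/-! ### Laguerre functions, their Laplace transforms and moments -/

section Laguerre

/-- The coefficients of the Laguerre functions, normalized by the value `1` at `0`. -/
def laguerreCoeff (ν : ℝ) (l i : ℕ) : ℝ :=
  l.choose i * (-2) ^ i * Real.Gamma (ν + 1) / Real.Gamma (ν + 1 + i)

/-- The Laguerre function `∑ (l choose i) (-2)^i Γ(ν+1) / Γ(ν+1+i) t^i exp(-t)`, a multiple of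
`L_l^(ν)(2t) exp(-t)`. -/
def laguerreFun (ν : ℝ) (l : ℕ) (t : ℝ) : ℝ :=
  ∑ i ∈ Finset.range (l + 1), laguerreCoeff ν l i * (t ^ i * Real.exp (-t))

/-- The ratio of consecutive coefficients, from the functional equation of Gamma and the ratio of
binomial coefficients, in a form free of division that also holds for `i ≥ l`. -/
theorem laguerreCoeff_succ {ν : ℝ} (hν : 0 < ν + 1) (l i : ℕ) :
    laguerreCoeff ν l (i + 1) * ((i + 1) * (i + 1 + ν)) = -2 * (l - i) * laguerreCoeff ν l i := by
  have h1 : Real.Gamma (ν + 1 + (i + 1 : ℕ)) = (ν + 1 + i) * Real.Gamma (ν + 1 + i) := by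
    rw [← Real.Gamma_add_one (by positivity)]
    congr 1
    push_cast
    ring
  have h2 : Real.Gamma (ν + 1 + i) ≠ 0 := (Real.Gamma_pos_of_pos (by positivity)).ne'
  have h3 : ν + 1 + i ≠ 0 := by positivity
  have h4 : (l.choose (i + 1) : ℝ) * (i + 1) = l.choose i * (l - i) := by
    rcases le_or_gt i l with hil | hil
    · have := Nat.choose_succ_right_eq l i
      rw [← Nat.cast_sub hil]
      exact_mod_cast this
    · simp [Nat.choose_eq_zero_of_lt hil, Nat.choose_eq_zero_of_lt (hil.trans (Nat.lt_succ_self i))]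
  rw [laguerreCoeff, laguerreCoeff, h1]
  field_simp
  rw [pow_succ]
  linear_combination (-2) ^ i * (-2) * (i + 1 + ν) * h4

/-- The three-term recursion behind the eigenvalue equation of the Laguerre functions. -/
theorem sum_laguerreCoeff_recursion {ν : ℝ} (hν : 0 < ν + 1) (l : ℕ) (X : ℕ → ℝ) :
    ∑ i ∈ Finset.range (l + 1), laguerreCoeff ν l i *
      (i * (i + ν) * X (i - 1) - (2 * i + ν + 1) * X i) =
      -(2 * l + ν + 1) * ∑ i ∈ Finset.range (l + 1), laguerreCoeff ν l i * X i := by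
  have hzero : laguerreCoeff ν l (l + 1) = 0 := by simp [laguerreCoeff]
  -- Shifting the index by one loses nothing: the term `i = 0` has the factor `i`, and the
  -- coefficient with index `l + 1` vanishes.
  have h1 : ∑ i ∈ Finset.range (l + 1), laguerreCoeff ν l i * (i * (i + ν) * X (i - 1)) =
      ∑ i ∈ Finset.range (l + 1), -2 * (l - i) * laguerreCoeff ν l i * X i := by
    have h2 := Finset.sum_range_succ' (fun i : ℕ => laguerreCoeff ν l i *
      (i * (i + ν) * X (i - 1))) (l + 1)
    rw [Finset.sum_range_succ, hzero] at h2
    simp only [zero_mul, add_zero, Nat.cast_zero, mul_zero] at h2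
    rw [h2]
    refine Finset.sum_congr rfl fun i _ => ?_
    rw [← laguerreCoeff_succ hν, Nat.add_sub_cancel]
    push_cast
    ring
  simp_rw [mul_sub]
  rw [Finset.sum_sub_distrib, h1, ← Finset.sum_sub_distrib, Finset.mul_sum]
  refine Finset.sum_congr rfl fun i _ => ?_
  ring

variable {R : Finset (E d)} {κ : E d → ℝ} {a : ℝ}

theorem integrable_tau_pow (h : Admissible R κ a) (n : ℕ) {c : ℝ} (hc : 0 < c) :
    Integrable (fun x => tau a x ^ n * Real.exp (-(c * tau a x))) (mu R κ a) := by
  simpa using integrable_tau h (s := n) (Nat.cast_nonneg n) hc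

theorem integral_laguerre_mul (h : Admissible R κ a) (l j : ℕ) {c : ℝ} (hc : 0 < c) :
    ∫ x, laguerreFun (lamA R κ a) l (tau a x) * (tau a x ^ j * Real.exp (-(c * tau a x)))
      ∂mu R κ a = ∑ i ∈ Finset.range (l + 1), laguerreCoeff (lamA R κ a) l i *
        ∫ x, tau a x ^ (i + j) * Real.exp (-((1 + c) * tau a x)) ∂mu R κ a := by
  have e : ∀ x : E d, laguerreFun (lamA R κ a) l (tau a x) *
      (tau a x ^ j * Real.exp (-(c * tau a x))) = ∑ i ∈ Finset.range (l + 1),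
        laguerreCoeff (lamA R κ a) l i *
        (tau a x ^ (i + j) * Real.exp (-((1 + c) * tau a x))) := by
    intro x
    rw [laguerreFun, Finset.sum_mul]
    refine Finset.sum_congr rfl fun i _ => ?_
    have : Real.exp (-((1 + c) * tau a x)) =
        Real.exp (-tau a x) * Real.exp (-(c * tau a x)) := by
      rw [← Real.exp_add]
      congr 1
      ring
    rw [this]
    ring
  simp_rw [e]
  rw [integral_finsetSum _ fun i _ => (integrable_tau_pow h (i + j) (by positivity)).const_mul _]
  simp only [integral_const_mul]

/-- The Laplace transform of a Laguerre function. -/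
theorem integral_laguerre_mul_exp (h : Admissible R κ a) : ∃ K : ℝ, 0 < K ∧ ∀ (l : ℕ) (c : ℝ),
    0 < c → ∫ x, laguerreFun (lamA R κ a) l (tau a x) * Real.exp (-(c * tau a x)) ∂mu R κ a =
      K * (c + 1) ^ (-(lamA R κ a + 1)) * ((c - 1) / (c + 1)) ^ l := by
  obtain ⟨K, hK, hint⟩ := exists_integral_tau h
  have hν := h.lamA_pos
  refine ⟨K * Real.Gamma (lamA R κ a + 1), mul_pos hK (Real.Gamma_pos_of_pos hν),
    fun l c hc => ?_⟩
  have h0 := integral_laguerre_mul h l 0 hc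
  simp only [pow_zero, one_mul, add_zero] at h0
  -- The Gamma factors of the coefficients cancel those of the moments, leaving the binomial
  -- expansion of `(1 - 2/(c+1))^l`.
  have hbin : ((c - 1) / (c + 1)) ^ l = ∑ i ∈ Finset.range (l + 1),
      (-2 / (c + 1)) ^ i * l.choose i := by
    have : (c - 1) / (c + 1) = -2 / (c + 1) + 1 := by
      field_simp
      ring
    rw [this, add_pow]
    simp
  rw [h0, hbin, Finset.mul_sum]
  refine Finset.sum_congr rfl fun i _ => ?_
  have h1 := hint i (1 + c) (Nat.cast_nonneg i) (by positivity)
  simp only [Real.rpow_natCast] at h1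
  have h2 : Real.Gamma (lamA R κ a + 1 + i) ≠ 0 := (Real.Gamma_pos_of_pos (by positivity)).ne'
  have h3 : 0 < c + 1 := by positivity
  rw [h1, neg_add, Real.rpow_add (by positivity), Real.rpow_neg (by positivity) (i : ℝ),
    Real.rpow_natCast, laguerreCoeff, div_pow, add_comm 1 c]
  field_simp

/-- The symmetry of the radial part of the oscillator, tested on monomials. -/
theorem laguerre_moment_recursion (h : Admissible R κ a) (l j : ℕ) :
    j * (j + lamA R κ a) * ∫ x, laguerreFun (lamA R κ a) l (tau a x) *
        (tau a x ^ (j - 1) * Real.exp (-(1 * tau a x))) ∂mu R κ a -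
      (2 * j + lamA R κ a + 1) * ∫ x, laguerreFun (lamA R κ a) l (tau a x) *
        (tau a x ^ j * Real.exp (-(1 * tau a x))) ∂mu R κ a =
      -(2 * l + lamA R κ a + 1) * ∫ x, laguerreFun (lamA R κ a) l (tau a x) *
        (tau a x ^ j * Real.exp (-(1 * tau a x))) ∂mu R κ a := by
  obtain ⟨K, hK, hint⟩ := exists_integral_tau h
  have hν := h.lamA_pos
  set ν := lamA R κ a
  set S : ℕ → ℝ := fun n => ∫ x, tau a x ^ n * Real.exp (-((1 + 1) * tau a x)) ∂mu R κ a
  have hS : ∀ n : ℕ, 2 * S (n + 1) = (ν + 1 + n) * S n := by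
    intro n
    have h1 := hint n (1 + 1) (Nat.cast_nonneg n) (by positivity)
    have h2 := hint (n + 1 : ℕ) (1 + 1) (Nat.cast_nonneg _) (by positivity)
    simp only [Real.rpow_natCast] at h1 h2
    have h3 : Real.Gamma (ν + 1 + (n + 1 : ℕ)) = (ν + 1 + n) * Real.Gamma (ν + 1 + n) := by
      rw [← Real.Gamma_add_one (by positivity)]
      congr 1
      push_cast
      ring
    have h4 : ((1 : ℝ) + 1) ^ (-(ν + 1 + (n + 1 : ℕ))) =
        (1 + 1) ^ (-(ν + 1 + n)) * (1 + 1)⁻¹ := by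
      rw [← Real.rpow_neg_one, ← Real.rpow_add (by positivity)]
      congr 1
      push_cast
      ring
    simp only [S]
    rw [h1, h2, h3, h4]
    ring
  have hsum : ∀ j : ℕ, ∫ x, laguerreFun ν l (tau a x) * (tau a x ^ j * Real.exp (-(1 * tau a x)))
      ∂mu R κ a = ∑ i ∈ Finset.range (l + 1), laguerreCoeff ν l i * S (i + j) :=
    fun j => integral_laguerre_mul h l j one_pos
  simp only [hsum]
  rw [← sum_laguerreCoeff_recursion hν l (fun i => S (i + j)), Finset.mul_sum, Finset.mul_sum,
    ← Finset.sum_sub_distrib]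
  refine Finset.sum_congr rfl fun i _ => ?_
  -- With `n = i + j ≥ 1`, the difference of the sides is `j - i` times the relation `(n + ν) S
  -- (n-1) = 2 S n`. The cases only resolve the truncated subtractions.
  have key : j * (j + ν) * S (i + (j - 1)) - (2 * j + ν + 1) * S (i + j) =
      i * (i + ν) * S (i - 1 + j) - (2 * i + ν + 1) * S (i + j) := by
    rcases i with _ | i <;> rcases j with _ | j
    · simp
    · have := hS j
      simp only [Nat.add_sub_cancel, zero_add] at this ⊢
      push_cast
      linear_combination (-(j + 1 : ℝ)) * this
    · have := hS i
      simp only [Nat.add_sub_cancel, add_zero] at this ⊢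
      push_cast
      linear_combination ((i : ℝ) + 1) * this
    · have := hS (i + j + 1)
      simp only [Nat.add_sub_cancel] at this ⊢
      have e1 : i + 1 + j = i + j + 1 := by ring
      have e2 : i + (j + 1) = i + j + 1 := by ring
      have e3 : i + 1 + (j + 1) = i + j + 1 + 1 := by ring
      rw [e1, e2, e3]
      push_cast at this ⊢
      linear_combination ((i : ℝ) - j) * this
  linear_combination laguerreCoeff ν l i * key

end Laguerre

/-! ### Pairing the Laguerre functions with the core -/

section Core

variable {R : Finset (E d)} {κ : E d → ℝ} {a : ℝ}

theorem oscillator_add {f g : E d → ℂ} {x : E d} (hf : ContDiffAt ℝ 2 f x)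
    (hg : ContDiffAt ℝ 2 g x) :
    oscillator R κ a (f + g) x = oscillator R κ a f x + oscillator R κ a g x := by
  have h : dunklLaplacian R κ (f + g) x = dunklLaplacian R κ f x + dunklLaplacian R κ g x := by
    simp only [dunklLaplacian, hf.laplacian_add hg,
      fderiv_add (hf.differentiableAt (by norm_num)) (hg.differentiableAt (by norm_num)),
      add_apply, Pi.add_apply]
    rw [add_add_add_comm, ← mul_add, ← Finset.sum_add_distrib]
    congr 2
    refine Finset.sum_congr rfl fun α _ => ?_
    ring
  rw [oscillator, oscillator, oscillator, h, Pi.add_apply]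
  ring

theorem oscillator_smul {f : E d → ℂ} {x : E d} (c : ℂ) (hf : ContDiffAt ℝ 2 f x) :
    oscillator R κ a (c • f) x = c * oscillator R κ a f x := by
  have h : dunklLaplacian R κ (c • f) x = c * dunklLaplacian R κ f x := by
    simp only [dunklLaplacian, InnerProductSpace.laplacian_smul c hf,
      fderiv_const_smul (hf.differentiableAt (by norm_num)), smul_apply, Pi.smul_apply, smul_eq_mul]
    simp only [mul_add, Finset.mul_sum]
    refine congrArg₂ (· + ·) rfl (Finset.sum_congr rfl fun α _ => ?_)
    ring
  rw [oscillator, oscillator, h, Pi.smul_apply, smul_eq_mul]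
  ring

theorem oscillator_zero (x : E d) : oscillator R κ a 0 x = 0 := by
  have h : (0 : E d → ℂ) = (0 : ℂ) • fun _ => 0 := by
    ext
    simp
  rw [h, oscillator_smul 0 contDiffAt_const, zero_mul]

theorem contDiffAt_basicFun (p : MvPolynomial (Fin d) ℂ) (j : ℕ) {x : E d} (hx : x ≠ 0) :
    ContDiffAt ℝ 2 (basicFun a p j) x := by
  have h1 : ContDiffAt ℝ 2 (fun x : E d => ‖x‖ ^ a) x :=
    (contDiffAt_norm ℝ hx).rpow_const_of_ne (norm_ne_zero_iff.2 hx)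
  have h2 : ContDiffAt ℝ 2 (fun x : E d => (‖x‖ ^ a) ^ j * Real.exp (-(‖x‖ ^ a / a))) x :=
    (h1.pow j).mul (h1.div_const a).neg.exp
  exact (contDiff_polyFun p).contDiffAt.mul (Complex.ofRealCLM.contDiff.contDiffAt.comp x h2)

theorem basicFun_eq_tau (ha : 0 < a) (p : MvPolynomial (Fin d) ℂ) (j : ℕ) (x : E d) :
    basicFun a p j x = polyFun p x * ((a ^ j * (tau a x ^ j * Real.exp (-(1 * tau a x))) : ℝ) : ℂ) := by
  rw [basicFun, tau, one_mul, ← mul_assoc, ← mul_pow, mul_div_cancel₀ _ ha.ne']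

/-- The eigenvalues of the oscillator on radial functions. -/
def radialEigenvalue (R : Finset (E d)) (κ : E d → ℝ) (a : ℝ) (l : ℕ) : ℝ :=
  -(a * (2 * l + lamA R κ a + 1))

/-- In polar coordinates the spherical factor is the weighted mean of `p`, which vanishes. Thus the
nonradial generators of the core pair to zero with radial functions. -/
theorem integral_harmonic_mul_radial (h : Admissible R κ a) {m : ℕ} (hm : 1 ≤ m)
    {p : MvPolynomial (Fin d) ℂ} (hp : IsHarmonic R κ m p) (g : ℝ → ℂ) :
    ∫ x, polyFun p x * g (tau a x) ∂mu R κ a = 0 := by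
  have h1 := integral_homogeneous_mul_radial_mu h (Q := polyFun p) (M := m)
    (fun r _ x => by rw [polyFun_smul hp.1, Real.rpow_natCast, Complex.real_smul]; push_cast; rfl)
    (fun r => g (r ^ a / a))
  have h2 := integral_sphere_harmonic h.one_le h.root h.mult hp hm
  simp only [Complex.real_smul] at h1
  simp only [mul_comm (polyFun p _) (dunklWeight R κ _ : ℂ)] at h2
  rw [h2] at h1
  simpa [tau] using h1

theorem integrable_laguerre_mul_basicFun (h : Admissible R κ a) {m : ℕ}
    {p : MvPolynomial (Fin d) ℂ} (hp : p.IsHomogeneous m) (l j : ℕ) :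
    Integrable (fun x => (laguerreFun (lamA R κ a) l (tau a x) : ℂ) * basicFun a p j x)
      (mu R κ a) := by
  have hQ : ∀ r : ℝ, 0 < r → ∀ x : E d, polyFun p (r • x) = r ^ (m : ℝ) • polyFun p x :=
    fun r _ x => by rw [polyFun_smul hp, Real.rpow_natCast, Complex.real_smul]; push_cast; rfl
  have e : ∀ x : E d, (laguerreFun (lamA R κ a) l (tau a x) : ℂ) * basicFun a p j x =
      ∑ i ∈ Finset.range (l + 1), ((laguerreCoeff (lamA R κ a) l i * a ^ j : ℝ) : ℂ) *
      ((tau a x ^ ((i + j : ℕ) : ℝ) * Real.exp (-((1 + 1) * tau a x))) • polyFun p x) := by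
    intro x
    have he : Real.exp (-((1 + 1) * tau a x)) = Real.exp (-tau a x) * Real.exp (-(1 * tau a x)) := by
      rw [← Real.exp_add]
      congr 1
      ring
    rw [basicFun_eq_tau h.a_pos, laguerreFun, Complex.ofReal_sum, Finset.sum_mul]
    refine Finset.sum_congr rfl fun i _ => ?_
    rw [he, Complex.real_smul, Real.rpow_natCast]
    push_cast
    ring
  simp_rw [e]
  exact integrable_finsetSum _ fun i _ => (integrable_homogeneous_mul_tau h hQ
    (contDiff_polyFun p (n := 0)).continuous (Nat.cast_nonneg m) (Nat.cast_nonneg _)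
    (by norm_num)).const_mul _

theorem ae_mu_oscillator_basicFun (h : Admissible R κ a) {m : ℕ} {p : MvPolynomial (Fin d) ℂ}
    (hp : IsHarmonic R κ m p) (j : ℕ) : ∀ᵐ x ∂mu R κ a, oscillator R κ a (basicFun a p j) x =
      (a * j * (a * j + 2 * m + 2 * lam R κ) : ℝ) * basicFun a p (j - 1) x -
      (2 * a * j + a + 2 * m + 2 * lam R κ : ℝ) * basicFun a p j x := by
  refine mu_absolutelyContinuous.ae_le ?_
  filter_upwards [ae_inner_ne_zero h.root, ae_ne_zero h] with x hx hx0
  exact oscillator_basicFun h.a_pos hp j hx0 hx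

theorem integral_laguerre_mul_basicFun_const (ha : 0 < a) (c : ℂ) (l j : ℕ) :
    ∫ x, (laguerreFun (lamA R κ a) l (tau a x) : ℂ) * basicFun a (MvPolynomial.C c) j x ∂mu R κ a =
      c * a ^ j * ((∫ x, laguerreFun (lamA R κ a) l (tau a x) *
        (tau a x ^ j * Real.exp (-(1 * tau a x))) ∂mu R κ a : ℝ) : ℂ) := by
  rw [← integral_complex_ofReal, ← integral_const_mul]
  congr 1
  ext x
  rw [basicFun_eq_tau ha, polyFun, MvPolynomial.eval_C]
  push_cast
  ring

theorem two_lam_eq (ha : 0 < a) : 2 * lam R κ = a * lamA R κ a := by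
  rw [lamA]
  field_simp

/-- The Laguerre functions are formal eigenfunctions against the generators of the core. -/
theorem integral_laguerre_mul_oscillator_basicFun (h : Admissible R κ a) {m : ℕ}
    {p : MvPolynomial (Fin d) ℂ} (hp : IsHarmonic R κ m p) (l j : ℕ) :
    Integrable (fun x => (laguerreFun (lamA R κ a) l (tau a x) : ℂ) *
      oscillator R κ a (basicFun a p j) x) (mu R κ a) ∧
    ∫ x, (laguerreFun (lamA R κ a) l (tau a x) : ℂ) * oscillator R κ a (basicFun a p j) x
      ∂mu R κ a = radialEigenvalue R κ a l *
      ∫ x, (laguerreFun (lamA R κ a) l (tau a x) : ℂ) * basicFun a p j x ∂mu R κ a := by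
  set φ : E d → ℂ := fun x => (laguerreFun (lamA R κ a) l (tau a x) : ℂ)
  set A : ℝ := a * j * (a * j + 2 * m + 2 * lam R κ) with hA
  set B : ℝ := 2 * a * j + a + 2 * m + 2 * lam R κ with hB
  have i1 := (integrable_laguerre_mul_basicFun h hp.1 l (j - 1)).const_mul (A : ℂ)
  have i2 := (integrable_laguerre_mul_basicFun h hp.1 l j).const_mul (B : ℂ)
  have e : (fun x => φ x * oscillator R κ a (basicFun a p j) x) =ᵐ[mu R κ a] fun x =>
      (A : ℂ) * (φ x * basicFun a p (j - 1) x) - (B : ℂ) * (φ x * basicFun a p j x) := by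
    filter_upwards [ae_mu_oscillator_basicFun h hp j] with x hx
    rw [hx]
    ring
  refine ⟨(i1.sub i2).congr e.symm, ?_⟩
  rw [integral_congr_ae e, integral_sub i1 i2, integral_const_mul, integral_const_mul]
  -- In degree `0` the polynomial is constant and the moment recursion applies; in positive degree
  -- all the integrals vanish.
  rcases Nat.eq_zero_or_pos m with rfl | hm
  · have hpC : p = MvPolynomial.C (MvPolynomial.coeff 0 p) :=
      MvPolynomial.totalDegree_eq_zero_iff_eq_C.1 (Nat.le_zero.1 hp.1.totalDegree_le)
    rw [hpC, integral_laguerre_mul_basicFun_const h.a_pos,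
      integral_laguerre_mul_basicFun_const h.a_pos, hA, hB, radialEigenvalue, two_lam_eq h.a_pos]
    have key := laguerre_moment_recursion h l j
    set N1 := ∫ x, laguerreFun (lamA R κ a) l (tau a x) *
        (tau a x ^ (j - 1) * Real.exp (-(1 * tau a x))) ∂mu R κ a
    set N2 := ∫ x, laguerreFun (lamA R κ a) l (tau a x) *
        (tau a x ^ j * Real.exp (-(1 * tau a x))) ∂mu R κ a
    have key' := congrArg (fun t : ℝ => (t : ℂ)) key
    push_cast at key' ⊢
    set c := MvPolynomial.coeff 0 p
    rcases j with _ | j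
    · simp only [Nat.cast_zero, mul_zero, zero_mul, zero_sub, zero_add, pow_zero] at key' ⊢
      linear_combination a * c * key'
    · simp only [Nat.add_sub_cancel, pow_succ] at key' ⊢
      push_cast at key' ⊢
      linear_combination a * (a ^ j * a) * c * key'
  · have hz : ∀ j, ∫ x, φ x * basicFun a p j x ∂mu R κ a = 0 := by
      intro j
      rw [← integral_harmonic_mul_radial h hm hp (fun t => (laguerreFun (lamA R κ a) l t : ℂ) *
        ((a ^ j * (t ^ j * Real.exp (-(1 * t))) : ℝ) : ℂ))]
      congr 1
      ext x
      rw [basicFun_eq_tau h.a_pos]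
      ring
    rw [hz, hz]
    ring

theorem core_induction {P : (E d → ℂ) → Prop}
    (hgen : ∀ (m j : ℕ) (p : MvPolynomial (Fin d) ℂ), IsHarmonic R κ m p → P (basicFun a p j))
    (hzero : P 0) (hadd : ∀ f g, P f → P g → P (f + g)) (hsmul : ∀ (c : ℂ) f, P f → P (c • f))
    {f : E d → ℂ} (hf : f ∈ core R κ a) : P f := by
  induction hf using Submodule.span_induction with
  | mem f hf =>
    obtain ⟨m, j, p, hp, rfl⟩ := hf
    simp_rw [norm_rpow_mul_natCast]
    exact hgen m j p hp
  | zero => exact hzero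
  | add f g _ _ hf hg => exact hadd f g hf hg
  | smul c f _ hf => exact hsmul c f hf

/-- Extension from the generators by linearity. Twice differentiability off the origin is carried
through the induction for additivity of the differential expression, and integrability for
additivity of the integrals. -/
theorem integral_laguerre_mul_oscillator (h : Admissible R κ a) {f : E d → ℂ}
    (hf : f ∈ core R κ a) (l : ℕ) :
    ∫ x, (laguerreFun (lamA R κ a) l (tau a x) : ℂ) * oscillator R κ a f x ∂mu R κ a =
      radialEigenvalue R κ a l *
        ∫ x, (laguerreFun (lamA R κ a) l (tau a x) : ℂ) * f x ∂mu R κ a := by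
  set φ : E d → ℂ := fun x => (laguerreFun (lamA R κ a) l (tau a x) : ℂ)
  have hae : ∀ᵐ x ∂mu R κ a, x ≠ 0 := mu_absolutelyContinuous.ae_le (ae_ne_zero h)
  suffices H : (∀ x ≠ 0, ContDiffAt ℝ 2 f x) ∧ Integrable (fun x => φ x * f x) (mu R κ a) ∧
      Integrable (fun x => φ x * oscillator R κ a f x) (mu R κ a) ∧
      ∫ x, φ x * oscillator R κ a f x ∂mu R κ a =
        radialEigenvalue R κ a l * ∫ x, φ x * f x ∂mu R κ a from H.2.2.2
  refine core_induction (P := fun f => (∀ x ≠ 0, ContDiffAt ℝ 2 f x) ∧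
    Integrable (fun x => φ x * f x) (mu R κ a) ∧
      Integrable (fun x => φ x * oscillator R κ a f x) (mu R κ a) ∧
      ∫ x, φ x * oscillator R κ a f x ∂mu R κ a =
        radialEigenvalue R κ a l * ∫ x, φ x * f x ∂mu R κ a) ?_ ?_ ?_ ?_ hf
  · intro m j p hp
    exact ⟨fun x hx => contDiffAt_basicFun p j hx, integrable_laguerre_mul_basicFun h hp.1 l j,
      integral_laguerre_mul_oscillator_basicFun h hp l j⟩
  · exact ⟨fun x _ => contDiffAt_const, by simp, by simp [oscillator_zero],
      by simp [oscillator_zero]⟩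
  · rintro f g ⟨f1, f2, f3, f4⟩ ⟨g1, g2, g3, g4⟩
    have e1 : (fun x => φ x * (f + g) x) = fun x => φ x * f x + φ x * g x := by
      ext x; simp [mul_add]
    have e2 : (fun x => φ x * oscillator R κ a (f + g) x) =ᵐ[mu R κ a]
        fun x => φ x * oscillator R κ a f x + φ x * oscillator R κ a g x := by
      filter_upwards [hae] with x hx
      rw [oscillator_add (f1 x hx) (g1 x hx), mul_add]
    refine ⟨fun x hx => (f1 x hx).add (g1 x hx), e1 ▸ f2.add g2, (f3.add g3).congr e2.symm, ?_⟩
    rw [integral_congr_ae e2, integral_add f3 g3, e1, integral_add f2 g2, f4, g4, mul_add]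
  · rintro c f ⟨f1, f2, f3, f4⟩
    have e1 : (fun x => φ x * (c • f) x) = fun x => c * (φ x * f x) := by
      ext x; simp; ring
    have e2 : (fun x => φ x * oscillator R κ a (c • f) x) =ᵐ[mu R κ a]
        fun x => c * (φ x * oscillator R κ a f x) := by
      filter_upwards [hae] with x hx
      rw [oscillator_smul c (f1 x hx)]
      ring
    refine ⟨fun x hx => (f1 x hx).const_smul c, e1 ▸ f2.const_mul c,
      (f3.const_mul c).congr e2.symm, ?_⟩
    rw [integral_congr_ae e2, integral_const_mul, e1, integral_const_mul, f4]
    ring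

theorem isHarmonic_one : IsHarmonic R κ 0 (1 : MvPolynomial (Fin d) ℂ) := by
  refine ⟨MvPolynomial.isHomogeneous_one _ _, fun x _ => ?_⟩
  have : polyFun (1 : MvPolynomial (Fin d) ℂ) = fun _ => 1 := by ext; simp [polyFun]
  simp [this, dunklLaplacian]

theorem basicFun_mem_core {m : ℕ} {p : MvPolynomial (Fin d) ℂ} (hp : IsHarmonic R κ m p) (j : ℕ) :
    basicFun a p j ∈ core R κ a := by
  refine Submodule.subset_span ⟨m, j, p, hp, ?_⟩
  simp_rw [norm_rpow_mul_natCast]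
  rfl

theorem laguerre_eq_sum_basicFun (ha : 0 < a) (ν : ℝ) (l : ℕ) :
    (fun x : E d => (laguerreFun ν l (tau a x) : ℂ)) = ∑ i ∈ Finset.range (l + 1),
      ((laguerreCoeff ν l i / a ^ i : ℝ) : ℂ) • basicFun a 1 i := by
  ext x
  rw [laguerreFun, Finset.sum_apply, Complex.ofReal_sum]
  refine Finset.sum_congr rfl fun i _ => ?_
  have h1 : polyFun 1 x = 1 := by simp [polyFun]
  rw [Pi.smul_apply, basicFun_eq_tau ha, h1, one_mul, one_mul, smul_eq_mul, ← Complex.ofReal_mul]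
  congr 1
  have : a ^ i ≠ 0 := by positivity
  field_simp

theorem laguerre_mem_core (ha : 0 < a) (ν : ℝ) (l : ℕ) :
    (fun x : E d => (laguerreFun ν l (tau a x) : ℂ)) ∈ core R κ a := by
  rw [laguerre_eq_sum_basicFun ha]
  exact Submodule.sum_mem _ fun i _ => Submodule.smul_mem _ _ (basicFun_mem_core isHarmonic_one i)

theorem oscillator_sum {ι : Type*} (s : Finset ι) (c : ι → ℂ) (f : ι → E d → ℂ) {x : E d}
    (hf : ∀ i ∈ s, ContDiffAt ℝ 2 (f i) x) :
    ContDiffAt ℝ 2 (∑ i ∈ s, c i • f i) x ∧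
    oscillator R κ a (∑ i ∈ s, c i • f i) x = ∑ i ∈ s, c i * oscillator R κ a (f i) x := by
  classical
  induction s using Finset.induction_on with
  | empty => exact ⟨by rw [Finset.sum_empty]; exact contDiffAt_const, by simpa using oscillator_zero x⟩
  | insert i s hi ih =>
    obtain ⟨h1, h2⟩ := ih fun j hj => hf j (Finset.mem_insert_of_mem hj)
    have h3 := hf i (Finset.mem_insert_self i s)
    have h4 : ContDiffAt ℝ 2 (c i • f i) x := h3.const_smul (c i)
    rw [Finset.sum_insert hi, Finset.sum_insert hi]
    exact ⟨h4.add h1, by rw [oscillator_add h4 h1, h2, oscillator_smul _ h3]⟩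

/-- This is `sum_laguerreCoeff_recursion` with `X i = τ^i e^{-τ}`, on which the oscillator acts by
lowering or keeping `i`. -/
theorem ae_oscillator_laguerre (h : Admissible R κ a) (l : ℕ) : ∀ᵐ x ∂mu R κ a,
    oscillator R κ a (fun x => (laguerreFun (lamA R κ a) l (tau a x) : ℂ)) x =
      radialEigenvalue R κ a l * (laguerreFun (lamA R κ a) l (tau a x) : ℂ) := by
  have hosc : ∀ᵐ x ∂mu R κ a, ∀ i : ℕ, oscillator R κ a (basicFun a 1 i) x =
      (a * i * (a * i + 2 * (0 : ℕ) + 2 * lam R κ) : ℝ) * basicFun a 1 (i - 1) x -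
      (2 * a * i + a + 2 * (0 : ℕ) + 2 * lam R κ : ℝ) * basicFun a 1 i x :=
    ae_all_iff.2 fun i => ae_mu_oscillator_basicFun h isHarmonic_one i
  filter_upwards [hosc, mu_absolutelyContinuous.ae_le (ae_ne_zero h)] with x hx hx0
  have ha := h.a_pos
  rw [laguerre_eq_sum_basicFun ha, (oscillator_sum _ _ _
    fun i _ => contDiffAt_basicFun 1 i hx0).2]
  have key := sum_laguerreCoeff_recursion h.lamA_pos l
    (fun i => tau a x ^ i * Real.exp (-(tau a x)))
  have h1 : polyFun 1 x = 1 := by simp [polyFun]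
  have h2 : ∀ i ∈ Finset.range (l + 1), ((laguerreCoeff (lamA R κ a) l i / a ^ i : ℝ) : ℂ) *
      oscillator R κ a (basicFun a 1 i) x = ((a * (laguerreCoeff (lamA R κ a) l i *
        (i * (i + lamA R κ a) * (tau a x ^ (i - 1) * Real.exp (-tau a x)) -
          (2 * i + lamA R κ a + 1) * (tau a x ^ i * Real.exp (-tau a x)))) : ℝ) : ℂ) := by
    intro i _
    simp only [hx, basicFun_eq_tau ha, h1, one_mul, ← Complex.ofReal_mul, ← Complex.ofReal_sub,
      two_lam_eq ha]
    congr 1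
    rcases i with _ | i
    · simp
      ring
    · simp only [Nat.add_sub_cancel, pow_succ]
      push_cast
      have : a ^ i ≠ 0 := by positivity
      field_simp
      ring
  rw [Finset.sum_congr rfl h2, ← Complex.ofReal_sum, ← Finset.mul_sum, key, radialEigenvalue,
    laguerreFun, ← Complex.ofReal_mul]
  congr 1
  ring

end Core

/-! ### Laguerre functions and exponentials in the Hilbert space -/

section SquareIntegrable

variable {R : Finset (E d)} {κ : E d → ℝ} {a : ℝ}

theorem memLp_tau_pow (h : Admissible R κ a) (n : ℕ) {c : ℝ} (hc : 0 < c) :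
    MemLp (fun x => ((tau a x ^ n * Real.exp (-(c * tau a x)) : ℝ) : ℂ)) 2 (mu R κ a) := by
  have hcont : Continuous fun x : E d => ((tau a x ^ n * Real.exp (-(c * tau a x)) : ℝ) : ℂ) := by
    have := continuous_tau (d := d) h.a_pos
    exact Complex.continuous_ofReal.comp (by fun_prop)
  rw [memLp_two_iff_integrable_sq_norm hcont.aestronglyMeasurable]
  refine (integrable_tau_pow h (2 * n) (c := 2 * c) (by positivity)).congr (.of_forall fun x => ?_)
  beta_reduce
  rw [Complex.norm_real, Real.norm_eq_abs, sq_abs, mul_pow, ← Real.exp_nat_mul, ← pow_mul,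
    mul_comm n 2]
  congr 2
  push_cast
  ring

theorem memLp_laguerre (h : Admissible R κ a) (l : ℕ) :
    MemLp (fun x => (laguerreFun (lamA R κ a) l (tau a x) : ℂ)) 2 (mu R κ a) := by
  simp only [laguerreFun, Complex.ofReal_sum, Complex.ofReal_mul (laguerreCoeff _ _ _)]
  refine memLp_finsetSum _ fun i _ => MemLp.const_mul ?_ _
  simpa using memLp_tau_pow h i one_pos

/-- The Laguerre functions of `|x|^a / a` as elements of the Hilbert space. -/
def laguerreL2 (h : Admissible R κ a) (l : ℕ) : L2 R κ a := (memLp_laguerre h l).toLp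

/-- The function `exp(-c |x|^a / a)` as an element of the Hilbert space. -/
def expL2 (h : Admissible R κ a) {c : ℝ} (hc : 0 < c) : L2 R κ a := (memLp_tau_pow h 0 hc).toLp

theorem inner_of_real_left {g : E d → ℝ} {v w : L2 R κ a} (hv : v =ᵐ[mu R κ a] fun x => (g x : ℂ)) :
    inner ℂ v w = ∫ x, (g x : ℂ) * w x ∂mu R κ a := by
  rw [L2.inner_def]
  refine integral_congr_ae ?_
  filter_upwards [hv] with x hx
  rw [hx, RCLike.inner_apply, Complex.conj_ofReal, mul_comm]

theorem inner_laguerreL2 (h : Admissible R κ a) (l : ℕ) (w : L2 R κ a) :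
    inner ℂ (laguerreL2 h l) w =
      ∫ x, (laguerreFun (lamA R κ a) l (tau a x) : ℂ) * w x ∂mu R κ a :=
  inner_of_real_left (memLp_laguerre h l).coeFn_toLp

theorem inner_expL2 (h : Admissible R κ a) {c : ℝ} (hc : 0 < c) (w : L2 R κ a) :
    inner ℂ (expL2 h hc) w = ∫ x, (Real.exp (-(c * tau a x)) : ℂ) * w x ∂mu R κ a := by
  refine inner_of_real_left (g := fun x => Real.exp (-(c * tau a x))) ?_
  filter_upwards [(memLp_tau_pow h 0 hc).coeFn_toLp] with x hx
  rw [expL2, hx, pow_zero, one_mul]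

theorem inner_expL2_laguerreL2 (h : Admissible R κ a) : ∃ K : ℝ, 0 < K ∧ ∀ (l : ℕ) (c : ℝ)
    (hc : 0 < c), inner ℂ (expL2 h hc) (laguerreL2 h l) =
      ((K * (c + 1) ^ (-(lamA R κ a + 1)) * ((c - 1) / (c + 1)) ^ l : ℝ) : ℂ) := by
  obtain ⟨K, hK, hint⟩ := integral_laguerre_mul_exp h
  refine ⟨K, hK, fun l c hc => ?_⟩
  rw [inner_expL2, ← hint l c hc, ← integral_complex_ofReal]
  refine integral_congr_ae ?_
  filter_upwards [(memLp_laguerre h l).coeFn_toLp] with x hx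
  rw [laguerreL2, hx]
  push_cast
  ring

theorem laguerreL2_ne_zero (h : Admissible R κ a) (l : ℕ) : laguerreL2 h l ≠ 0 := by
  intro h0
  obtain ⟨K, hK, hint⟩ := inner_expL2_laguerreL2 h
  -- Any `c > 0` other than `1` would do; at `c = 1` the Laplace transform vanishes for `l ≥ 1`.
  have := hint l 2 two_pos
  rw [h0, inner_zero_right] at this
  have h1 : (K * (2 + 1) ^ (-(lamA R κ a + 1)) * ((2 - 1) / (2 + 1)) ^ l : ℝ) ≠ 0 := by
    have : (0 : ℝ) < (2 - 1) / (2 + 1) := by norm_num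
    positivity
  exact h1 (by exact_mod_cast this.symm)

theorem laguerreL2_mem_eigenspace (h : Admissible R κ a) (l : ℕ) :
    laguerreL2 h l ∈ eigenspace (oscillatorGraph R κ a) (radialEigenvalue R κ a l) := by
  change (laguerreL2 h l, (radialEigenvalue R κ a l : ℂ) • laguerreL2 h l) ∈ oscillatorGraph R κ a
  refine Submodule.le_topologicalClosure _ (Submodule.subset_span
    ⟨_, laguerre_mem_core h.a_pos (lamA R κ a) l, (memLp_laguerre h l).coeFn_toLp, ?_⟩)
  filter_upwards [ae_oscillator_laguerre h l, (memLp_laguerre h l).coeFn_toLp,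
    Lp.coeFn_smul (radialEigenvalue R κ a l : ℂ) (laguerreL2 h l)] with x h1 h2 h3
  rw [h1, h3, Pi.smul_apply, laguerreL2, h2, smul_eq_mul]

/-- The relation is a closed linear condition on `w`, so it passes from the core to the closure of
the graph. It is the only form of symmetry of the oscillator that is needed. -/
theorem inner_laguerreL2_graph (h : Admissible R κ a) {w : L2 R κ a × L2 R κ a}
    (hw : w ∈ oscillatorGraph R κ a) (l : ℕ) :
    inner ℂ (laguerreL2 h l) w.2 =
      radialEigenvalue R κ a l * inner ℂ (laguerreL2 h l) w.1 := by
  set T : L2 R κ a × L2 R κ a →L[ℂ] ℂ :=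
    (innerSL ℂ (laguerreL2 h l)).comp (ContinuousLinearMap.snd ℂ _ _) -
      (radialEigenvalue R κ a l : ℂ) •
        (innerSL ℂ (laguerreL2 h l)).comp (ContinuousLinearMap.fst ℂ _ _) with hT
  have hcl : IsClosed (LinearMap.ker T.toLinearMap : Set (L2 R κ a × L2 R κ a)) :=
    T.isClosed_ker
  have hle : oscillatorGraph R κ a ≤ LinearMap.ker T.toLinearMap := by
    refine Submodule.topologicalClosure_minimal _ (Submodule.span_le.2 ?_) hcl
    rintro ⟨u, v⟩ ⟨f, hf, hu, hv⟩
    have h1 := integral_laguerre_mul_oscillator h hf l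
    simp only at hu hv
    have h2 : inner ℂ (laguerreL2 h l) u =
        ∫ x, (laguerreFun (lamA R κ a) l (tau a x) : ℂ) * f x ∂mu R κ a := by
      rw [inner_laguerreL2]
      refine integral_congr_ae ?_
      filter_upwards [hu] with x hx
      rw [hx]
    have h3 : inner ℂ (laguerreL2 h l) v = ∫ x, (laguerreFun (lamA R κ a) l (tau a x) : ℂ) *
        oscillator R κ a f x ∂mu R κ a := by
      rw [inner_laguerreL2]
      refine integral_congr_ae ?_
      filter_upwards [hv] with x hx
      rw [hx]
    change T (u, v) = 0
    simp [hT, h2, h3, h1]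
  have := hle hw
  change T w = 0 at this
  simpa [hT, sub_eq_zero] using this

theorem integrable_mul_coe (u : L2 R κ a) {F : E d → ℂ} (hF : MemLp F 2 (mu R κ a)) :
    Integrable (fun x => F x * u x) (mu R κ a) :=
  hF.integrable_mul (Lp.memLp u)

/-- If `u` annihilates all `t^n exp(-c t)`, it annihilates all `t^n exp(-(c + 1/2) t)`. -/
theorem integral_tau_pow_step (h : Admissible R κ a) (u : L2 R κ a) {c : ℝ} (hc : 1 ≤ c)
    (h0 : ∀ n : ℕ, ∫ x, ((tau a x ^ n * Real.exp (-(c * tau a x)) : ℝ) : ℂ) * u x ∂mu R κ a = 0)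
    (n : ℕ) :
    ∫ x, ((tau a x ^ n * Real.exp (-((c + 1 / 2) * tau a x)) : ℝ) : ℂ) * u x ∂mu R κ a = 0 := by
  have hexp : ∀ t : ℝ, HasSum (fun k : ℕ => t ^ k / k.factorial) (Real.exp t) := by
    intro t
    rw [Real.exp_eq_exp_ℝ]
    exact NormedSpace.expSeries_div_hasSum_exp t
  have hmeas : AEStronglyMeasurable u (mu R κ a) := Lp.aestronglyMeasurable u
  have htau : Continuous (tau a : E d → ℝ) := continuous_tau h.a_pos
  -- The factor `e^{-τ/2}` is expanded in its power series. The absolute values sum to `e^{τ/2}`,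
  -- which leaves the decay `e^{-(c - 1/2)τ}`; a step of length `1` from `c = 1` would leave none.
  have hS := hasSum_integral_of_dominated_convergence (μ := mu R κ a)
    (F := fun (k : ℕ) x => ((tau a x ^ n * Real.exp (-(c * tau a x)) *
      ((-(1 / 2 * tau a x)) ^ k / k.factorial) : ℝ) : ℂ) * u x)
    (f := fun x => ((tau a x ^ n * Real.exp (-(c * tau a x)) *
      Real.exp (-(1 / 2 * tau a x)) : ℝ) : ℂ) * u x)
    (fun k x => tau a x ^ n * Real.exp (-(c * tau a x)) *
      ((1 / 2 * tau a x) ^ k / k.factorial) * ‖u x‖) ?_ ?_ ?_ ?_ ?_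
  · have hz : ∀ k : ℕ, ∫ x, ((tau a x ^ n * Real.exp (-(c * tau a x)) *
        ((-(1 / 2 * tau a x)) ^ k / k.factorial) : ℝ) : ℂ) * u x ∂mu R κ a = 0 := by
      intro k
      have e : ∀ x, ((tau a x ^ n * Real.exp (-(c * tau a x)) *
        ((-(1 / 2 * tau a x)) ^ k / k.factorial) : ℝ) : ℂ) * u x =
        (((-(1 / 2)) ^ k / k.factorial : ℝ) : ℂ) *
          (((tau a x ^ (n + k) * Real.exp (-(c * tau a x)) : ℝ) : ℂ) * u x) := by
        intro x
        rw [← mul_assoc, ← Complex.ofReal_mul]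
        congr 2
        rw [← neg_mul (1 / 2), mul_pow, pow_add]
        ring
      simp_rw [e]
      rw [integral_const_mul, h0, mul_zero]
    simp only [hz] at hS
    rw [← hS.unique hasSum_zero]
    congr 1
    ext x
    congr 2
    rw [mul_assoc, ← Real.exp_add]
    congr 2
    ring
  · intro k
    refine AEStronglyMeasurable.mul (Continuous.aestronglyMeasurable ?_) hmeas
    exact Complex.continuous_ofReal.comp (by fun_prop)
  · intro k
    refine .of_forall fun x => ?_
    have := tau_nonneg h.a_pos x
    rw [norm_mul, Complex.norm_real, Real.norm_eq_abs, abs_mul, abs_of_nonneg (by positivity :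
      0 ≤ tau a x ^ n * Real.exp (-(c * tau a x))), abs_div, abs_pow, abs_neg,
      abs_of_nonneg (by positivity : 0 ≤ 1 / 2 * tau a x), abs_of_nonneg (by positivity :
      (0 : ℝ) ≤ k.factorial)]
  · refine .of_forall fun x => ?_
    exact ((hexp (1 / 2 * tau a x)).summable.mul_left _).mul_right _
  · have e : ∀ x, ∑' k : ℕ, tau a x ^ n * Real.exp (-(c * tau a x)) *
        ((1 / 2 * tau a x) ^ k / k.factorial) * ‖u x‖ =
        ‖((tau a x ^ n * Real.exp (-((c - 1 / 2) * tau a x)) : ℝ) : ℂ) * u x‖ := by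
      intro x
      have := tau_nonneg h.a_pos x
      rw [(((hexp (1 / 2 * tau a x)).mul_left _).mul_right _).tsum_eq, norm_mul,
        Complex.norm_real, Real.norm_of_nonneg (by positivity), mul_assoc (_ ^ _), ← Real.exp_add]
      congr 3
      ring
    simp_rw [e]
    exact (integrable_mul_coe u (memLp_tau_pow h n (by linarith))).norm
  · refine .of_forall fun x => ?_
    have := ((hexp (-(1 / 2 * tau a x))).mul_left (tau a x ^ n * Real.exp (-(c * tau a x))))
    exact (this.mapL Complex.ofRealCLM).mul_right (u x)

/-- The Laguerre functions are triangular with nonzero leading coefficients in the `τ^n e^{-τ}`, so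
`u` annihilates all of these; `2i` half steps then lead from `e^{-τ}` to `e^{-(1+i)τ}`. -/
theorem integral_exp_eq_zero (h : Admissible R κ a) (u : L2 R κ a)
    (h0 : ∀ l, inner ℂ (laguerreL2 h l) u = 0) (i : ℕ) :
    ∫ x, ((Real.exp (-((1 + i) * tau a x)) : ℝ) : ℂ) * u x ∂mu R κ a = 0 := by
  have h1 : ∀ n : ℕ, ∫ x, ((tau a x ^ n * Real.exp (-(1 * tau a x)) : ℝ) : ℂ) * u x
      ∂mu R κ a = 0 := by
    intro n
    induction n using Nat.strong_induction_on with
    | _ n ih =>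
      have h2 := h0 n
      have e : ∀ x, (laguerreFun (lamA R κ a) n (tau a x) : ℂ) * u x =
          ∑ i ∈ Finset.range (n + 1), (laguerreCoeff (lamA R κ a) n i : ℂ) *
            (((tau a x ^ i * Real.exp (-(1 * tau a x)) : ℝ) : ℂ) * u x) := by
        intro x
        rw [laguerreFun, Complex.ofReal_sum, Finset.sum_mul]
        refine Finset.sum_congr rfl fun i _ => ?_
        rw [one_mul]
        push_cast
        ring
      rw [inner_laguerreL2] at h2
      simp_rw [e] at h2
      rw [integral_finsetSum _ fun i _ => (integrable_mul_coe u
        (memLp_tau_pow h i one_pos)).const_mul _] at h2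
      simp only [integral_const_mul] at h2
      rw [Finset.sum_range_succ, Finset.sum_eq_zero fun i hi => by
        rw [ih i (Finset.mem_range.1 hi), mul_zero], zero_add] at h2
      refine (mul_eq_zero.1 h2).resolve_left ?_
      have hν := h.lamA_pos
      have h3 : 0 < Real.Gamma (lamA R κ a + 1) := Real.Gamma_pos_of_pos hν
      have h4 : 0 < Real.Gamma (lamA R κ a + 1 + n) := Real.Gamma_pos_of_pos (by positivity)
      have : laguerreCoeff (lamA R κ a) n n ≠ 0 := by
        rw [laguerreCoeff, Nat.choose_self]
        have : (-2 : ℝ) ^ n ≠ 0 := by positivity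
        positivity
      exact_mod_cast this
  have h2 : ∀ k n : ℕ, ∫ x, ((tau a x ^ n * Real.exp (-((1 + k * (1 / 2)) * tau a x)) : ℝ) : ℂ) *
      u x ∂mu R κ a = 0 := by
    intro k
    induction k with
    | zero => simpa using h1
    | succ k ih =>
      intro n
      have := integral_tau_pow_step h u (c := 1 + k * (1 / 2))
        (by have : (0 : ℝ) ≤ k * (1 / 2) := by positivity
            linarith) ih n
      have e : (1 : ℝ) + ((k + 1 : ℕ) : ℝ) * (1 / 2) = 1 + k * (1 / 2) + 1 / 2 := by
        push_cast
        ring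
      rwa [e]
  have h3 := h2 (2 * i) 0
  have e : (1 : ℝ) + ((2 * i : ℕ) : ℝ) * (1 / 2) = 1 + i := by
    push_cast
    ring
  rw [e] at h3
  simpa only [pow_zero, one_mul] using h3

end SquareIntegrable

/-! ### The transform of radial functions tested on exponentials -/

section Key

variable {R : Finset (E d)} {κ : E d → ℝ} {a : ℝ}

/-- Compactly supported radial functions lie in the closed span of the Laguerre functions. -/
theorem mem_closure_span_laguerreL2 (h : Admissible R κ a) {k : ℝ → ℝ} (hk : Continuous k) {T : ℝ}
    (hT : ∀ t, T ≤ t → k t = 0) {f : L2 R κ a} (hf : f =ᵐ[mu R κ a] fun x => (k (tau a x) : ℂ)) :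
    f ∈ (Submodule.span ℂ (Set.range (laguerreL2 h))).topologicalClosure := by
  rw [← Submodule.orthogonal_orthogonal_eq_closure, Submodule.mem_orthogonal]
  intro u hu
  have hu0 : ∀ l, inner ℂ (laguerreL2 h l) u = 0 := fun l =>
    (Submodule.mem_orthogonal _ _).1 hu _ (Submodule.subset_span ⟨l, rfl⟩)
  have hz := integral_exp_eq_zero h u hu0
  rw [inner_eq_zero_symm, inner_of_real_left hf]
  -- With `v = e^{-τ}` one has `k(τ) = e^{-τ} F(e^{-τ})`, and `F` is continuous on `[0,1]` because
  -- `k` vanishes for large arguments. A polynomial `p` close to `F` yields `e^{-τ} p(e^{-τ})`, a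
  -- combination of the `e^{-(1+i)τ}` annihilated by `u`. The separated factor `e^{-τ}` keeps the
  -- error `ε e^{-τ} |u|` integrable.
  set F : ℝ → ℝ := fun v => k (-Real.log v) / v with hF
  have hFc : ContinuousOn F (Set.Icc 0 1) := by
    intro v hv
    rcases hv.1.eq_or_lt with h0 | h0
    · subst h0
      have hev : F =ᶠ[nhdsWithin 0 (Set.Icc 0 1)] fun _ => 0 := by
        have : Set.Iio (Real.exp (-T)) ∈ nhds (0 : ℝ) := Iio_mem_nhds (Real.exp_pos _)
        filter_upwards [mem_nhdsWithin_of_mem_nhds this, self_mem_nhdsWithin] with v hv hv'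
        rcases hv'.1.eq_or_lt with h1 | h1
        · simp [hF, ← h1]
        · have h2 : Real.log v < -T := (Real.log_lt_iff_lt_exp h1).2 hv
          simp [hF, hT (-Real.log v) (by linarith)]
      have h0 : F 0 = 0 := by simp [hF]
      exact ContinuousWithinAt.congr_of_eventuallyEq continuousWithinAt_const hev h0
    · refine ContinuousAt.continuousWithinAt ?_
      exact (hk.continuousAt.comp (Real.continuousAt_log h0.ne').neg).div continuousAt_id h0.ne'
  set C := ∫ x, ‖((Real.exp (-(1 * tau a x)) : ℝ) : ℂ) * u x‖ ∂mu R κ a with hC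
  have hi : ∀ c : ℝ, 0 < c → Integrable (fun x => ((Real.exp (-(c * tau a x)) : ℝ) : ℂ) * u x)
      (mu R κ a) := by
    intro c hc
    have := integrable_mul_coe u (memLp_tau_pow h 0 hc)
    simpa only [pow_zero, one_mul] using this
  have hbound : ∀ ε : ℝ, 0 < ε → ‖∫ x, (k (tau a x) : ℂ) * u x ∂mu R κ a‖ ≤ ε * C := by
    intro ε hε
    obtain ⟨p, hp⟩ := exists_polynomial_near_of_continuousOn 0 1 F hFc ε hε
    have hp0 : Integrable (fun x => ((Real.exp (-(1 * tau a x)) * p.eval (Real.exp (-tau a x)) : ℝ)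
        : ℂ) * u x) (mu R κ a) ∧ ∫ x, ((Real.exp (-(1 * tau a x)) * p.eval (Real.exp (-tau a x)) : ℝ)
        : ℂ) * u x ∂mu R κ a = 0 := by
      have e : (fun x => ((Real.exp (-(1 * tau a x)) * p.eval (Real.exp (-tau a x)) : ℝ) : ℂ) * u x) =
          fun x => ∑ i ∈ Finset.range (p.natDegree + 1), (p.coeff i : ℂ) *
            (((Real.exp (-((1 + i) * tau a x)) : ℝ) : ℂ) * u x) := by
        ext x
        rw [Polynomial.eval_eq_sum_range, Finset.mul_sum, Complex.ofReal_sum, Finset.sum_mul]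
        refine Finset.sum_congr rfl fun i _ => ?_
        have : Real.exp (-((1 + i) * tau a x)) =
            Real.exp (-(1 * tau a x)) * Real.exp (-tau a x) ^ i := by
          rw [← Real.exp_nat_mul, ← Real.exp_add]
          congr 1
          ring
        rw [this]
        push_cast
        ring
      rw [e]
      refine ⟨integrable_finsetSum _ fun i _ => (hi (1 + i) (by positivity)).const_mul _, ?_⟩
      rw [integral_finsetSum _ fun (i : ℕ) _ => (hi (1 + (i : ℝ)) (by positivity)).const_mul _]
      simp only [integral_const_mul, hz, mul_zero, Finset.sum_const_zero]
    have hle : ∀ x, ‖(k (tau a x) : ℂ) * u x - ((Real.exp (-(1 * tau a x)) *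
        p.eval (Real.exp (-tau a x)) : ℝ) : ℂ) * u x‖ ≤
        ε * ‖((Real.exp (-(1 * tau a x)) : ℝ) : ℂ) * u x‖ := by
      intro x
      have ht := tau_nonneg h.a_pos x
      have h1 := hp (Real.exp (-tau a x)) ⟨(Real.exp_pos _).le, Real.exp_le_one_iff.2 (by linarith)⟩
      have h2 : k (tau a x) = Real.exp (-(1 * tau a x)) * F (Real.exp (-tau a x)) := by
        rw [hF]
        simp only [Real.log_exp, neg_neg, one_mul]
        field_simp
      rw [← sub_mul, ← Complex.ofReal_sub, h2, ← mul_sub, norm_mul, norm_mul, Complex.norm_real,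
        Complex.norm_real, norm_mul, Real.norm_eq_abs (F _ - _), abs_sub_comm, mul_comm,
        mul_comm ε]
      calc _ = ‖Real.exp (-(1 * tau a x))‖ * ‖u x‖ *
            |p.eval (Real.exp (-tau a x)) - F (Real.exp (-tau a x))| := by ring
        _ ≤ _ := by gcongr
    have hki : Integrable (fun x => (k (tau a x) : ℂ) * u x) (mu R κ a) := by
      refine (integrable_mul_coe u (Lp.memLp f)).congr ?_
      filter_upwards [hf] with x hx
      rw [hx]
    calc _ = ‖∫ x, ((k (tau a x) : ℂ) * u x - ((Real.exp (-(1 * tau a x)) *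
          p.eval (Real.exp (-tau a x)) : ℝ) : ℂ) * u x) ∂mu R κ a‖ := by
          rw [integral_sub hki hp0.1, hp0.2, sub_zero]
      _ ≤ ∫ x, ε * ‖((Real.exp (-(1 * tau a x)) : ℝ) : ℂ) * u x‖ ∂mu R κ a :=
          norm_integral_le_of_norm_le ((hi 1 one_pos).norm.const_mul ε) (.of_forall hle)
      _ = ε * C := integral_const_mul _ _
  have hC0 : 0 ≤ C := integral_nonneg fun _ => norm_nonneg _
  refine norm_le_zero_iff.1 (le_of_forall_pos_le_add fun δ hδ => ?_)
  refine (hbound (δ / (C + 1)) (by positivity)).trans ?_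
  rw [zero_add, div_mul_eq_mul_div, div_le_iff₀ (by positivity)]
  nlinarith

theorem radialEigenvalue_injective (h : Admissible R κ a) :
    Function.Injective (radialEigenvalue R κ a) := by
  intro l m hlm
  have ha := h.a_pos.ne'
  simp only [radialEigenvalue, neg_inj, mul_right_inj' ha] at hlm
  have : (l : ℝ) = m := by linarith
  exact_mod_cast this

/-- On radial functions, the generalized Fourier transform exchanges `exp(-c |x|^a / a)` with a
multiple of `exp(-|x|^a / (c a))`, in the weak form. -/
theorem inner_expL2_genFourier (h : Admissible R κ a) {f : L2 R κ a}
    (hf : f ∈ (Submodule.span ℂ (Set.range (laguerreL2 h))).topologicalClosure) {c : ℝ}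
    (hc : 0 < c) : inner ℂ (expL2 h hc) (genFourier R κ a f) =
      (c ^ (-(lamA R κ a + 1)) : ℝ) * inner ℂ (expL2 h (inv_pos.2 hc)) f := by
  have ha : (a : ℂ) ≠ 0 := by exact_mod_cast h.a_pos.ne'
  set ν := lamA R κ a with hν
  set z : ℂ := Complex.I * Real.pi / (2 * a) with hz
  set θ : ℂ := Complex.exp (Complex.I * Real.pi / 2 * (ν + 1)) with hθ
  -- The exponents add up to `(iπ/2)(ν + 1) - (iπ/2)(2l + ν + 1) = -iπl`.
  have hexp : ∀ l, θ * Complex.exp (z * radialEigenvalue R κ a l) = (-1) ^ l := by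
    intro l
    rw [hθ, ← Complex.exp_add, ← Complex.exp_pi_mul_I, ← Complex.exp_nat_mul]
    rw [← Complex.exp_periodic.int_mul (l : ℤ)]
    congr 1
    rw [hz, radialEigenvalue]
    push_cast
    field_simp
    ring
  have hθ0 : θ ≠ 0 := Complex.exp_ne_zero _
  obtain ⟨K, hK, hint⟩ := inner_expL2_laguerreL2 h
  have key := inner_expOp_eq (G := oscillatorGraph R κ a) (laguerreL2_ne_zero h)
    (radialEigenvalue_injective h) (laguerreL2_mem_eigenspace h)
    (fun w hw l => inner_laguerreL2_graph h hw l) (z := z) (fun l => ?_) hf (v := expL2 h hc)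
    (v' := expL2 h (inv_pos.2 hc)) (b := θ⁻¹ * (c ^ (-(ν + 1)) : ℝ)) fun l => ?_
  · rw [genFourier, inner_smul_right, ← hν, ← hz, ← hθ, key, ← mul_assoc, ← mul_assoc,
      mul_inv_cancel₀ hθ0, one_mul]
  · have : z * radialEigenvalue R κ a l =
        ((-(Real.pi / 2 * (2 * l + ν + 1)) : ℝ) : ℂ) * Complex.I := by
      rw [hz, radialEigenvalue, ← hν]
      push_cast
      field_simp
    rw [this, Complex.norm_exp_ofReal_mul_I]
  · have h1 : Complex.exp (z * radialEigenvalue R κ a l) = θ⁻¹ * (-1) ^ l := by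
      rw [← hexp l, ← mul_assoc, inv_mul_cancel₀ hθ0, one_mul]
    rw [h1, hint, hint, ← hν]
    -- The sign `(-1)^l` is absorbed by `c ↦ 1/c` in `((c-1)/(c+1))^l`; the power of `c + 1`
    -- supplies the factor `c^{-(ν+1)}`, independent of `l`.
    have h2 : (-1) ^ l * (K * (c + 1) ^ (-(ν + 1)) * ((c - 1) / (c + 1)) ^ l) =
        c ^ (-(ν + 1)) * (K * (c⁻¹ + 1) ^ (-(ν + 1)) * ((c⁻¹ - 1) / (c⁻¹ + 1)) ^ l) := by
      have h3 : (c + 1) ^ (-(ν + 1)) = c ^ (-(ν + 1)) * (c⁻¹ + 1) ^ (-(ν + 1)) := by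
        rw [← Real.mul_rpow hc.le (by positivity)]
        congr 1
        field_simp
        ring
      have h4 : (c⁻¹ - 1) / (c⁻¹ + 1) = -1 * ((c - 1) / (c + 1)) := by
        field_simp
        ring
      rw [h3, h4, mul_pow]
      ring
    have h5 := congrArg (fun t : ℝ => θ⁻¹ * (t : ℂ)) h2
    push_cast at h5 ⊢
    linear_combination h5

/-- Letting `c → ∞` probes the transform at the origin and the profile's moments; letting `c → 0`
probes the transform at infinity and the profile at the origin. -/
theorem integral_exp_mul_genFourier (h : Admissible R κ a) {k : ℝ → ℝ} (hk : Continuous k) {T : ℝ}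
    (hT : ∀ t, T ≤ t → k t = 0) {f : L2 R κ a} (hf : f =ᵐ[mu R κ a] fun x => (k (tau a x) : ℂ))
    {c : ℝ} (hc : 0 < c) :
    ∫ x, (Real.exp (-(c * tau a x)) : ℂ) * genFourier R κ a f x ∂mu R κ a =
      ((c ^ (-(lamA R κ a + 1)) *
        ∫ x, Real.exp (-(c⁻¹ * tau a x)) * k (tau a x) ∂mu R κ a : ℝ) : ℂ) := by
  rw [← inner_expL2 h hc, inner_expL2_genFourier h (mem_closure_span_laguerreL2 h hk hT hf) hc,
    inner_expL2, Complex.ofReal_mul, ← integral_complex_ofReal]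
  congr 1
  refine integral_congr_ae ?_
  filter_upwards [hf] with x hx
  rw [hx]
  push_cast
  ring

end Key

/-! ### Comparison of asymptotic expansions in real powers -/

section Asymptotics

/-- A combination of real powers that is `O(x ^ δ)` at `0` has no exponent less than `δ`. -/
theorem coeff_eq_zero_of_isBigO (B : ℝ →₀ ℂ) {δ : ℝ}
    (h : (fun x : ℝ => B.sum fun e b => b * ((x ^ e : ℝ) : ℂ)) =O[nhdsWithin 0 (Set.Ioi 0)]
      fun x => x ^ δ) {e : ℝ} (he : e < δ) : B e = 0 := by
  by_contra hBe
  have hmem : e ∈ B.support := Finsupp.mem_support_iff.2 hBe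
  set m := B.support.min' ⟨e, hmem⟩ with hm
  have hme : m ≤ e := Finset.min'_le _ _ hmem
  have hBm : B m ≠ 0 := Finsupp.mem_support_iff.1 (Finset.min'_mem _ _)
  have hpow : ∀ p : ℝ, 0 < p → Filter.Tendsto (fun x : ℝ => x ^ p) (nhdsWithin 0 (Set.Ioi 0))
      (nhds 0) := by
    intro p hp
    have := (Real.continuousAt_rpow_const 0 p (Or.inr hp.le)).tendsto
    rw [Real.zero_rpow hp.ne'] at this
    exact this.mono_left nhdsWithin_le_nhds
  -- After division by `x^m`, with `m` the least exponent present, the sum tends to `B m`, but also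
  -- to `0` since `m < δ`.
  have h1 : Filter.Tendsto (fun x : ℝ => ∑ i ∈ B.support, B i * ((x ^ (i - m) : ℝ) : ℂ))
      (nhdsWithin 0 (Set.Ioi 0)) (nhds (∑ i ∈ B.support, if i = m then B i else 0)) := by
    refine tendsto_finsetSum _ fun i hi => ?_
    split_ifs with him
    · simp [him]
    · have hlt : 0 < i - m := sub_pos.2 (lt_of_le_of_ne (Finset.min'_le _ _ hi) (Ne.symm him))
      have := ((Complex.continuous_ofReal.tendsto _).comp (hpow _ hlt)).const_mul (B i)
      simpa using this
  have hmB : m ∈ B.support := Finset.min'_mem _ _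
  rw [Finset.sum_ite_eq' B.support m, if_pos hmB] at h1
  have h2 : (fun x : ℝ => ∑ i ∈ B.support, B i * ((x ^ (i - m) : ℝ) : ℂ))
      =O[nhdsWithin 0 (Set.Ioi 0)] fun x => x ^ (δ - m) := by
    have h0 : (fun x : ℝ => ((x ^ (-m) : ℝ) : ℂ)) =O[nhdsWithin 0 (Set.Ioi 0)]
        fun x => x ^ (-m) := Asymptotics.IsBigO.of_norm_right (.of_bound 1 (by simp))
    refine (h0.mul h).congr' ?_ ?_
    · filter_upwards [self_mem_nhdsWithin] with x hx
      rw [Finsupp.sum, Finset.mul_sum]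
      refine Finset.sum_congr rfl fun i _ => ?_
      rw [sub_eq_neg_add, Real.rpow_add hx]
      push_cast
      ring
    · filter_upwards [self_mem_nhdsWithin] with x hx
      rw [sub_eq_neg_add, Real.rpow_add hx]
  have h3 := h2.trans_tendsto (hpow _ (by linarith))
  exact hBm (tendsto_nhds_unique h1 h3)

/-- A power `x ^ e` with nonzero coefficient can only be cancelled, up to `O(x ^ δ)` with `e < δ`,
by a term with the same exponent. -/
theorem exists_exponent_eq {ι : Type*} (S : Finset ι) (b : ι → ℂ) (p : ι → ℝ) {e δ : ℝ} {β : ℂ}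
    (hβ : β ≠ 0) (he : e < δ) (h : (fun x : ℝ => (∑ i ∈ S, b i * ((x ^ p i : ℝ) : ℂ)) +
      β * ((x ^ e : ℝ) : ℂ)) =O[nhdsWithin 0 (Set.Ioi 0)] fun x => x ^ δ) :
    ∃ i ∈ S, p i = e ∧ b i ≠ 0 := by
  classical
  by_contra! hcon
  -- Collecting the coefficients by exponent allows repeated values of `p`.
  set B : ℝ →₀ ℂ := (∑ i ∈ S, Finsupp.single (p i) (b i)) + Finsupp.single e β with hB
  have hsum : ∀ x : ℝ, B.sum (fun e b => b * ((x ^ e : ℝ) : ℂ)) =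
      (∑ i ∈ S, b i * ((x ^ p i : ℝ) : ℂ)) + β * ((x ^ e : ℝ) : ℂ) := by
    intro x
    rw [hB, Finsupp.sum_add_index' (fun _ => zero_mul _) fun _ _ _ => add_mul _ _ _,
      ← Finsupp.sum_finsetSum_index (fun _ => zero_mul _) fun _ _ _ => add_mul _ _ _]
    simp [Finsupp.sum_single_index]
  have h0 := coeff_eq_zero_of_isBigO B (by simpa only [hsum] using h) he
  rw [hB, Finsupp.add_apply, Finsupp.finsetSum_apply, Finsupp.single_eq_same,
    Finset.sum_eq_zero, zero_add] at h0
  · exact hβ h0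
  · intro i hi
    rw [Finsupp.single_apply]
    split_ifs with hp
    · exact hcon i hi hp
    · rfl

/-- Uniform on the half line: for `s ≤ 1` it is the usual remainder estimate, and for `s ≥ 1` every
term is itself at most `s^K`. -/
theorem abs_exp_neg_sub_sum_le (K : ℕ) : ∃ C : ℝ, 0 ≤ C ∧ ∀ s : ℝ, 0 ≤ s →
    |Real.exp (-s) - ∑ k ∈ Finset.range K, (-s) ^ k / (k.factorial : ℝ)| ≤ C * s ^ K := by
  rcases Nat.eq_zero_or_pos K with rfl | hK
  · refine ⟨1, zero_le_one, fun s hs => ?_⟩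
    simp [Real.abs_exp, hs]
  refine ⟨(K.succ / (K.factorial * K) : ℝ) + (1 + K), by positivity, fun s hs => ?_⟩
  rw [add_mul]
  rcases le_total s 1 with h1 | h1
  · have := Real.exp_bound (x := -s) (by rwa [abs_neg, abs_of_nonneg hs]) hK
    rw [abs_neg, abs_of_nonneg hs, mul_comm] at this
    exact this.trans (le_add_of_nonneg_right (by positivity))
  · refine le_trans ?_ (le_add_of_nonneg_left (by positivity))
    have hpow : (1 : ℝ) ≤ s ^ K := one_le_pow₀ h1
    have hsum : |∑ k ∈ Finset.range K, (-s) ^ k / (k.factorial : ℝ)| ≤ K * s ^ K := by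
      refine (Finset.abs_sum_le_sum_abs _ _).trans ?_
      refine (Finset.sum_le_card_nsmul _ _ (s ^ K) fun k hk => ?_).trans_eq (by simp)
      rw [abs_div, abs_pow, abs_neg, abs_of_nonneg hs, Nat.abs_cast]
      refine (div_le_self (by positivity) (by exact_mod_cast k.factorial_pos)).trans ?_
      exact pow_le_pow_right₀ h1 (Finset.mem_range.1 hk).le
    have hexp : |Real.exp (-s)| ≤ s ^ K := by
      rw [Real.abs_exp]
      exact (Real.exp_le_one_iff.2 (by linarith)).trans hpow
    linarith [abs_sub (Real.exp (-s)) (∑ k ∈ Finset.range K, (-s) ^ k / (k.factorial : ℝ))]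

theorem rpow_mul_exp_neg_le (s : ℝ) (hs : 0 ≤ s) :
    ∃ C : ℝ, 0 ≤ C ∧ ∀ y : ℝ, 0 ≤ y → y ^ s * Real.exp (-y) ≤ C := by
  obtain ⟨n, hn⟩ := exists_nat_ge s
  refine ⟨1 + n.factorial, by positivity, fun y hy => ?_⟩
  have h1 : y ^ s ≤ 1 + y ^ n := by
    rcases le_total y 1 with h | h
    · exact (Real.rpow_le_one hy h hs).trans (le_add_of_nonneg_right (by positivity))
    · rw [← Real.rpow_natCast]
      exact (Real.rpow_le_rpow_of_exponent_le h hn).trans (le_add_of_nonneg_left zero_le_one)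
  have h2 := Real.pow_div_factorial_le_exp y hy n
  rw [div_le_iff₀ (by positivity)] at h2
  rw [Real.exp_neg, ← div_eq_mul_inv, div_le_iff₀ (Real.exp_pos y)]
  have h3 := Real.one_le_exp hy
  nlinarith

theorem abs_le_mul_exp_neg {k : ℝ → ℝ} (hk : Continuous k) {T : ℝ} (hT : ∀ t, T ≤ t → k t = 0) :
    ∃ C : ℝ, 0 ≤ C ∧ ∀ t, 0 ≤ t → |k t| ≤ C * Real.exp (-t) := by
  obtain ⟨C, hC⟩ := (isCompact_Icc (a := (0 : ℝ)) (b := T)).exists_bound_of_continuousOn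
    (f := fun t => k t * Real.exp t) (by fun_prop)
  refine ⟨max C 0, le_max_right _ _, fun t ht => ?_⟩
  rw [Real.exp_neg, ← div_eq_mul_inv, le_div_iff₀ (Real.exp_pos t)]
  rcases le_total T t with h | h
  · simp [hT t h]
  · have := hC t ⟨ht, h⟩
    rw [norm_mul, Real.norm_eq_abs, Real.norm_eq_abs, Real.abs_exp] at this
    exact this.trans (le_max_left _ _)

end Asymptotics

/-! ### The test function -/

section Test

variable {R : Finset (E d)} {κ : E d → ℝ} {a : ℝ}

/-- The profile, in the variable `|x|^a / a`, of the test function `|x|^2 cutoff (|x|^2)`. -/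
def testProfile (a t : ℝ) : ℝ := (a * max t 0) ^ (2 / a) * cutoff ((a * max t 0) ^ (2 / a))

theorem continuous_testProfile (ha : 0 < a) : Continuous (testProfile a) := by
  have h1 : Continuous fun t : ℝ => (a * max t 0) ^ (2 / a) :=
    Continuous.rpow_const (by fun_prop) fun _ => Or.inr (by positivity)
  exact h1.mul ((contDiff_cutoff (n := 0)).continuous.comp h1)

theorem testProfile_eq_zero (ha : 0 < a) {t : ℝ} (ht : 2 ^ (a / 2) / a ≤ t) :
    testProfile a t = 0 := by
  have h0 : 0 ≤ t := le_trans (by positivity) ht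
  rw [div_le_iff₀' ha] at ht
  have h1 : (2 : ℝ) ≤ (a * t) ^ (2 / a) := by
    have := Real.rpow_le_rpow (by positivity) ht (show 0 ≤ 2 / a by positivity)
    rwa [← Real.rpow_mul zero_le_two, div_mul_div_cancel₀ two_ne_zero, div_self ha.ne',
      Real.rpow_one] at this
  rw [testProfile, max_eq_left h0, cutoff_of_ge h1, mul_zero]

theorem testProfile_tau (ha : 0 < a) (x : E d) :
    testProfile a (tau a x) = ‖x‖ ^ 2 * cutoff (‖x‖ ^ 2) := by
  have : (a * max (tau a x) 0) ^ (2 / a) = ‖x‖ ^ 2 := by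
    rw [max_eq_left (tau_nonneg ha x), tau, mul_div_cancel₀ _ ha.ne',
      ← Real.rpow_mul (norm_nonneg x), mul_div_cancel₀ _ ha.ne']
    norm_cast
  rw [testProfile, this]

theorem testProfile_nonneg (ha : 0 < a) (t : ℝ) : 0 ≤ testProfile a t :=
  mul_nonneg (by positivity) (cutoff_nonneg _)

/-- With `s = (a t)^{2/a}` this is `s(1 - χ(s)) ≤ s²`: `χ = 1` for `s ≤ 1`, and `1 - χ ≤ 1 ≤ s`
otherwise. -/
theorem abs_testProfile_sub_le (ha : 0 < a) {t : ℝ} (ht : 0 ≤ t) :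
    |testProfile a t - (a * t) ^ (2 / a)| ≤ (a * t) ^ (4 / a) := by
  have h4 : (a * t) ^ (4 / a) = (a * t) ^ (2 / a) * (a * t) ^ (2 / a) := by
    rw [← Real.rpow_add_of_nonneg (by positivity) (by positivity) (by positivity)]
    congr 1
    ring
  rw [testProfile, max_eq_left ht, h4]
  set s := (a * t) ^ (2 / a)
  have hs : 0 ≤ s := by positivity
  rw [show s * cutoff s - s = -(s * (1 - cutoff s)) by ring, abs_neg,
    abs_of_nonneg (mul_nonneg hs (sub_nonneg.2 (cutoff_le_one s)))]
  refine mul_le_mul_of_nonneg_left ?_ hs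
  rcases le_total s 1 with h | h
  · simpa [cutoff_of_le h] using hs
  · linarith [cutoff_nonneg s]

/-- The same function serves both parts: its first moment in `τ` is positive, and its leading
behaviour `|x|² = (aτ)^{2/a}` at the origin carries the exponent `2/a`. -/
theorem exists_testFunction (h : Admissible R κ a) : ∃ f ∈ schwartzSet R κ a,
    f =ᵐ[mu R κ a] fun x => (testProfile a (tau a x) : ℂ) := by
  have hcd : ContDiff ℝ ∞ fun x : E d => ((‖x‖ ^ 2 * cutoff (‖x‖ ^ 2) : ℝ) : ℂ) :=
    Complex.ofRealCLM.contDiff.comp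
      ((contDiff_norm_sq ℝ).mul (contDiff_cutoff.comp (contDiff_norm_sq ℝ)))
  have hcs : HasCompactSupport fun x : E d => ((‖x‖ ^ 2 * cutoff (‖x‖ ^ 2) : ℝ) : ℂ) := by
    refine HasCompactSupport.of_support_subset_isCompact (isCompact_closedBall 0 2) fun x hx => ?_
    by_contra hx2
    rw [mem_closedBall_zero_iff, not_le] at hx2
    exact hx (by simp [cutoff_of_ge (show 2 ≤ ‖x‖ ^ 2 by nlinarith)])
  obtain ⟨C, hC, hle⟩ := abs_le_mul_exp_neg (continuous_testProfile h.a_pos)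
    fun t ht => testProfile_eq_zero h.a_pos ht
  have hL : MemLp (fun x : E d => ((‖x‖ ^ 2 * cutoff (‖x‖ ^ 2) : ℝ) : ℂ)) 2 (mu R κ a) := by
    refine (memLp_tau_pow h 0 one_pos).of_le_mul (c := C) hcd.continuous.aestronglyMeasurable
      (.of_forall fun x => ?_)
    rw [← testProfile_tau h.a_pos, Complex.norm_real, Complex.norm_real, pow_zero, one_mul, one_mul,
      Real.norm_eq_abs, Real.norm_eq_abs, Real.abs_exp]
    exact hle _ (tau_nonneg h.a_pos x)
  refine ⟨hL.toLp, ⟨hcs.toSchwartzMap hcd, hL.coeFn_toLp⟩, ?_⟩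
  filter_upwards [hL.coeFn_toLp] with x hx
  rw [hx, testProfile_tau h.a_pos]

theorem integrable_tau_pow_mul (h : Admissible R κ a) {k : ℝ → ℝ} (hk : Continuous k) {T : ℝ}
    (hT : ∀ t, T ≤ t → k t = 0) (n : ℕ) :
    Integrable (fun x => tau a x ^ n * k (tau a x)) (mu R κ a) := by
  obtain ⟨C, hC, hle⟩ := abs_le_mul_exp_neg hk hT
  have hc := continuous_tau (d := d) h.a_pos
  refine ((integrable_tau_pow h n (c := 1) one_pos).const_mul C).mono'
    (by fun_prop) (.of_forall fun x => ?_)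
  have ht := tau_nonneg h.a_pos x
  rw [norm_mul, Real.norm_of_nonneg (pow_nonneg ht n), one_mul]
  calc tau a x ^ n * ‖k (tau a x)‖ ≤ tau a x ^ n * (C * Real.exp (-tau a x)) := by
        gcongr
        exact hle _ ht
    _ = _ := by ring

theorem ae_of_ae_mu (h : Admissible R κ a) {p : E d → Prop} (hp : ∀ᵐ x ∂mu R κ a, p x) :
    ∀ᵐ x : E d, p x := by
  refine (withDensity_absolutelyContinuous' (measurable_density h).aemeasurable ?_).ae_le hp
  filter_upwards [ae_ne_zero h, ae_inner_ne_zero h.root] with x hx hx'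
  have : 0 < weight R κ a x :=
    mul_pos (Real.rpow_pos_of_pos (norm_pos_iff.2 hx) _)
      (Finset.prod_pos fun α hα => Real.rpow_pos_of_pos (abs_pos.2 (hx' α hα)) _)
  exact (ENNReal.ofReal_pos.2 (mul_pos (normConst_pos h) this)).ne'

/-- This is the coefficient `m₁` that must not vanish. If it did, the continuous nonnegative
integrand would vanish everywhere, but it is `1/a` on the unit sphere. -/
theorem integral_tau_mul_testProfile_pos (h : Admissible R κ a) :
    0 < ∫ x, tau a x * testProfile a (tau a x) ∂mu R κ a := by
  have hnn : ∀ x : E d, 0 ≤ tau a x * testProfile a (tau a x) := fun x =>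
    mul_nonneg (tau_nonneg h.a_pos x) (testProfile_nonneg h.a_pos _)
  have hi := integrable_tau_pow_mul h (continuous_testProfile h.a_pos)
    (fun t ht => testProfile_eq_zero h.a_pos ht) 1
  simp only [pow_one] at hi
  refine lt_of_le_of_ne (integral_nonneg hnn) fun h0 => ?_
  have hz := ae_of_ae_mu h ((integral_eq_zero_iff_of_nonneg hnn hi).1 h0.symm)
  have hc := continuous_tau (d := d) h.a_pos
  have hk := continuous_testProfile h.a_pos
  have hzero : (fun x : E d => tau a x * testProfile a (tau a x)) = 0 :=
    Continuous.ae_eq_iff_eq (μ := volume) (by fun_prop) continuous_zero |>.1 hz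
  have : Nontrivial (E d) := by
    have : Nonempty (Fin d) := ⟨⟨0, h.one_le⟩⟩
    infer_instance
  obtain ⟨x, hx⟩ := exists_norm_eq (E d) zero_le_one
  have h1 := congrFun hzero x
  rw [testProfile_tau h.a_pos, tau, hx, Real.one_rpow, one_pow, cutoff_of_le le_rfl, mul_one,
    mul_one, Pi.zero_apply] at h1
  exact (one_div_pos.2 h.a_pos).ne' h1

end Test

/-! ### Taylor expansion with a global remainder bound -/

section Taylor

variable {V : Type*} [NormedAddCommGroup V] [NormedSpace ℝ V]

/-- The term of degree `m` of the Taylor series at `0`. -/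
def taylorTerm (g : V → ℂ) (m : ℕ) (x : V) : ℂ :=
  (m.factorial : ℝ)⁻¹ • iteratedFDeriv ℝ m g 0 fun _ => x

theorem taylorTerm_smul (g : V → ℂ) (m : ℕ) (r : ℝ) (x : V) :
    taylorTerm g m (r • x) = r ^ m • taylorTerm g m x := by
  rw [taylorTerm, taylorTerm, ContinuousMultilinearMap.map_smul_univ _ (fun _ => r) (fun _ => x),
    smul_comm]
  simp

theorem continuous_taylorTerm (g : V → ℂ) (m : ℕ) : Continuous (taylorTerm g m) := by
  have : Continuous fun x : V => iteratedFDeriv ℝ m g 0 fun _ => x :=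
    (iteratedFDeriv ℝ m g 0).cont.comp (continuous_pi fun _ => continuous_id)
  exact this.const_smul (m.factorial : ℝ)⁻¹

theorem norm_taylorTerm_le (g : V → ℂ) (m : ℕ) (x : V) :
    ‖taylorTerm g m x‖ ≤ ‖iteratedFDeriv ℝ m g 0‖ * ‖x‖ ^ m := by
  rw [taylorTerm, norm_smul, norm_inv, Real.norm_natCast]
  have h1 : ‖iteratedFDeriv ℝ m g 0 fun _ => x‖ ≤ ‖iteratedFDeriv ℝ m g 0‖ * ‖x‖ ^ m := by
    simpa using (iteratedFDeriv ℝ m g 0).le_opNorm fun _ => x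
  refine (mul_le_of_le_one_left (norm_nonneg _) ?_).trans h1
  exact inv_le_one_of_one_le₀ (by exact_mod_cast m.factorial_pos)

/-- The term `‖g x‖` on the right makes the bound global without any growth condition on `g`: on the
unit ball the integral remainder is used, and outside it `1 ≤ ‖x‖^{n+1}` absorbs both `g` and the
Taylor polynomial. -/
theorem exists_taylor_bound [ProperSpace V] {g : V → ℂ} (hg : ContDiff ℝ ∞ g) (n : ℕ) :
    ∃ C : ℝ, 0 ≤ C ∧ ∀ x, ‖g x - ∑ m ∈ Finset.range (n + 1), taylorTerm g m x‖ ≤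
      (C + ‖g x‖) * ‖x‖ ^ (n + 1) := by
  obtain ⟨C, hC⟩ := (isCompact_closedBall (0 : V) 1).exists_bound_of_continuousOn
    (hg.continuous_iteratedFDeriv (m := n + 1) (by exact_mod_cast le_top)).continuousOn
  have hC0 : 0 ≤ C := (norm_nonneg _).trans (hC 0 (by simp))
  refine ⟨C + ∑ m ∈ Finset.range (n + 1), ‖iteratedFDeriv ℝ m g 0‖, by positivity, fun x => ?_⟩
  rcases le_total ‖x‖ 1 with hx | hx
  · have ht := map_add_eq_sum_add_integral_iteratedFDeriv (f := g) (x := 0) (y := x) (n := n)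
      fun t _ => (hg.of_le (by exact_mod_cast le_top)).contDiffAt
    simp only [zero_add] at ht
    have hint : ‖∫ t in (0 : ℝ)..1, (1 - t) ^ n • iteratedFDeriv ℝ (n + 1) g (t • x) fun _ => x‖ ≤
        (C * ‖x‖ ^ (n + 1)) * |(1 : ℝ) - 0| := by
      refine intervalIntegral.norm_integral_le_of_norm_le_const fun t ht => ?_
      rw [Set.uIoc_of_le zero_le_one] at ht
      have h1 : ‖(1 - t) ^ n‖ ≤ 1 := by
        rw [norm_pow, Real.norm_of_nonneg (by linarith [ht.2])]
        exact pow_le_one₀ (by linarith [ht.2]) (by linarith [ht.1])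
      have h2 : ‖iteratedFDeriv ℝ (n + 1) g (t • x) fun _ => x‖ ≤ C * ‖x‖ ^ (n + 1) := by
        refine ((iteratedFDeriv ℝ (n + 1) g (t • x)).le_opNorm fun _ => x).trans ?_
        rw [Finset.prod_const, Finset.card_univ, Fintype.card_fin]
        gcongr
        refine hC _ ?_
        rw [mem_closedBall_zero_iff, norm_smul, Real.norm_of_nonneg ht.1.le]
        exact mul_le_one₀ ht.2 (norm_nonneg _) hx
      rw [norm_smul]
      exact (mul_le_of_le_one_left (norm_nonneg _) h1).trans h2
    have hrem : g x - ∑ m ∈ Finset.range (n + 1), taylorTerm g m x = (n.factorial : ℝ)⁻¹ •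
        ∫ t in (0 : ℝ)..1, (1 - t) ^ n • iteratedFDeriv ℝ (n + 1) g (t • x) fun _ => x := by
      rw [sub_eq_iff_eq_add']
      exact ht
    rw [hrem, norm_smul, norm_inv, Real.norm_natCast]
    have hf : ((n.factorial : ℝ))⁻¹ ≤ 1 :=
      inv_le_one_of_one_le₀ (by exact_mod_cast n.factorial_pos)
    refine (mul_le_of_le_one_left (norm_nonneg _) hf).trans (hint.trans ?_)
    rw [sub_zero, abs_one, mul_one]
    gcongr
    rw [add_assoc]
    exact le_add_of_nonneg_right (by positivity)
  · have hp : 1 ≤ ‖x‖ ^ (n + 1) := one_le_pow₀ hx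
    have hsum : ‖∑ m ∈ Finset.range (n + 1), taylorTerm g m x‖ ≤
        (∑ m ∈ Finset.range (n + 1), ‖iteratedFDeriv ℝ m g 0‖) * ‖x‖ ^ (n + 1) := by
      rw [Finset.sum_mul]
      refine norm_sum_le_of_le _ fun m hm => (norm_taylorTerm_le g m x).trans ?_
      gcongr
      exact (Finset.mem_range.1 hm).le
    calc _ ≤ ‖g x‖ + ‖∑ m ∈ Finset.range (n + 1), taylorTerm g m x‖ := norm_sub_le _ _
      _ ≤ ‖g x‖ * ‖x‖ ^ (n + 1) + C * ‖x‖ ^ (n + 1) + (∑ m ∈ Finset.range (n + 1),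
          ‖iteratedFDeriv ℝ m g 0‖) * ‖x‖ ^ (n + 1) := by
          have := le_mul_of_one_le_right (norm_nonneg (g x)) hp
          have : 0 ≤ C * ‖x‖ ^ (n + 1) := by positivity
          linarith
      _ = _ := by ring

end Taylor

/-! ### Smooth functions tested on `exp(-cτ)` for large `c` -/

section Smooth

variable {R : Finset (E d)} {κ : E d → ℝ} {a : ℝ}

theorem tau_neg (x : E d) : tau a (-x) = tau a x := by simp [tau]

theorem weight_neg (x : E d) : weight R κ a (-x) = weight R κ a x := by simp [weight]

theorem integral_mu_neg (h : Admissible R κ a) (F : E d → ℂ) :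
    ∫ x, F (-x) ∂mu R κ a = ∫ x, F x ∂mu R κ a := by
  rw [integral_mu h, integral_mu h, ← integral_neg_eq_self (fun x => weight R κ a x • F x)]
  simp only [weight_neg]

theorem taylorTerm_homogeneous (g : E d → ℂ) (m : ℕ) (r : ℝ) (_ : 0 < r) (x : E d) :
    taylorTerm g m (r • x) = r ^ (m : ℝ) • taylorTerm g m x := by
  rw [taylorTerm_smul, Real.rpow_natCast]

theorem integrable_exp_smul_taylorTerm (h : Admissible R κ a) (g : E d → ℂ) (m : ℕ) {c : ℝ}
    (hc : 0 < c) : Integrable (fun x => Real.exp (-(c * tau a x)) • taylorTerm g m x)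
      (mu R κ a) := by
  simpa using integrable_homogeneous_mul_tau h (taylorTerm_homogeneous g m)
    (continuous_taylorTerm g m) m.cast_nonneg le_rfl hc

/-- Homogeneity yields the power of `c`; for odd degree the integral changes sign under `x ↦ -x`,
which preserves `mu`. -/
theorem integral_exp_smul_taylorTerm (h : Admissible R κ a) (g : E d → ℂ) :
    ∃ A : ℕ → ℂ, (∀ m, Odd m → A m = 0) ∧ ∀ (m : ℕ) (c : ℝ), 0 < c →
      ∫ x, Real.exp (-(c * tau a x)) • taylorTerm g m x ∂mu R κ a =
        c ^ (-(lamA R κ a + 1 + m / a)) • A m := by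
  choose A hA using fun m : ℕ =>
    integral_homogeneous_mul_exp h (taylorTerm_homogeneous g m) m.cast_nonneg
  refine ⟨A, fun m hm => ?_, hA⟩
  have h1 := hA m 1 one_pos
  rw [← integral_mu_neg h] at h1
  have h2 : ∀ x, taylorTerm g m (-x) = -taylorTerm g m x := by
    intro x
    rw [← neg_one_smul ℝ, taylorTerm_smul, hm.neg_one_pow, neg_one_smul]
  simp only [tau_neg, h2, smul_neg, integral_neg, hA m 1 one_pos, Real.one_rpow, one_smul] at h1
  exact self_eq_neg.1 h1.symm

/-- Half of the exponent `cτ` absorbs the power of `|x|` at the price `c^{-s}`; the other half is at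
least `τ` because `c ≥ 2`, and keeps an integrable weight. -/
theorem exp_mul_norm_rpow_le (ha : 0 < a) {s : ℝ} (hs : 0 ≤ s) :
    ∃ C : ℝ, 0 ≤ C ∧ ∀ c : ℝ, 2 ≤ c → ∀ x : E d,
      Real.exp (-(c * tau a x)) * ‖x‖ ^ (a * s) ≤ C * c ^ (-s) * Real.exp (-tau a x) := by
  obtain ⟨C, hC, hle⟩ := rpow_mul_exp_neg_le s hs
  refine ⟨(2 * a) ^ s * C, by positivity, fun c hc x => ?_⟩
  have hc0 : 0 < c := by linarith
  have ht := tau_nonneg ha x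
  have h1 : ‖x‖ ^ (a * s) = (2 * a) ^ s * c ^ (-s) * (c / 2 * tau a x) ^ s := by
    rw [Real.mul_rpow (by positivity) ht, tau_rpow_eq ha, Real.div_rpow hc0.le zero_le_two,
      Real.mul_rpow zero_le_two ha.le, Real.rpow_neg hc0.le]
    have h2 : (2 : ℝ) ^ s ≠ 0 := by positivity
    have h3 : a ^ s ≠ 0 := by positivity
    have h4 : c ^ s ≠ 0 := by positivity
    field_simp
  have h2 : Real.exp (-(c * tau a x)) ≤
      Real.exp (-(c / 2 * tau a x)) * Real.exp (-tau a x) := by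
    rw [← Real.exp_add]
    gcongr
    nlinarith
  calc _ ≤ (Real.exp (-(c / 2 * tau a x)) * Real.exp (-tau a x)) *
        ((2 * a) ^ s * c ^ (-s) * (c / 2 * tau a x) ^ s) := by
        rw [h1]
        gcongr
    _ = (2 * a) ^ s * c ^ (-s) * Real.exp (-tau a x) *
        ((c / 2 * tau a x) ^ s * Real.exp (-(c / 2 * tau a x))) := by ring
    _ ≤ (2 * a) ^ s * c ^ (-s) * Real.exp (-tau a x) * C := by
        gcongr
        exact hle _ (by positivity)
    _ = _ := by ring

theorem integrable_exp_mul (h : Admissible R κ a) (u : L2 R κ a) {c : ℝ} (hc : 0 < c) :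
    Integrable (fun x => (Real.exp (-(c * tau a x)) : ℂ) * u x) (mu R κ a) := by
  simpa only [pow_zero, one_mul, Complex.ofReal_exp] using integrable_mul_coe u (memLp_tau_pow h 0 hc)

/-- A smooth function has an asymptotic expansion of its integral against `exp(-c |x|^a / a)` as
`c → ∞` in which only even degrees occur. -/
theorem exists_expansion_of_smooth (h : Admissible R κ a) (u : L2 R κ a) {g : E d → ℂ}
    (hg : ContDiff ℝ ∞ g) (hu : u =ᵐ[mu R κ a] g) (n : ℕ) :
    ∃ A : ℕ → ℂ, (∀ m, Odd m → A m = 0) ∧ ∃ C : ℝ, 0 ≤ C ∧ ∀ c : ℝ, 2 ≤ c →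
      ‖∫ x, (Real.exp (-(c * tau a x)) : ℂ) * u x ∂mu R κ a - ∑ m ∈ Finset.range (n + 1),
        c ^ (-(lamA R κ a + 1 + m / a)) • A m‖ ≤ C * c ^ (-((n + 1 : ℕ) / a)) := by
  obtain ⟨A, hodd, hA⟩ := integral_exp_smul_taylorTerm h g
  obtain ⟨C₁, hC₁, hT⟩ := exists_taylor_bound hg n
  obtain ⟨C₂, hC₂, hE⟩ := exp_mul_norm_rpow_le (d := d) h.a_pos
    (s := (n + 1 : ℕ) / a) (div_nonneg (Nat.cast_nonneg _) h.a_pos.le)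
  rw [mul_div_cancel₀ _ h.a_pos.ne'] at hE
  simp only [Real.rpow_natCast] at hE
  have hi0 : Integrable (fun x => Real.exp (-(1 * tau a x))) (mu R κ a) := by
    simpa using integrable_tau_pow h 0 one_pos
  have hi1 := (integrable_exp_mul h u one_pos).norm
  -- Up to the factor `C₂ c^{-(n+1)/a}` this dominates the remainder. The unknown growth of `g`
  -- enters only through `e^{-τ} u`, which is integrable since `u` is square integrable.
  have hi : Integrable (fun x => C₁ * Real.exp (-(1 * tau a x)) +
      ‖(Real.exp (-(1 * tau a x)) : ℂ) * u x‖) (mu R κ a) := (hi0.const_mul C₁).add hi1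
  have hnn : 0 ≤ ∫ x, (C₁ * Real.exp (-(1 * tau a x)) +
      ‖(Real.exp (-(1 * tau a x)) : ℂ) * u x‖) ∂mu R κ a :=
    integral_nonneg fun x => by positivity
  refine ⟨A, hodd, C₂ * _, mul_nonneg hC₂ hnn, fun c hc => ?_⟩
  have hc0 : 0 < c := by linarith
  have hterm : ∀ m ∈ Finset.range (n + 1), Integrable
      (fun x => Real.exp (-(c * tau a x)) • taylorTerm g m x) (mu R κ a) := fun m _ =>
    integrable_exp_smul_taylorTerm h g m hc0
  have hdiff : ∫ x, (Real.exp (-(c * tau a x)) : ℂ) * u x ∂mu R κ a -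
      ∑ m ∈ Finset.range (n + 1), c ^ (-(lamA R κ a + 1 + m / a)) • A m =
      ∫ x, ((Real.exp (-(c * tau a x)) : ℂ) * u x - ∑ m ∈ Finset.range (n + 1),
        Real.exp (-(c * tau a x)) • taylorTerm g m x) ∂mu R κ a := by
    rw [integral_sub (integrable_exp_mul h u hc0) (integrable_finsetSum _ hterm),
      integral_finsetSum _ hterm]
    simp only [hA _ c hc0]
  rw [hdiff, mul_right_comm, ← integral_const_mul]
  refine norm_integral_le_of_norm_le (hi.const_mul _) ?_
  filter_upwards [hu] with x hx
  have h1 : (Real.exp (-(c * tau a x)) : ℂ) * u x - ∑ m ∈ Finset.range (n + 1),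
      Real.exp (-(c * tau a x)) • taylorTerm g m x = (Real.exp (-(c * tau a x)) : ℂ) *
        (g x - ∑ m ∈ Finset.range (n + 1), taylorTerm g m x) := by
    rw [hx, mul_sub, Finset.mul_sum]
    simp only [Complex.real_smul]
  have h2 : ∀ c : ℝ, ‖(Real.exp (-(c * tau a x)) : ℂ)‖ = Real.exp (-(c * tau a x)) := fun c => by
    rw [Complex.norm_real, Real.norm_eq_abs, Real.abs_exp]
  rw [h1, norm_mul, norm_mul, h2, h2, hx]
  calc _ ≤ Real.exp (-(c * tau a x)) * ((C₁ + ‖g x‖) * ‖x‖ ^ (n + 1)) := by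
        gcongr
        exact hT x
    _ = (C₁ + ‖g x‖) * (Real.exp (-(c * tau a x)) * ‖x‖ ^ (n + 1)) := by ring
    _ ≤ (C₁ + ‖g x‖) * (C₂ * c ^ (-((n + 1 : ℕ) / a)) * Real.exp (-tau a x)) := by
        exact mul_le_mul_of_nonneg_left (hE c hc x) (by positivity)
    _ = _ := by
        rw [one_mul]
        ring

end Smooth

/-! ### Smoothness of the transforms forces `a / 2` to be an integer -/

section Main

variable {R : Finset (E d)} {κ : E d → ℝ} {a : ℝ}

theorem integral_exp_mul_profile_expansion (h : Admissible R κ a) {k : ℝ → ℝ} (hk : Continuous k)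
    {T : ℝ} (hT : ∀ t, T ≤ t → k t = 0) : ∃ C : ℝ, 0 ≤ C ∧ ∀ ε : ℝ, 0 ≤ ε →
      |∫ x, Real.exp (-(ε * tau a x)) * k (tau a x) ∂mu R κ a -
        (∫ x, k (tau a x) ∂mu R κ a - ε * ∫ x, tau a x * k (tau a x) ∂mu R κ a)| ≤ C * ε ^ 2 := by
  obtain ⟨C, hC, hle⟩ := abs_exp_neg_sub_sum_le 2
  have hi0 := integrable_tau_pow_mul h hk hT 0
  have hi1 := integrable_tau_pow_mul h hk hT 1
  have hi2 := (integrable_tau_pow_mul h hk hT 2).norm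
  simp only [pow_zero, one_mul, pow_one] at hi0 hi1
  have hc := continuous_tau (d := d) h.a_pos
  refine ⟨C * ∫ x, ‖tau a x ^ 2 * k (tau a x)‖ ∂mu R κ a,
    mul_nonneg hC (integral_nonneg fun _ => norm_nonneg _), fun ε hε => ?_⟩
  have hie : Integrable (fun x => Real.exp (-(ε * tau a x)) * k (tau a x)) (mu R κ a) := by
    refine hi0.mono (by fun_prop) (.of_forall fun x => ?_)
    rw [norm_mul, Real.norm_eq_abs, Real.abs_exp]
    refine mul_le_of_le_one_left (norm_nonneg _) (Real.exp_le_one_iff.2 ?_)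
    have := mul_nonneg hε (tau_nonneg h.a_pos x)
    linarith
  have hi01 : Integrable (fun x => k (tau a x) - ε * (tau a x * k (tau a x))) (mu R κ a) := hi0.sub (hi1.const_mul ε)
  rw [← integral_const_mul, ← integral_sub hi0 (hi1.const_mul ε), ← integral_sub hie hi01, mul_right_comm, ← integral_const_mul,
    ← Real.norm_eq_abs]
  refine norm_integral_le_of_norm_le (hi2.const_mul _) (.of_forall fun x => ?_)
  have h1 := hle (ε * tau a x) (mul_nonneg hε (tau_nonneg h.a_pos x))
  simp only [Finset.sum_range_succ, Finset.sum_range_zero, zero_add, pow_zero, pow_one,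
    Nat.factorial_zero, Nat.factorial_one, Nat.cast_one, div_one] at h1
  calc _ = |Real.exp (-(ε * tau a x)) - (1 + -(ε * tau a x))| * |k (tau a x)| := by
        rw [← abs_mul, Real.norm_eq_abs]
        congr 1
        ring
    _ ≤ C * (ε * tau a x) ^ 2 * |k (tau a x)| := by gcongr
    _ = _ := by
        rw [norm_mul, norm_pow, Real.norm_eq_abs, Real.norm_eq_abs, sq_abs]
        ring

theorem exists_half_eq_nat (h : Admissible R κ a)
    (hs : genFourier R κ a '' schwartzSet R κ a ⊆ smoothSet R κ a) :
    ∃ n : ℕ, 1 ≤ n ∧ a / 2 = n := by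
  have ha := h.a_pos
  obtain ⟨f, hfS, hf⟩ := exists_testFunction h
  obtain ⟨g, hg, hu⟩ := hs ⟨f, hfS, rfl⟩
  have hk := continuous_testProfile ha
  have hkT : ∀ t, 2 ^ (a / 2) / a ≤ t → testProfile a t = 0 := fun t => testProfile_eq_zero ha
  set ν := lamA R κ a with hν
  -- This makes `(n + 1)/a ≥ (ν + 1) + 2`, so the Taylor remainder is still `O(ε²)` after division
  -- by `ε^{ν+1}`.
  obtain ⟨n, hn⟩ := exists_nat_ge (a * (ν + 3))
  obtain ⟨A, hodd, C₁, hC₁, hA⟩ := exists_expansion_of_smooth h _ hg hu n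
  obtain ⟨C₂, hC₂, hB⟩ := integral_exp_mul_profile_expansion h hk hkT
  set m₀ := ∫ x, testProfile a (tau a x) ∂mu R κ a
  set m₁ := ∫ x, tau a x * testProfile a (tau a x) ∂mu R κ a with hm₁
  have hm₁0 : (m₁ : ℂ) ≠ 0 := by exact_mod_cast (integral_tau_mul_testProfile_pos h).ne'
  -- With `ε = 1/c`, this is the difference of two expansions of the same integral `I`, the Taylor
  -- one and `m₀ - m₁ ε`; the constant `m₀` is merged into the term `m = 0`.
  have hO : (fun ε : ℝ => (∑ m ∈ Finset.range (n + 1), (A m - if m = 0 then (m₀ : ℂ) else 0) *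
      ((ε ^ ((m : ℝ) / a) : ℝ) : ℂ)) + m₁ * ((ε ^ (1 : ℝ) : ℝ) : ℂ))
      =O[nhdsWithin 0 (Set.Ioi 0)] fun ε => ε ^ (2 : ℝ) := by
    refine Asymptotics.IsBigO.of_bound (C₁ + C₂) ?_
    have hIio : Set.Iio (1 / 2 : ℝ) ∈ nhds (0 : ℝ) := Iio_mem_nhds (by norm_num)
    filter_upwards [self_mem_nhdsWithin, mem_nhdsWithin_of_mem_nhds hIio] with ε hε hε2
    have hε0 : (0 : ℝ) < ε := hε
    have hε2' : ε < 1 / 2 := hε2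
    have hpow : ∀ p : ℝ, ε⁻¹ ^ (-p) = ε ^ p := fun p => by
      rw [Real.rpow_neg (inv_nonneg.2 hε0.le), Real.inv_rpow hε0.le, inv_inv]
    have h1 := hA ε⁻¹ (by rw [le_inv_comm₀ two_pos hε0]; linarith)
    have h2 := hB ε hε0.le
    rw [integral_exp_mul_genFourier h hk hkT hf (inv_pos.2 hε0), inv_inv] at h1
    simp only [hpow, ← hν, Real.rpow_add hε0 (ν + 1)] at h1
    set I := ∫ x, Real.exp (-(ε * tau a x)) * testProfile a (tau a x) ∂mu R κ a
    set P := ε ^ (ν + 1) with hP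
    have hP0 : 0 < P := Real.rpow_pos_of_pos hε0 _
    have h3 : ‖(I : ℂ) - ∑ m ∈ Finset.range (n + 1), A m * ((ε ^ ((m : ℝ) / a) : ℝ) : ℂ)‖ ≤
        C₁ * ε ^ 2 := by
      have e : ((P * I : ℝ) : ℂ) - ∑ m ∈ Finset.range (n + 1), (P * ε ^ ((m : ℝ) / a)) • A m =
          P * ((I : ℂ) - ∑ m ∈ Finset.range (n + 1), A m * ((ε ^ ((m : ℝ) / a) : ℝ) : ℂ)) := by
        rw [mul_sub, Finset.mul_sum, Complex.ofReal_mul]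
        congr 1
        refine Finset.sum_congr rfl fun m _ => ?_
        rw [Complex.real_smul]
        push_cast
        ring
      rw [e, norm_mul, Complex.norm_real, Real.norm_of_nonneg hP0.le] at h1
      have h4 : ε ^ ((n + 1 : ℕ) / a : ℝ) ≤ P * ε ^ 2 := by
        rw [hP, ← Real.rpow_two, ← Real.rpow_add hε0]
        refine Real.rpow_le_rpow_of_exponent_ge hε0 (by linarith) ?_
        rw [le_div_iff₀ ha]
        push_cast
        linarith
      have h5 := h1.trans (mul_le_mul_of_nonneg_left h4 hC₁)
      refine le_of_mul_le_mul_left (h5.trans_eq (by ring)) hP0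
    have h4 : ‖(I : ℂ) - (m₀ - ε * m₁)‖ ≤ C₂ * ε ^ 2 := by
      have : (I : ℂ) - (m₀ - ε * m₁) = ((I - (m₀ - ε * m₁) : ℝ) : ℂ) := by push_cast; ring
      rw [this, Complex.norm_real]
      exact h2
    have e : (∑ m ∈ Finset.range (n + 1), (A m - if m = 0 then (m₀ : ℂ) else 0) *
        ((ε ^ ((m : ℝ) / a) : ℝ) : ℂ)) + m₁ * ((ε ^ (1 : ℝ) : ℝ) : ℂ) =
        ((I : ℂ) - (m₀ - ε * m₁)) -
          ((I : ℂ) - ∑ m ∈ Finset.range (n + 1), A m * ((ε ^ ((m : ℝ) / a) : ℝ) : ℂ)) := by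
      simp only [sub_mul, Finset.sum_sub_distrib, ite_mul, zero_mul, Real.rpow_one]
      rw [Finset.sum_ite_eq' (Finset.range (n + 1)) 0, if_pos (by simp)]
      simp
      ring
    rw [e, Real.rpow_two, Real.norm_of_nonneg (by positivity)]
    refine (norm_sub_le _ _).trans ?_
    linarith
  -- The term `m₁ ε` needs a partner with `m / a = 1`, so `m = a`; its coefficient is nonzero, which
  -- excludes odd `m`.
  obtain ⟨m, -, hm, hb⟩ := exists_exponent_eq _ _ _ hm₁0 one_lt_two hO
  rw [div_eq_one_iff_eq ha.ne'] at hm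
  have hm0 : m ≠ 0 := by
    rintro rfl
    simp at hm
    exact ha.ne hm
  rw [if_neg hm0, sub_zero] at hb
  obtain ⟨j, hj⟩ := Nat.not_odd_iff_even.1 fun ho => hb (hodd m ho)
  refine ⟨j, by omega, ?_⟩
  rw [← hm, hj]
  push_cast
  ring

end Main

/-! ### Rapid decrease of the transforms forces `2 / a` to be an integer -/

section Rapid

variable {R : Finset (E d)} {κ : E d → ℝ} {a : ℝ}

theorem integrable_indicator_norm_rpow (h : Admissible R κ a) {ρ : ℝ} (hρ : 0 < ρ) {p : ℝ}
    (hp : p + 2 * lam R κ + a < 0) :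
    Integrable (fun x : E d => (Set.Ioi ρ).indicator (fun r => r ^ p) ‖x‖) (mu R κ a) := by
  have h1 := integrable_mu h (integrable_weight_smul h (Q := fun _ => (1 : ℝ)) (M := 0)
    one_homogeneous continuous_const (ρ := (Set.Ioi ρ).indicator fun r => r ^ p) ?_)
  · simpa using h1
  · have h2 : IntegrableOn (fun r : ℝ => r ^ (p + 2 * lam R κ + a - 1)) (Set.Ioi ρ) :=
      integrableOn_Ioi_rpow_of_lt (by linarith) hρ
    have h3 : IntegrableOn ((Set.Ioi ρ).indicator fun r : ℝ => r ^ (p + 2 * lam R κ + a - 1))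
        (Set.Ioi 0) := (h2.integrable_indicator measurableSet_Ioi).integrableOn
    refine h3.congr_fun (fun r (hr : 0 < r) => ?_) measurableSet_Ioi
    by_cases hrρ : r ∈ Set.Ioi ρ
    · simp only [Set.indicator_of_mem hrρ, smul_eq_mul]
      rw [← Real.rpow_add hr]
      congr 1
      ring
    · simp only [Set.indicator_of_notMem hrρ, smul_zero]

/-- On a large ball `e^{-τ}` is bounded below, so integrability of `e^{-τ} u` suffices; outside it,
decay of order `N > a n + 2λ_κ + a` outweighs the moment and the measure. -/
theorem integrable_tau_pow_mul_of_rapid (h : Admissible R κ a) (u : L2 R κ a) {g : E d → ℂ}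
    (hg : ∀ N : ℕ, g =O[Filter.cocompact (E d)] fun x => (‖x‖ ^ N)⁻¹) (hu : u =ᵐ[mu R κ a] g)
    (n : ℕ) : Integrable (fun x => tau a x ^ n • u x) (mu R κ a) := by
  have ha := h.a_pos
  obtain ⟨N, hN⟩ := exists_nat_gt (a * n + 2 * lam R κ + a)
  obtain ⟨C, hC⟩ := (hg N).bound
  rw [← Metric.cobounded_eq_cocompact, (Metric.hasBasis_cobounded_compl_closedBall
    (0 : E d)).eventually_iff] at hC
  obtain ⟨ρ, -, hρ⟩ := hC
  set r₀ := max ρ 1 with hr₀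
  have hr₀1 : 1 ≤ r₀ := le_max_right _ _
  have hi1 := ((integrable_exp_mul h u one_pos).norm).const_mul
    ((r₀ ^ a / a) ^ n * Real.exp (r₀ ^ a / a))
  have hi2 := (integrable_indicator_norm_rpow h (ρ := r₀) (p := a * n - N) (by linarith)
    (by linarith)).const_mul ((a ^ n)⁻¹ * |C|)
  have hc := continuous_tau (d := d) ha
  refine (hi1.add hi2).mono' ((hc.pow n).aestronglyMeasurable.smul
    (Lp.aestronglyMeasurable u)) ?_
  filter_upwards [hu] with x hx
  have ht := tau_nonneg ha x
  rw [norm_smul, Real.norm_of_nonneg (pow_nonneg ht n), Pi.add_apply]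
  rcases le_or_gt ‖x‖ r₀ with hxr | hxr
  · have hle : tau a x ≤ r₀ ^ a / a := by
      rw [tau]
      gcongr
    have hind : 0 ≤ (Set.Ioi r₀).indicator (fun r : ℝ => r ^ (a * n - N)) ‖x‖ :=
      Set.indicator_nonneg (fun r (hr : r₀ < r) => Real.rpow_nonneg (by linarith) _) _
    have hexp : 1 ≤ Real.exp (r₀ ^ a / a) * Real.exp (-(1 * tau a x)) := by
      rw [← Real.exp_add]
      exact Real.one_le_exp (by linarith)
    have h1 : tau a x ^ n * ‖u x‖ ≤ (r₀ ^ a / a) ^ n * Real.exp (r₀ ^ a / a) *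
        ‖(Real.exp (-(1 * tau a x)) : ℂ) * u x‖ := by
      rw [norm_mul, Complex.norm_real, Real.norm_eq_abs, Real.abs_exp]
      calc _ ≤ (r₀ ^ a / a) ^ n * ‖u x‖ := by gcongr
        _ ≤ ((r₀ ^ a / a) ^ n * ‖u x‖) * (Real.exp (r₀ ^ a / a) * Real.exp (-(1 * tau a x))) :=
          le_mul_of_one_le_right (by positivity) hexp
        _ = _ := by ring
    refine h1.trans (le_add_of_nonneg_right (by positivity))
  · have hx0 : 0 < ‖x‖ := by linarith
    have hρx : ‖g x‖ ≤ C * ‖(‖x‖ ^ N)⁻¹‖ := by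
      refine hρ ?_
      rw [Set.mem_compl_iff, mem_closedBall_zero_iff, not_le]
      exact (le_max_left _ _).trans_lt hxr
    rw [Set.indicator_of_mem (show ‖x‖ ∈ Set.Ioi r₀ from hxr)]
    have h1 : tau a x ^ n = (a ^ n)⁻¹ * ‖x‖ ^ (a * n) := by
      have := tau_rpow_eq ha n x
      rwa [Real.rpow_natCast, Real.rpow_natCast] at this
    have h2 : ‖x‖ ^ (a * n - N) = ‖x‖ ^ (a * n) * (‖x‖ ^ N)⁻¹ := by
      rw [Real.rpow_sub hx0, Real.rpow_natCast, div_eq_mul_inv]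
    refine le_add_of_nonneg_of_le (by positivity) ?_
    rw [hx, h1, h2]
    rw [Real.norm_of_nonneg (by positivity)] at hρx
    calc _ ≤ (a ^ n)⁻¹ * ‖x‖ ^ (a * n) * (|C| * (‖x‖ ^ N)⁻¹) := by
          refine mul_le_mul_of_nonneg_left (hρx.trans ?_) (by positivity)
          exact mul_le_mul_of_nonneg_right (le_abs_self C) (by positivity)
      _ = _ := by ring

theorem norm_exp_smul_sub_sum_le {K : ℕ} {C : ℝ} (hle : ∀ s : ℝ, 0 ≤ s →
    |Real.exp (-s) - ∑ k ∈ Finset.range K, (-s) ^ k / (k.factorial : ℝ)| ≤ C * s ^ K)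
    {c t : ℝ} (hc : 0 ≤ c) (ht : 0 ≤ t) (z : ℂ) :
    ‖(Real.exp (-(c * t)) : ℂ) * z - ∑ k ∈ Finset.range K,
      ((-1) ^ k / k.factorial * c ^ k : ℝ) • (t ^ k • z)‖ ≤ C * c ^ K * ‖t ^ K • z‖ := by
  have e : (Real.exp (-(c * t)) : ℂ) * z - ∑ k ∈ Finset.range K,
      ((-1) ^ k / k.factorial * c ^ k : ℝ) • (t ^ k • z) =
      (Real.exp (-(c * t)) - ∑ k ∈ Finset.range K, (-(c * t)) ^ k / (k.factorial : ℝ)) • z := by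
    rw [sub_smul, Complex.real_smul, Finset.sum_smul]
    congr 1
    refine Finset.sum_congr rfl fun k _ => ?_
    rw [smul_smul, neg_pow (c * t), mul_pow]
    congr 1
    ring
  rw [e, norm_smul, norm_smul, Real.norm_eq_abs, Real.norm_of_nonneg (pow_nonneg ht K)]
  calc _ ≤ C * (c * t) ^ K * ‖z‖ :=
        mul_le_mul_of_nonneg_right (hle _ (mul_nonneg hc ht)) (norm_nonneg z)
    _ = _ := by
      rw [mul_pow]
      ring

/-- A rapidly decreasing function has an asymptotic expansion of its integral against
`exp(-c |x|^a / a)` in integral powers of `c`, as `c → 0`. -/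
theorem exists_expansion_of_rapid (h : Admissible R κ a) (u : L2 R κ a)
    (hu : ∀ n : ℕ, Integrable (fun x => tau a x ^ n • u x) (mu R κ a)) (K : ℕ) :
    ∃ A : ℕ → ℂ, ∃ C : ℝ, 0 ≤ C ∧ ∀ c : ℝ, 0 < c →
      ‖∫ x, (Real.exp (-(c * tau a x)) : ℂ) * u x ∂mu R κ a -
        ∑ k ∈ Finset.range K, A k * ((c ^ k : ℝ) : ℂ)‖ ≤ C * c ^ K := by
  obtain ⟨C, hC, hle⟩ := abs_exp_neg_sub_sum_le K
  refine ⟨fun k => ((-1) ^ k / k.factorial : ℝ) • ∫ x, tau a x ^ k • u x ∂mu R κ a,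
    C * ∫ x, ‖tau a x ^ K • u x‖ ∂mu R κ a,
    mul_nonneg hC (integral_nonneg fun _ => norm_nonneg _), fun c hc => ?_⟩
  have hterm : ∀ k ∈ Finset.range K, Integrable (fun x => ((-1) ^ k / k.factorial * c ^ k : ℝ) •
      (tau a x ^ k • u x)) (mu R κ a) := fun k _ =>
    (hu k).smul ((-1) ^ k / k.factorial * c ^ k : ℝ)
  have e : ∑ k ∈ Finset.range K, (((-1) ^ k / k.factorial : ℝ) •
      ∫ x, tau a x ^ k • u x ∂mu R κ a) * ((c ^ k : ℝ) : ℂ) =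
      ∫ x, ∑ k ∈ Finset.range K, ((-1) ^ k / k.factorial * c ^ k : ℝ) •
        (tau a x ^ k • u x) ∂mu R κ a := by
    rw [integral_finsetSum _ hterm]
    refine Finset.sum_congr rfl fun k _ => ?_
    rw [integral_smul, Complex.real_smul, Complex.real_smul, Complex.ofReal_mul]
    ring
  rw [e, ← integral_sub (integrable_exp_mul h u hc) (integrable_finsetSum _ hterm), mul_right_comm,
    ← integral_const_mul]
  exact norm_integral_le_of_norm_le ((hu K).norm.const_mul _) (.of_forall fun x =>
    norm_exp_smul_sub_sum_le hle hc.le (tau_nonneg h.a_pos x) (u x))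

/-- The profile is replaced by `(aτ)^{2/a}`, with error at most `(aτ)^{4/a}`. The moment of order
`s` against `e^{-τ/c}` is a multiple of `c^{ν+1+s}`, and the prefactor leaves `c^s`. -/
theorem integral_exp_mul_testProfile_expansion (h : Admissible R κ a) :
    ∃ A : ℝ, 0 < A ∧ ∃ C : ℝ, ∀ c : ℝ, 0 < c →
      |c ^ (-(lamA R κ a + 1)) *
        ∫ x, Real.exp (-(c⁻¹ * tau a x)) * testProfile a (tau a x) ∂mu R κ a -
          A * c ^ (2 / a)| ≤ C * c ^ (4 / a) := by
  have ha := h.a_pos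
  obtain ⟨K, hK, hint⟩ := exists_integral_tau h
  have hν := h.lamA_pos
  have h2a : 0 ≤ 2 / a := by positivity
  have h4a : 0 ≤ 4 / a := by positivity
  refine ⟨a ^ (2 / a) * (K * Real.Gamma (lamA R κ a + 1 + 2 / a)),
    mul_pos (by positivity) (mul_pos hK (Real.Gamma_pos_of_pos (by positivity))),
    a ^ (4 / a) * (K * Real.Gamma (lamA R κ a + 1 + 4 / a)), fun c hc => ?_⟩
  have hc' := inv_pos.2 hc
  have hpow : ∀ p : ℝ, c⁻¹ ^ (-p) = c ^ p := fun p => by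
    rw [Real.rpow_neg hc'.le, Real.inv_rpow hc.le, inv_inv]
  have hval : ∀ s : ℝ, 0 ≤ s → c ^ (-(lamA R κ a + 1)) *
      ∫ x, (a * tau a x) ^ s * Real.exp (-(c⁻¹ * tau a x)) ∂mu R κ a =
      a ^ s * (K * Real.Gamma (lamA R κ a + 1 + s)) * c ^ s := by
    intro s hs
    have e : ∀ x : E d, (a * tau a x) ^ s * Real.exp (-(c⁻¹ * tau a x)) =
        a ^ s * (tau a x ^ s * Real.exp (-(c⁻¹ * tau a x))) := by
      intro x
      rw [Real.mul_rpow ha.le (tau_nonneg ha x)]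
      ring
    simp only [e]
    rw [integral_const_mul, hint s _ hs hc', hpow, Real.rpow_add hc, Real.rpow_neg hc.le]
    have : c ^ (lamA R κ a + 1) ≠ 0 := (Real.rpow_pos_of_pos hc _).ne'
    field_simp
  have hi : ∀ s : ℝ, 0 ≤ s → Integrable
      (fun x => (a * tau a x) ^ s * Real.exp (-(c⁻¹ * tau a x))) (mu R κ a) := by
    intro s hs
    refine ((integrable_tau h hs hc').const_mul (a ^ s)).congr (.of_forall fun x => ?_)
    beta_reduce
    rw [Real.mul_rpow ha.le (tau_nonneg ha x)]
    ring
  have hk := continuous_testProfile ha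
  have hct := continuous_tau (d := d) ha
  have hik : Integrable (fun x => Real.exp (-(c⁻¹ * tau a x)) * testProfile a (tau a x))
      (mu R κ a) := by
    have hi0 := integrable_tau_pow_mul h hk (fun t ht => testProfile_eq_zero ha ht) 0
    simp only [pow_zero, one_mul] at hi0
    refine hi0.mono (by fun_prop) (.of_forall fun x => ?_)
    rw [norm_mul, Real.norm_eq_abs, Real.abs_exp]
    refine mul_le_of_le_one_left (norm_nonneg _) (Real.exp_le_one_iff.2 ?_)
    have := mul_nonneg hc'.le (tau_nonneg ha x)
    linarith
  rw [← hval _ h2a, ← hval _ h4a, ← mul_sub, abs_mul, abs_of_pos (Real.rpow_pos_of_pos hc _),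
    ← integral_sub hik (hi _ h2a)]
  refine mul_le_mul_of_nonneg_left ?_ (Real.rpow_nonneg hc.le _)
  rw [← Real.norm_eq_abs]
  refine norm_integral_le_of_norm_le (hi _ h4a) (.of_forall fun x => ?_)
  rw [mul_comm, ← sub_mul, norm_mul, Real.norm_eq_abs, Real.norm_eq_abs, Real.abs_exp]
  exact mul_le_mul_of_nonneg_right (abs_testProfile_sub_le ha (tau_nonneg ha x)) (Real.exp_pos _).le

theorem exists_two_div_eq_nat (h : Admissible R κ a)
    (hs : genFourier R κ a '' schwartzSet R κ a ⊆ rapidSet R κ a) :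
    ∃ n : ℕ, 1 ≤ n ∧ 2 / a = n := by
  have ha := h.a_pos
  obtain ⟨f, hfS, hf⟩ := exists_testFunction h
  obtain ⟨g, hg, hu⟩ := hs ⟨f, hfS, rfl⟩
  -- For `c < 1` this puts the remainder `c^K` below `c^{4/a}`, the error on the other side.
  obtain ⟨K, hK⟩ := exists_nat_ge (4 / a)
  obtain ⟨A, C₁, hC₁, hA⟩ := exists_expansion_of_rapid h _
    (integrable_tau_pow_mul_of_rapid h _ hg hu) K
  obtain ⟨A₁, hA₁, C₂, hB⟩ := integral_exp_mul_testProfile_expansion h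
  have hβ : (-A₁ : ℂ) ≠ 0 := neg_ne_zero.2 (by exact_mod_cast hA₁.ne')
  have hO : (fun c : ℝ => (∑ k ∈ Finset.range K, A k * ((c ^ (k : ℝ) : ℝ) : ℂ)) +
      -A₁ * ((c ^ (2 / a) : ℝ) : ℂ)) =O[nhdsWithin 0 (Set.Ioi 0)] fun c => c ^ (4 / a) := by
    refine Asymptotics.IsBigO.of_bound (C₁ + C₂) ?_
    filter_upwards [self_mem_nhdsWithin, mem_nhdsWithin_of_mem_nhds (Iio_mem_nhds one_pos)]
      with c hc hc1
    have hc0 : (0 : ℝ) < c := hc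
    have hc1' : c < 1 := hc1
    have h1 := hA c hc0
    have h2 := hB c hc0
    rw [integral_exp_mul_genFourier h (continuous_testProfile ha)
      (fun t ht => testProfile_eq_zero ha ht) hf hc0] at h1
    set J := c ^ (-(lamA R κ a + 1)) *
      ∫ x, Real.exp (-(c⁻¹ * tau a x)) * testProfile a (tau a x) ∂mu R κ a
    have h3 : ‖(J : ℂ) - A₁ * ((c ^ (2 / a) : ℝ) : ℂ)‖ ≤ C₂ * c ^ (4 / a) := by
      rw [← Complex.ofReal_mul, ← Complex.ofReal_sub, Complex.norm_real]
      exact h2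
    have h4 : c ^ K ≤ c ^ (4 / a) := by
      rw [← Real.rpow_natCast]
      exact Real.rpow_le_rpow_of_exponent_ge hc0 hc1'.le hK
    have e : (∑ k ∈ Finset.range K, A k * ((c ^ (k : ℝ) : ℝ) : ℂ)) +
        -A₁ * ((c ^ (2 / a) : ℝ) : ℂ) = ((J : ℂ) - A₁ * ((c ^ (2 / a) : ℝ) : ℂ)) -
          ((J : ℂ) - ∑ k ∈ Finset.range K, A k * ((c ^ k : ℝ) : ℂ)) := by
      simp only [Real.rpow_natCast]
      ring
    rw [e, Real.norm_of_nonneg (Real.rpow_nonneg hc0.le _)]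
    refine (norm_sub_le _ _).trans ?_
    have := h1.trans (mul_le_mul_of_nonneg_left h4 hC₁)
    linarith
  have hlt : 2 / a < 4 / a := by
    gcongr
    norm_num
  obtain ⟨k, -, hk, -⟩ := exists_exponent_eq _ _ _ hβ hlt hO
  refine ⟨k, Nat.one_le_iff_ne_zero.2 ?_, hk.symm⟩
  rintro rfl
  have : 0 < 2 / a := by positivity
  rw [← hk] at this
  simp at this

theorem schwartzSet_subset_smoothSet : schwartzSet R κ a ⊆ smoothSet R κ a :=
  fun _ ⟨f, hf⟩ => ⟨f, f.smooth', hf⟩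

theorem schwartzSet_subset_rapidSet : schwartzSet R κ a ⊆ rapidSet R κ a := by
  rintro u ⟨f, hf⟩
  refine ⟨f, fun N => ?_, hf⟩
  have := f.isBigO_cocompact_zpow_neg_nat N
  simpa only [zpow_neg, zpow_natCast] using this

/-- The integers `a/2` and `2/a` have product `1`. Only the inclusion is used, so this covers both
the equality statement and the failure of invariance. -/
theorem eq_two_of_image_subset (h : Admissible R κ a)
    (hs : genFourier R κ a '' schwartzSet R κ a ⊆ schwartzSet R κ a) : a = 2 := by
  obtain ⟨n, hn, hn2⟩ := exists_half_eq_nat h (hs.trans schwartzSet_subset_smoothSet)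
  obtain ⟨m, hm, hm2⟩ := exists_two_div_eq_nat h (hs.trans schwartzSet_subset_rapidSet)
  have ha := h.a_pos
  have h1 : (n : ℝ) * m = 1 := by
    rw [← hn2, ← hm2]
    field_simp
  have h2 : n = 1 := Nat.eq_one_of_mul_eq_one_right (by exact_mod_cast h1)
  rw [h2] at hn2
  push_cast at hn2
  linarith

end Rapid

end DunklA

end

theorem mainTheorem6 (d : ℕ) (hd : 1 ≤ d)
    (R : Finset (DunklA.E d)) (hR : DunklA.IsRootSystem R)
    (κ : DunklA.E d → ℝ) (hκ : DunklA.IsMultiplicity R κ)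
    (a : ℝ) (ha : 0 < a) (hpos : 0 < 2 * DunklA.lam R κ + a) :
    (DunklA.genFourier R κ a '' DunklA.schwartzSet R κ a ⊆ DunklA.smoothSet R κ a →
      ∃ n : ℕ, 1 ≤ n ∧ a / 2 = n) ∧
    (DunklA.genFourier R κ a '' DunklA.schwartzSet R κ a ⊆ DunklA.rapidSet R κ a →
      ∃ n : ℕ, 1 ≤ n ∧ 2 / a = n) ∧
    (DunklA.genFourier R κ a '' DunklA.schwartzSet R κ a = DunklA.schwartzSet R κ a → a = 2) ∧
    (a ≠ 2 →
      ¬ DunklA.genFourier R κ a '' DunklA.schwartzSet R κ a ⊆ DunklA.schwartzSet R κ a) :=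
  have h : DunklA.Admissible R κ a := ⟨hd, hR, hκ, ha, hpos⟩
  ⟨DunklA.exists_half_eq_nat h, DunklA.exists_two_div_eq_nat h,
    fun hs => DunklA.eq_two_of_image_subset h hs.subset,
    fun ha2 hs => ha2 (DunklA.eq_two_of_image_subset h hs)⟩
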